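/- Let $(N,g,\mathcal D)$ be a four-dimensional Walker manifold: $N$ is a smooth 4-manifold, $g$ a smooth pseudo-Riemannian metric on $N$, and $\mathcal D\subset TN$ a smooth distribution of rank two that is null ($g|_{\mathcal D}=0$) and parallel for the Levi-Civita connection of $g$; then $g$ has signature $(2,2)$. Give $N$ the canonical orientation determined by $\mathcal D$: a basis $(u_1,u_2,d_1,d_2)$ of $T_pN$ with $d_1,d_2\in\mathcal D_p$ and $g(u_i,d_j)=\delta_{ij}$ is positively oriented (equivalently, the bivector $d_1\wedge d_2$ is self-dual). Let $W$ be the Weyl tensor of $g$, $\star$ the Hodge star operator on two-forms, and $W_-=\frac12(W-\star W)$. One says that $(N,g,\mathcal D)$ is self-dual if $W_-=0$. For a surface $\Sigma$ (a smooth 2-manifold) with a smooth torsion free affine connection $\nabla$, a smooth vector field $X$, a smooth $(1,1)$-tensor field $T$ and a smooth symmetric $(0,2)$-tensor field $\Phi$, let $\pi:T^*\Sigma\to\Sigma$ be the projection and consider on $T^*\Sigma$ the metric $$ g_{X,T,\nabla,\Phi}=\iota X\,(\iota\operatorname{id}\circ\iota\operatorname{id})+\iota\operatorname{id}\circ\iota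 T+g_\nabla+\pi^*\Phi . $$ Here $\iota X(p,\omega)=\omega(X_p)$; $\iota T$ is the one-form $(\iota T)_{(p,\omega)}(\xi)=\omega(T\pi_*\xi)$; $\alpha\circ\beta=\frac12(\alpha\otimes\beta+\beta\otimes\alpha)$; and $g_\nabla$ is the Riemannian extension of $\nabla$, characterized by $g_\nabla(Y^C,Z^C)=-\iota(\nabla_YZ+\nabla_ZY)$ on complete lifts of vector fields $Y,Z$ on $\Sigma$, that is, $g_\nabla=2\,dx^i\circ dx^{i'}-2x_{k'}\Gamma_{ij}{}^k\,dx^i\circ dx^j$ in the coordinates $(x_i,x_{i'})$ of $T^*\Sigma$, $\omega=\sum x_{i'}dx^i$, induced by local coordinates $(x_i)$ of $\Sigma$. Give $T^*\Sigma$ the canonical orientation determined in the same way by the null distribution $\ker\pi_*$. **Theorem.** The following conditions on a four-dimensional Walker manifold $(N,g,\mathcal D)$ are equivalent. 1. $(N,g,\mathcal D)$ is self-dual. 2. Every point of $N$ has a neighbourhood that is isometric, by an orientation preserving isometry, to an open subset of some $(T^*\Sigma,g_{X,T,\nabla,\Phi})$, with $\Sigma,\nabla,X,T,\Phi$ as above.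 3. Every point of $N$ has a neighbourhood that is isometric to an open subset of some $(T^*\Sigma,g_{X,T,\nabla,\Phi})$, with $\Sigma,\nabla,X,T,\Phi$ as above, by an isometry that takes $\mathcal D$ to $\ker\pi_*$. -/

import Mathlib

open scoped Manifold ContDiff Topology

noncomputable section

namespace Walker

/-- The model space `ℝⁿ`. -/
abbrev E (n : ℕ) : Type := EuclideanSpace ℝ (Fin n)

/-- The `i`-th standard basis vector of `ℝ⁴`. -/
abbrev e (i : Fin 4) : E 4 := EuclideanSpace.single i 1

section LocalGeometry

/-! ### Curvature of a metric in coordinates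

Here `g` is a field of bilinear forms on (an open part of) `ℝ⁴`: `g y v w` is the value of the
metric at the point `y` on the vectors `v`, `w`. -/

variable (g : E 4 → E 4 →L[ℝ] E 4 →L[ℝ] ℝ)

/-- The matrix `(g_ij)` at `y`. -/
def gram (y : E 4) : Matrix (Fin 4) (Fin 4) ℝ := Matrix.of fun i j => g y (e i) (e j)

/-- The Christoffel symbols of the first kind,
`Γ_{ijk} = 1/2 (∂_i g_{jk} + ∂_j g_{ik} - ∂_k g_{ij})`, extended trilinearly to vectors. -/
def christoffelFirst (y v w u : E 4) : ℝ :=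
  (1 / 2) * (fderiv ℝ g y v w u + fderiv ℝ g y w v u - fderiv ℝ g y u v w)

/-- The Christoffel symbols `Γ_{ij}^k = g^{kl} Γ_{ijl}`, as the vector `Γ(v, w)`. -/
def christoffel (y v w : E 4) : E 4 :=
  ∑ k, (∑ l, (gram g y)⁻¹ k l * christoffelFirst g y v w (e l)) • e k

/-- The curvature operator `R(u, v) w = ∇_u ∇_v w - ∇_v ∇_u w - ∇_[u,v] w` of the Levi-Civita
connection, evaluated on constant coordinate fields. -/
def riemann (y u v w : E 4) : E 4 :=
  fderiv ℝ (fun y' => christoffel g y' v w) y u - fderiv ℝ (fun y' => christoffel g y' u w) y v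
    + christoffel g y u (christoffel g y v w) - christoffel g y v (christoffel g y u w)

/-- The Ricci tensor `ρ(v, w) = Tr {u ↦ R(u, v) w}`. -/
def ricci (y v w : E 4) : ℝ := ∑ i, riemann g y (e i) v w i

/-- The scalar curvature `τ = g^{ij} ρ_{ij}`. -/
def scalar (y : E 4) : ℝ := ∑ i, ∑ j, (gram g y)⁻¹ i j * ricci g y (e i) (e j)

/-- The Weyl conformal curvature tensor in dimension four, with all arguments lowered:
the totally trace-free part of `(u, v, w, z) ↦ g(R(u, v) w, z)`. -/
def weyl (y u v w z : E 4) : ℝ :=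
  g y (riemann g y u v w) z
    - (1 / 2) * (ricci g y v w * g y u z + g y v w * ricci g y u z
        - ricci g y u w * g y v z - g y u w * ricci g y v z)
    + (scalar g y / 6) * (g y v w * g y u z - g y u w * g y v z)

end LocalGeometry

section LinearAlgebra

variable {V : Type*} [AddCommGroup V] [Module ℝ V]

/-- A basis `(u₁, u₂, d₁, d₂)` of a four-dimensional space with inner product `B` and a null plane
`D` is adapted if `d₁, d₂ ∈ D` and `B(u_i, d_j) = δ_ij`. Passing between two adapted bases has
determinant `1`, so the adapted bases define an orientation (the canonical orientation determined
by `D`; the bivector `d₁ ∧ d₂` is self-dual for it), and every adapted basis has Gram determinant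
`1`, hence unit volume. In Walker coordinates `(x₁, x₂, x₁', x₂')`, the coordinate frame is an
adapted basis. -/
def IsAdapted (B : V → V → ℝ) (D : Submodule ℝ V) (b : Module.Basis (Fin 4) ℝ V) : Prop :=
  b 2 ∈ D ∧ b 3 ∈ D ∧ B (b 0) (b 2) = 1 ∧ B (b 0) (b 3) = 0 ∧ B (b 1) (b 2) = 0 ∧ B (b 1) (b 3) = 1

/-- The Hodge star operator on two-forms of a four-dimensional space with inner product `B`,
oriented by the basis `b`:
`(⋆α)(v, w) = 1/2 ∑ vol(v, w, b_k, b_l) g^{km} g^{ln} α(b_m, b_n)`, where `g_ij = B(b_i, b_j)` and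
`vol = |det g|^{1/2} b¹ ∧ b² ∧ b³ ∧ b⁴` is the oriented volume form. -/
def hodgeStar (B : V → V → ℝ) (b : Module.Basis (Fin 4) ℝ V) (α : V → V → ℝ) (v w : V) : ℝ :=
  let G : Matrix (Fin 4) (Fin 4) ℝ := Matrix.of fun i j => B (b i) (b j)
  (1 / 2) * ∑ k, ∑ l, ∑ m, ∑ n,
    (Real.sqrt |G.det| * b.det ![v, w, b k, b l]) * G⁻¹ k m * G⁻¹ l n * α (b m) (b n)

end LinearAlgebra

section Manifold

variable {N : Type*} [TopologicalSpace N] [ChartedSpace (E 4) N] [IsManifold (𝓡 4) ∞ N]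

variable (N) in
/-- A smooth pseudo-Riemannian metric on a four-dimensional manifold. -/
structure Metric where
  /-- The inner product on each tangent space. -/
  val : ∀ p : N, TangentSpace (𝓡 4) p →L[ℝ] TangentSpace (𝓡 4) p →L[ℝ] ℝ
  symm : ∀ p v w, val p v w = val p w v
  nondegenerate : ∀ p v, (∀ w, val p v w = 0) → v = 0
  smooth : ContMDiff (𝓡 4) ((𝓡 4).prod 𝓘(ℝ, E 4 →L[ℝ] E 4 →L[ℝ] ℝ)) ∞
    (fun p => Bundle.TotalSpace.mk' (E 4 →L[ℝ] E 4 →L[ℝ] ℝ)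
      (E := fun p : N => TangentSpace (𝓡 4) p →L[ℝ] TangentSpace (𝓡 4) p →L[ℝ] ℝ) p (val p))

/-- The metric `g` in the coordinates given by the preferred chart at `p`. -/
def Metric.inChart (g : Metric N) (p : N) (y : E 4) : E 4 →L[ℝ] E 4 →L[ℝ] ℝ :=
  let L : E 4 →L[ℝ] E 4 := mfderiv (𝓡 4) (𝓡 4) (extChartAt (𝓡 4) p).symm y
  ContinuousLinearMap.bilinearComp (g.val ((extChartAt (𝓡 4) p).symm y)) L L

/-- The vector field `Y` in the coordinates given by the preferred chart at `p`. -/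
def fieldInChart (p : N) (Y : ∀ q : N, TangentSpace (𝓡 4) q) (y : E 4) : E 4 :=
  mfderiv (𝓡 4) (𝓡 4) (extChartAt (𝓡 4) p) ((extChartAt (𝓡 4) p).symm y)
    (Y ((extChartAt (𝓡 4) p).symm y))

/-- The Levi-Civita covariant derivative `(∇^g_v Y)(p) = v(Y) + Γ(v, Y(p))`, computed in the
preferred chart at `p`, whose coordinate frame at `p` identifies `T_pN` with `ℝ⁴`. -/
def Metric.nabla (g : Metric N) (p : N) (v : TangentSpace (𝓡 4) p)
    (Y : ∀ q : N, TangentSpace (𝓡 4) q) : TangentSpace (𝓡 4) p :=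
  (fderiv ℝ (fieldInChart p Y) (extChartAt (𝓡 4) p p) v
    + christoffel (g.inChart p) (extChartAt (𝓡 4) p p) v (Y p) : E 4)

/-- The Weyl tensor of `g` at the point `p`. -/
def Metric.weylAt (g : Metric N) (p : N) (u v w z : TangentSpace (𝓡 4) p) : ℝ :=
  weyl (g.inChart p) (extChartAt (𝓡 4) p p) u v w z

/-- `Y` is a smooth vector field on the set `U`. -/
def SmoothFieldOn (U : Set N) (Y : ∀ q : N, TangentSpace (𝓡 4) q) : Prop :=
  ContMDiffOn (𝓡 4) (𝓡 4).tangent ∞ (fun q => (⟨q, Y q⟩ : TangentBundle (𝓡 4) N)) U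

/-- A Walker structure for `g`: a smooth parallel null distribution of rank two. -/
structure WalkerDistribution (g : Metric N) where
  /-- The plane of the distribution at each point. -/
  plane : ∀ p : N, Submodule ℝ (TangentSpace (𝓡 4) p)
  rank_two : ∀ p, Module.finrank ℝ (plane p) = 2
  smooth : ∀ p, ∃ U : Set N, IsOpen U ∧ p ∈ U ∧
    ∃ Y₁ Y₂ : ∀ q : N, TangentSpace (𝓡 4) q, SmoothFieldOn U Y₁ ∧ SmoothFieldOn U Y₂ ∧
      ∀ q ∈ U, plane q = Submodule.span ℝ {Y₁ q, Y₂ q}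
  null : ∀ p, ∀ v ∈ plane p, ∀ w ∈ plane p, g.val p v w = 0
  parallel : ∀ (U : Set N), IsOpen U → ∀ Y : ∀ q : N, TangentSpace (𝓡 4) q, SmoothFieldOn U Y →
    (∀ q ∈ U, Y q ∈ plane q) → ∀ p ∈ U, ∀ v : TangentSpace (𝓡 4) p, g.nabla p v Y ∈ plane p

/-- The anti-self-dual part `W_- = 1/2 (W - ⋆W)` of the Weyl tensor at `p`, for the orientation of
`T_pN` given by the basis `b`; the star acts on the first pair of arguments. -/
def Metric.weylMinus (g : Metric N) (p : N) (b : Module.Basis (Fin 4) ℝ (TangentSpace (𝓡 4) p))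
    (u v w z : TangentSpace (𝓡 4) p) : ℝ :=
  (1 / 2) * (g.weylAt p u v w z
    - hodgeStar (fun x y => g.val p x y) b (fun x y => g.weylAt p x y w z) u v)

/-- The Walker metric `g` is self-dual: `W_- = 0` for the canonical orientation, that is, the
orientation of the adapted bases. -/
def IsSelfDual (g : Metric N) (D : WalkerDistribution g) : Prop :=
  ∀ (p : N) (b : Module.Basis (Fin 4) ℝ (TangentSpace (𝓡 4) p)),
    IsAdapted (fun x y => g.val p x y) (D.plane p) b → ∀ u v w z, g.weylMinus p b u v w z = 0

end Manifold

section Cotangent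

variable (S : Type) [TopologicalSpace S] [ChartedSpace (E 2) S] [IsManifold (𝓡 2) ∞ S]

/-- The cotangent bundle `T*Σ` of a surface: its points are the pairs `(p, ω)`, `ω ∈ T*_pΣ`. -/
abbrev Cotangent : Type :=
  Bundle.TotalSpace (E 2 →L[ℝ] ℝ) (fun p : S => TangentSpace (𝓡 2) p →L[ℝ] ℝ)

/-- The model with corners of the four-dimensional manifold `T*Σ`. -/
abbrev cotModel : ModelWithCorners ℝ (E 2 × (E 2 →L[ℝ] ℝ)) (ModelProd (E 2) (E 2 →L[ℝ] ℝ)) :=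
  (𝓡 2).prod 𝓘(ℝ, E 2 →L[ℝ] ℝ)

variable {S}

/-- The differential `π_* : T_(p,ω)(T*Σ) → T_pΣ` of the projection `π : T*Σ → Σ`. -/
def dproj (z : Cotangent S) : TangentSpace cotModel z →L[ℝ] TangentSpace (𝓡 2) z.proj :=
  mfderiv cotModel (𝓡 2) (Bundle.TotalSpace.proj : Cotangent S → S) z

/-- The vertical distribution `ker π_*`. -/
def vertical (z : Cotangent S) : Submodule ℝ (TangentSpace cotModel z) :=
  LinearMap.ker (dproj z).toLinearMap

/-- The function `ιX (p, ω) = ω(X_p)` on `T*Σ`. -/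
def iotaField (X : ∀ p : S, TangentSpace (𝓡 2) p) (z : Cotangent S) : ℝ := z.2 (X z.proj)

/-- The one-form `ιT` on `T*Σ`, `(ιT)_(p,ω)(ξ) = ω(T(π_* ξ))`. As `π_*` takes the complete lift
`X^C` to `X`, it is the one-form with `(ιT)(X^C) = ι(TX)`. -/
def iotaEnd (T : ∀ p : S, TangentSpace (𝓡 2) p →L[ℝ] TangentSpace (𝓡 2) p) (z : Cotangent S)
    (ξ : TangentSpace cotModel z) : ℝ :=
  z.2 (T z.proj (dproj z ξ))

/-- The one-form `ι id`. -/
def iotaId (z : Cotangent S) (ξ : TangentSpace cotModel z) : ℝ :=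
  iotaEnd (fun p => ContinuousLinearMap.id ℝ (TangentSpace (𝓡 2) p)) z ξ

/-- The symmetric product `1/2 (α ⊗ β + β ⊗ α)` of two covectors. -/
def symProd {V : Type*} (α β : V → ℝ) (ξ η : V) : ℝ := (1 / 2) * (α ξ * β η + β ξ * α η)

/-- The expression `ξ(ιY) - ω(∇_{π_* ξ} Y)`, for `ξ ∈ T_(p,ω)(T*Σ)`, as a function of the vector
`Y_p = y`. By the Leibniz rule it does not depend on how `y` is extended to a vector field `Y`;
the extension that is constant in the trivialization at `p` is used. -/
def vertPart (nab : CovariantDerivative (𝓡 2) (E 2) (fun p : S => TangentSpace (𝓡 2) p))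
    (z : Cotangent S) (ξ : TangentSpace cotModel z) (y : TangentSpace (𝓡 2) z.proj) : ℝ :=
  let Y : ∀ p : S, TangentSpace (𝓡 2) p := FiberBundle.extend (E 2) y
  mvfderiv cotModel (iotaField Y) z ξ - z.2 (nab Y z.proj (dproj z ξ))

/-- The Riemannian extension `g_∇` of a torsion free connection:
`g_∇(ξ, η) = {ξ(ιY) - ω(∇_{π_* ξ} Y)} + {η(ιX) - ω(∇_{π_* η} X)}` at `(p, ω)`, for vector fields
`X`, `Y` with `X_p = π_* ξ`, `Y_p = π_* η`. For complete lifts, `X^C(ιY) = ι[X, Y] = -Y^C(ιX)`, so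
that `g_∇(X^C, Y^C) = -ι(∇_X Y + ∇_Y X)`; in coordinates
`g_∇ = 2 dx^i ∘ dx^{i'} - 2 x_{k'} Γ_{ij}^k dx^i ∘ dx^j`. -/
def riemannianExtension
    (nab : CovariantDerivative (𝓡 2) (E 2) (fun p : S => TangentSpace (𝓡 2) p))
    (z : Cotangent S) (ξ η : TangentSpace cotModel z) : ℝ :=
  vertPart nab z ξ (dproj z η) + vertPart nab z η (dproj z ξ)

variable (S) in
/-- A smooth torsion free affine connection `∇`, a smooth vector field `X`, a smooth
`(1,1)`-tensor field `T` and a smooth symmetric `(0,2)`-tensor field `Φ` on a surface. -/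
structure SurfaceData where
  /-- The connection `∇`; `nab Y p v` is `(∇_v Y)(p)`. -/
  nab : CovariantDerivative (𝓡 2) (E 2) (fun p : S => TangentSpace (𝓡 2) p)
  nab_smooth : CovariantDerivative.ContMDiffCovariantDerivative nab ∞
  nab_torsion : nab.torsion = 0
  /-- The vector field `X`. -/
  X : ∀ p : S, TangentSpace (𝓡 2) p
  X_smooth : ContMDiff (𝓡 2) (𝓡 2).tangent ∞ (fun p => (⟨p, X p⟩ : TangentBundle (𝓡 2) S))
  /-- The endomorphism field `T`. -/
  T : ∀ p : S, TangentSpace (𝓡 2) p →L[ℝ] TangentSpace (𝓡 2) p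
  T_smooth : ContMDiff (𝓡 2) ((𝓡 2).prod 𝓘(ℝ, E 2 →L[ℝ] E 2)) ∞
    (fun p => Bundle.TotalSpace.mk' (E 2 →L[ℝ] E 2)
      (E := fun p : S => TangentSpace (𝓡 2) p →L[ℝ] TangentSpace (𝓡 2) p) p (T p))
  /-- The symmetric tensor field `Φ`. -/
  Phi : ∀ p : S, TangentSpace (𝓡 2) p →L[ℝ] TangentSpace (𝓡 2) p →L[ℝ] ℝ
  Phi_symm : ∀ p v w, Phi p v w = Phi p w v
  Phi_smooth : ContMDiff (𝓡 2) ((𝓡 2).prod 𝓘(ℝ, E 2 →L[ℝ] E 2 →L[ℝ] ℝ)) ∞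
    (fun p => Bundle.TotalSpace.mk' (E 2 →L[ℝ] E 2 →L[ℝ] ℝ)
      (E := fun p : S => TangentSpace (𝓡 2) p →L[ℝ] TangentSpace (𝓡 2) p →L[ℝ] ℝ) p (Phi p))

/-- The metric `ιX (ι id ∘ ι id) + ι id ∘ ιT + g_∇ + π*Φ` on `T*Σ`. -/
def SurfaceData.extension (d : SurfaceData S) (z : Cotangent S)
    (ξ η : TangentSpace cotModel z) : ℝ :=
  iotaField d.X z * symProd (iotaId z) (iotaId z) ξ η
    + symProd (iotaId z) (iotaEnd d.T z) ξ η
    + riemannianExtension d.nab z ξ η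
    + d.Phi z.proj (dproj z ξ) (dproj z η)

variable {N : Type*} [TopologicalSpace N] [ChartedSpace (E 4) N] [IsManifold (𝓡 4) ∞ N]

/-- `f` is an isometry from a neighbourhood of `p` in `(N, g)` onto an open subset of `T*Σ` with
the metric `ιX (ι id ∘ ι id) + ι id ∘ ιT + g_∇ + π*Φ`. -/
def IsLocalIsometryAt (g : Metric N) (d : SurfaceData S) (f : N → Cotangent S) (p : N) : Prop :=
  IsLocalDiffeomorphAt (𝓡 4) cotModel ∞ f p ∧
    ∀ᶠ q in 𝓝 p, ∀ v w : TangentSpace (𝓡 4) q,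
      d.extension (f q) (mfderiv (𝓡 4) cotModel f q v) (mfderiv (𝓡 4) cotModel f q w) = g.val q v w

/-- Near `p`, the map `f` takes the distribution of the Walker manifold to `ker π_*`. -/
def PreservesDistributionAt {g : Metric N} (D : WalkerDistribution g) (f : N → Cotangent S)
    (p : N) : Prop :=
  ∀ᶠ q in 𝓝 p, ∀ v : TangentSpace (𝓡 4) q,
    mfderiv (𝓡 4) cotModel f q v ∈ vertical (f q) ↔ v ∈ D.plane q

/-- Near `p`, the map `f` preserves the canonical orientations, which the distributions determine
on `N` and on `T*Σ`. -/
def PreservesOrientationAt {g : Metric N} (D : WalkerDistribution g) (d : SurfaceData S)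
    (f : N → Cotangent S) (p : N) : Prop :=
  ∀ᶠ q in 𝓝 p, ∀ (b : Module.Basis (Fin 4) ℝ (TangentSpace (𝓡 4) q))
    (b' : Module.Basis (Fin 4) ℝ (TangentSpace cotModel (f q))),
    IsAdapted (fun x y => g.val q x y) (D.plane q) b →
    IsAdapted (d.extension (f q)) (vertical (f q)) b' →
    0 < b'.det (fun i => mfderiv (𝓡 4) cotModel f q (b i))

/-- The Walker manifold is locally isometric, by orientation preserving isometries, to cotangent
bundles `T*Σ` of affine surfaces with metrics `ιX (ι id ∘ ι id) + ι id ∘ ιT + g_∇ + π*Φ`. -/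
def LocallyIsometricOriented (g : Metric N) (D : WalkerDistribution g) : Prop :=
  ∀ p : N, ∃ (S : Type) (_ : TopologicalSpace S) (_ : ChartedSpace (E 2) S)
    (_ : IsManifold (𝓡 2) ∞ S) (_ : T2Space S) (_ : SecondCountableTopology S)
    (d : SurfaceData S) (f : N → Cotangent S),
    IsLocalIsometryAt g d f p ∧ PreservesOrientationAt D d f p

/-- The same by isometries that take the parallel null distribution to `ker π_*`. -/
def LocallyIsometricWalker (g : Metric N) (D : WalkerDistribution g) : Prop :=
  ∀ p : N, ∃ (S : Type) (_ : TopologicalSpace S) (_ : ChartedSpace (E 2) S)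
    (_ : IsManifold (𝓡 2) ∞ S) (_ : T2Space S) (_ : SecondCountableTopology S)
    (d : SurfaceData S) (f : N → Cotangent S),
    IsLocalIsometryAt g d f p ∧ PreservesDistributionAt D f p

end Cotangent

end Walker

end

/-!
# Self-dual Walker manifolds

Everything is local, so the argument takes place in coordinates `(x, ω) ∈ ℝ² × (ℝ²)*`, with `x` a point
of the base and `ω` the fibre coordinate.

*Walker coordinates.* A parallel distribution is integrable because the Levi-Civita connection is
torsion free, so its leaves are straightened by the Frobenius theorem (`exists_frobenius`,
`IsNullParallelGraph.exists_flattening`). Since the distribution is null of half the dimension and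
parallel, the pairing of the metric between leaves and base is a closed covector-valued form on each
leaf, and its primitives serve as fibre coordinates. In these coordinates the metric is
`2 dxⁱ ∘ dx^{i'} + Q`, where `Q` is a field of bilinear forms on the base that depends on `x` and `ω`
(`IsNullParallelGraph.exists_walkerForm`, `exists_walkerChart`). The metrics on cotangent bundles have
this form for every choice of the tensor fields, by `extension_eq`.

*The anti-self-dual Weyl tensor.* By linear algebra, `W_-` vanishes at a point if and only if the
curvature tensor vanishes on the null anti-self-dual bivectors (`weyl_eq_hodgeStar_iff`). For a metric
in Walker form, with the canonical orientation, these are spanned by a lift of a vector `v` of the base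
and a vertical vector `β` with `β(v) = 0`, and the curvature on them is, up to a factor, the second
derivative of `Q(v, v)` along the fibre in the direction `β` (`IsWalkerFormAt.inner_riem`). Hence
self-duality is the equation `∂_β ∂_β Q(v, v) = 0` whenever `β(v) = 0`
(`weylMinus_iff_of_walkerForm`).

*The fibre equation.* For the metrics on cotangent bundles, `Q(v, v)` is
`ω(X) ω(v)² + ω(v) ω(T v) - 2 ω(Γ(v, v)) + Φ(v, v)`, which is affine in the directions `β` with
`β(v) = 0`. So every such metric is self-dual, and an isometry that preserves orientations carries
this over to the Walker manifold, because `W_-` depends only on the metric and the orientation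
(`weylMinus_eq_zero_of_isometry`). Conversely, the second order equation forces `Q` to be a
polynomial of degree at most three on the fibres, with terms of degree two and three of exactly this
shape (`IsFibreSystem.taylor`), so that its Taylor coefficients along the zero section define `X`,
`T`, `∇` and `Φ` (`exists_base_tensors`, `locallyIsometricWalker_of_isSelfDual`).

*Orientations.* Two adapted bases for the same null plane differ by a matrix of determinant one
(`IsAdapted.det_eq_one`), and an isometry that preserves the null distributions takes adapted bases to
adapted bases. So it preserves the canonical orientations
(`preservesOrientationAt_of_preservesDistributionAt`), which closes the circle of implications.
-/

set_option maxSynthPendingDepth 3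
set_option linter.unusedSectionVars false

noncomputable section

namespace Walker

/-! ### Levi-Civita connection and curvature of a metric on a normed space -/

section Koszul

variable {F : Type*} [NormedAddCommGroup F] [NormedSpace ℝ F]

/-- The Koszul expression `1/2 (D_v(w, z) + D_w(v, z) - D_z(v, w))` of a trilinear form `D`; for
`D = Dg` these are the Christoffel symbols of the first kind. -/
def koszul (D : F →L[ℝ] F →L[ℝ] F →L[ℝ] ℝ) : F →L[ℝ] F →L[ℝ] F →L[ℝ] ℝ :=
  (1 / 2 : ℝ) • (D + D.flip -
    ((ContinuousLinearMap.flipₗᵢ ℝ F F ℝ).toContinuousLinearEquiv :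
      (F →L[ℝ] F →L[ℝ] ℝ) →L[ℝ] (F →L[ℝ] F →L[ℝ] ℝ)) ∘L D.flip)

lemma koszul_apply (D : F →L[ℝ] F →L[ℝ] F →L[ℝ] ℝ) (v w z : F) :
    koszul D v w z = (1 / 2) * (D v w z + D w v z - D z v w) := by
  simp [koszul]

lemma contDiff_koszul {n : ℕ∞ω} :
    ContDiff ℝ n (koszul : (F →L[ℝ] F →L[ℝ] F →L[ℝ] ℝ) → _) := by
  have hflip : ContDiff ℝ n (fun D : F →L[ℝ] F →L[ℝ] F →L[ℝ] ℝ => D.flip) :=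
    (ContinuousLinearMap.flipₗᵢ ℝ F F (F →L[ℝ] ℝ)).contDiff
  exact ((contDiff_id.add hflip).sub (contDiff_const.clm_comp hflip)).const_smul (1 / 2 : ℝ)

lemma eventually_isInvertible_of_continuousAt {F' : Type*} [NormedAddCommGroup F']
    [NormedSpace ℝ F'] [CompleteSpace F] {X : Type*} [TopologicalSpace X]
    {f : X → F →L[ℝ] F'} {x : X} (hf : ContinuousAt f x) (h : (f x).IsInvertible) :
    ∀ᶠ x' in 𝓝 x, (f x').IsInvertible := by
  obtain ⟨e, he⟩ := h
  have := ContinuousLinearEquiv.nhds e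
  rw [he] at this
  filter_upwards [hf this] with y' hy'
  obtain ⟨e', he'⟩ := hy'
  exact ⟨e', he'⟩

/-- `g` is a pseudo-Riemannian metric near `y`, of class `C²`. -/
structure IsMetricAt (g : F → F →L[ℝ] F →L[ℝ] ℝ) (y : F) : Prop where
  contDiffAt : ContDiffAt ℝ 2 g y
  symm : ∀ᶠ y' in 𝓝 y, ∀ v w, g y' v w = g y' w v
  invertible : (g y).IsInvertible

/-- The Christoffel symbols of the second kind of `g` at `y`, as a bilinear map. -/
def chr (g : F → F →L[ℝ] F →L[ℝ] ℝ) (y : F) : F →L[ℝ] F →L[ℝ] F :=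
  (ContinuousLinearMap.compL ℝ F (F →L[ℝ] ℝ) F (g y).inverse) ∘L koszul (fderiv ℝ g y)

lemma chr_apply (g : F → F →L[ℝ] F →L[ℝ] ℝ) (y v w : F) :
    chr g y v w = (g y).inverse (koszul (fderiv ℝ g y) v w) := rfl

/-- The curvature operator of the connection with Christoffel symbols `G`. -/
def riem (G : F → F →L[ℝ] F →L[ℝ] F) (y u v w : F) : F :=
  fderiv ℝ G y u v w - fderiv ℝ G y v u w + G y u (G y v w) - G y v (G y u w)

namespace IsMetricAt

variable {g : F → F →L[ℝ] F →L[ℝ] ℝ} {y : F}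

lemma ext_inner (hg : IsMetricAt g y) {v w : F} (h : ∀ z, g y v z = g y w z) : v = w :=
  hg.invertible.injective (ContinuousLinearMap.ext h)

lemma inner_chr (hg : IsMetricAt g y) (v w z : F) :
    g y (chr g y v w) z = koszul (fderiv ℝ g y) v w z := by
  rw [chr_apply, hg.invertible.self_apply_inverse]

lemma eq_chr (hg : IsMetricAt g y) {v w x : F}
    (h : ∀ z, g y x z = koszul (fderiv ℝ g y) v w z) : x = chr g y v w :=
  hg.ext_inner fun z => by rw [h, hg.inner_chr]

lemma differentiableAt (hg : IsMetricAt g y) : DifferentiableAt ℝ g y :=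
  hg.contDiffAt.differentiableAt (by norm_num)

lemma fderiv_symm (hg : IsMetricAt g y) (u v w : F) :
    fderiv ℝ g y u v w = fderiv ℝ g y u w v := by
  have h1 : ∀ a b, fderiv ℝ (fun y' => g y' a b) y u = fderiv ℝ g y u a b := fun a b => by
    have := ((hg.differentiableAt.hasFDerivAt.clm_apply (hasFDerivAt_const a y)).clm_apply
      (hasFDerivAt_const b y)).fderiv
    rw [this]; simp
  rw [← h1, ← h1]
  have : (fun y' => g y' v w) =ᶠ[𝓝 y] fun y' => g y' w v := hg.symm.mono fun y' h => h v w
  rw [this.fderiv_eq]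

lemma chr_symm (hg : IsMetricAt g y) (v w : F) : chr g y v w = chr g y w v := by
  refine hg.eq_chr fun z => ?_
  rw [hg.inner_chr, koszul_apply, koszul_apply, hg.fderiv_symm z v w]
  ring

/-- The Levi-Civita connection is metric. -/
lemma fderiv_eq (hg : IsMetricAt g y) (u v w : F) :
    fderiv ℝ g y u v w = g y (chr g y u v) w + g y v (chr g y u w) := by
  rw [hg.symm.self_of_nhds v, hg.inner_chr, hg.inner_chr, koszul_apply, koszul_apply,
    hg.fderiv_symm u w v]
  ring

variable [CompleteSpace F]

lemma contDiffAt_chr (hg : IsMetricAt g y) : ContDiffAt ℝ 1 (chr g) y := by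
  have h1 : ContDiffAt ℝ 1 (fun y' => (g y').inverse) y :=
    (hg.invertible.contDiffAt_map_inverse (n := 1)).comp y (hg.contDiffAt.of_le (by norm_num))
  have h2 : ContDiffAt ℝ 1 (fun y' => koszul (fderiv ℝ g y')) y :=
    contDiff_koszul.contDiffAt.comp y (hg.contDiffAt.fderiv_right (by norm_num))
  exact (((ContinuousLinearMap.compL ℝ F (F →L[ℝ] ℝ) F).contDiff.contDiffAt).comp y h1).clm_comp h2

lemma eventually (hg : IsMetricAt g y) : ∀ᶠ y' in 𝓝 y, IsMetricAt g y' := by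
  have h1 := eventually_isInvertible_of_continuousAt hg.contDiffAt.continuousAt hg.invertible
  filter_upwards [hg.contDiffAt.eventually (by simp), hg.symm.eventually_nhds, h1]
    with y' a b c using ⟨a, b, c⟩

lemma differentiableAt_chr (hg : IsMetricAt g y) : DifferentiableAt ℝ (chr g) y :=
  hg.contDiffAt_chr.differentiableAt (by norm_num)

end IsMetricAt

end Koszul

section Pullback

variable {F : Type*} [NormedAddCommGroup F] [NormedSpace ℝ F] [CompleteSpace F]
  {F' : Type*} [NormedAddCommGroup F'] [NormedSpace ℝ F'] [CompleteSpace F']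

/-- Near `y`, the metric `g` is the pull-back of the metric `h` by the local diffeomorphism `φ`. -/
structure IsPullbackAt (φ : F → F') (g : F → F →L[ℝ] F →L[ℝ] ℝ)
    (h : F' → F' →L[ℝ] F' →L[ℝ] ℝ) (y : F) : Prop where
  contDiffAt : ContDiffAt ℝ 3 φ y
  invertible : (fderiv ℝ φ y).IsInvertible
  metric : IsMetricAt h (φ y)
  eq : ∀ᶠ y' in 𝓝 y, ∀ v w, g y' v w = h (φ y') (fderiv ℝ φ y' v) (fderiv ℝ φ y' w)

namespace IsPullbackAt

variable {φ : F → F'} {g : F → F →L[ℝ] F →L[ℝ] ℝ} {h : F' → F' →L[ℝ] F' →L[ℝ] ℝ} {y : F}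

lemma eventually (H : IsPullbackAt φ g h y) : ∀ᶠ y' in 𝓝 y, IsPullbackAt φ g h y' := by
  have h1 : ContinuousAt (fderiv ℝ φ) y :=
    (H.contDiffAt.fderiv_right (m := 2) (by norm_num)).continuousAt
  filter_upwards [H.contDiffAt.eventually (by simp), H.eq.eventually_nhds,
    H.contDiffAt.continuousAt.eventually H.metric.eventually,
    eventually_isInvertible_of_continuousAt h1 H.invertible] with y' a b c d using ⟨a, d, c, b⟩

lemma differentiableAt (H : IsPullbackAt φ g h y) : DifferentiableAt ℝ φ y :=
  H.contDiffAt.differentiableAt (by norm_num)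

lemma differentiableAt_fderiv (H : IsPullbackAt φ g h y) : DifferentiableAt ℝ (fderiv ℝ φ) y :=
  (H.contDiffAt.fderiv_right (m := 2) (by norm_num)).differentiableAt (by norm_num)

lemma second_symm (H : IsPullbackAt φ g h y) (u v : F) :
    fderiv ℝ (fderiv ℝ φ) y u v = fderiv ℝ (fderiv ℝ φ) y v u :=
  H.contDiffAt.isSymmSndFDerivAt (by norm_num [minSmoothness_of_isRCLikeNormedField]) u v

lemma contDiffAt_metric (H : IsPullbackAt φ g h y) : ContDiffAt ℝ 2 g y := by
  have h1 : ContDiffAt ℝ 2 (fderiv ℝ φ) y := H.contDiffAt.fderiv_right (by norm_num)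
  have h2 : ContDiffAt ℝ 2 (fun y' => h (φ y')) y :=
    H.metric.contDiffAt.comp y (H.contDiffAt.of_le (by norm_num))
  have h3 : ContDiffAt ℝ 2 (fun y' => ((ContinuousLinearMap.flipₗᵢ ℝ F F ℝ).toContinuousLinearEquiv :
      (F →L[ℝ] F →L[ℝ] ℝ) →L[ℝ] (F →L[ℝ] F →L[ℝ] ℝ))
      ((ContinuousLinearMap.compL ℝ F F' ℝ).flip (fderiv ℝ φ y') ∘L
      (ContinuousLinearMap.flip ((h (φ y')) ∘L (fderiv ℝ φ y'))).flip).flip) y := by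
    have e1 := h2.clm_comp h1
    have e2 := (((ContinuousLinearMap.compL ℝ F F' ℝ).flip.contDiff.contDiffAt).comp y h1).clm_comp e1
    simpa using e2
  refine h3.congr_of_eventuallyEq ?_
  filter_upwards [H.eq] with y' hy'
  ext v w
  simp [hy']

lemma isMetricAt (H : IsPullbackAt φ g h y) : IsMetricAt g y := by
  refine ⟨H.contDiffAt_metric, ?_, ?_⟩
  · filter_upwards [H.eq, H.contDiffAt.continuousAt.eventually H.metric.symm] with y' e s v w
    rw [e, e, s]
  · obtain ⟨L, hL⟩ := H.invertible
    obtain ⟨M, hM⟩ := H.metric.invertible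
    refine ⟨(L.trans M).trans (L.symm.arrowCongr (ContinuousLinearEquiv.refl ℝ ℝ)), ?_⟩
    ext v w
    rw [H.eq.self_of_nhds, ← hL, ← hM]
    simp

lemma fderiv_metric (H : IsPullbackAt φ g h y) (u v w : F) :
    fderiv ℝ g y u v w = fderiv ℝ h (φ y) (fderiv ℝ φ y u) (fderiv ℝ φ y v) (fderiv ℝ φ y w)
      + h (φ y) (fderiv ℝ (fderiv ℝ φ) y u v) (fderiv ℝ φ y w)
      + h (φ y) (fderiv ℝ φ y v) (fderiv ℝ (fderiv ℝ φ) y u w) := by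
  have h1 : fderiv ℝ (fun y' => g y' v w) y u = fderiv ℝ g y u v w := by
    have := ((H.isMetricAt.differentiableAt.hasFDerivAt.clm_apply (hasFDerivAt_const v y)).clm_apply
      (hasFDerivAt_const w y)).fderiv
    rw [this]; simp
  have h2 : (fun y' => g y' v w) =ᶠ[𝓝 y]
      fun y' => h (φ y') (fderiv ℝ φ y' v) (fderiv ℝ φ y' w) := H.eq.mono fun y' e => e v w
  have hh : HasFDerivAt (fun y' => h (φ y')) ((fderiv ℝ h (φ y)).comp (fderiv ℝ φ y)) y :=
    HasFDerivAt.comp (g := h) y H.metric.differentiableAt.hasFDerivAt H.differentiableAt.hasFDerivAt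
  have hd := H.differentiableAt_fderiv.hasFDerivAt
  have := ((hh.clm_apply (hd.clm_apply (hasFDerivAt_const v y))).clm_apply
    (hd.clm_apply (hasFDerivAt_const w y))).fderiv
  rw [← h1, h2.fderiv_eq, this]
  simp
  ring

/-- The transformation law of the Christoffel symbols. -/
lemma map_chr (H : IsPullbackAt φ g h y) (v w : F) :
    fderiv ℝ φ y (chr g y v w) =
      chr h (φ y) (fderiv ℝ φ y v) (fderiv ℝ φ y w) + fderiv ℝ (fderiv ℝ φ) y v w := by
  refine H.metric.ext_inner fun z => ?_
  obtain ⟨z, rfl⟩ := H.invertible.surjective z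
  rw [← H.eq.self_of_nhds, H.isMetricAt.inner_chr, map_add, add_apply,
    H.metric.inner_chr, koszul_apply, koszul_apply, H.fderiv_metric, H.fderiv_metric,
    H.fderiv_metric, H.second_symm w v, H.second_symm z v, H.second_symm z w,
    H.metric.symm.self_of_nhds (fderiv ℝ φ y w) (fderiv ℝ (fderiv ℝ φ) y v z),
    H.metric.symm.self_of_nhds (fderiv ℝ φ y v) (fderiv ℝ (fderiv ℝ φ) y w z)]
  ring

/-- The transformation law of the covariant derivative of a vector field. -/
lemma map_covariant (H : IsPullbackAt φ g h y) {Y : F → F} {Y' : F' → F'}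
    (hY : DifferentiableAt ℝ Y y) (hY' : DifferentiableAt ℝ Y' (φ y))
    (e : ∀ᶠ y' in 𝓝 y, Y' (φ y') = fderiv ℝ φ y' (Y y')) (v : F) :
    fderiv ℝ φ y (fderiv ℝ Y y v + chr g y v (Y y)) =
      fderiv ℝ Y' (φ y) (fderiv ℝ φ y v) + chr h (φ y) (fderiv ℝ φ y v) (Y' (φ y)) := by
  have h1 := (HasFDerivAt.comp (g := Y') y hY'.hasFDerivAt H.differentiableAt.hasFDerivAt).fderiv
  have h2 := (H.differentiableAt_fderiv.hasFDerivAt.clm_apply hY.hasFDerivAt).fderiv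
  have h3 : fderiv ℝ (Y' ∘ φ) y v = fderiv ℝ (fun y' => fderiv ℝ φ y' (Y y')) y v := by
    exact congrArg (fun L : F →L[ℝ] F' => L v) (Filter.EventuallyEq.fderiv_eq e)
  rw [h1, h2] at h3
  simp only [ContinuousLinearMap.coe_comp, Function.comp_apply, add_apply,
    ContinuousLinearMap.flip_apply] at h3
  rw [map_add, H.map_chr, h3, e.self_of_nhds]
  abel

/-- The transformation law of the curvature. -/
lemma map_riem (H : IsPullbackAt φ g h y) (u v w : F) :
    fderiv ℝ φ y (riem (chr g) y u v w) =
      riem (chr h) (φ y) (fderiv ℝ φ y u) (fderiv ℝ φ y v) (fderiv ℝ φ y w) := by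
  have hg := H.isMetricAt.differentiableAt_chr.hasFDerivAt
  have hd := H.differentiableAt_fderiv.hasFDerivAt
  have hdd : DifferentiableAt ℝ (fderiv ℝ (fderiv ℝ φ)) y :=
    ((H.contDiffAt.fderiv_right (m := 2) (by norm_num)).fderiv_right
      (m := 1) (by norm_num)).differentiableAt (by norm_num)
  have hh : HasFDerivAt (fun y' => chr h (φ y')) ((fderiv ℝ (chr h) (φ y)).comp (fderiv ℝ φ y)) y :=
    HasFDerivAt.comp (g := chr h) y H.metric.differentiableAt_chr.hasFDerivAt H.differentiableAt.hasFDerivAt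
  -- The derivative of the transformation law of the Christoffel symbols.
  have key : ∀ a b c : F,
      fderiv ℝ (fderiv ℝ φ) y a (chr g y b c) + fderiv ℝ φ y (fderiv ℝ (chr g) y a b c) =
        fderiv ℝ (chr h) (φ y) (fderiv ℝ φ y a) (fderiv ℝ φ y b) (fderiv ℝ φ y c)
        + chr h (φ y) (fderiv ℝ (fderiv ℝ φ) y a b) (fderiv ℝ φ y c)
        + chr h (φ y) (fderiv ℝ φ y b) (fderiv ℝ (fderiv ℝ φ) y a c)
        + fderiv ℝ (fderiv ℝ (fderiv ℝ φ)) y a b c := by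
    intro a b c
    have e : (fun y' => fderiv ℝ φ y' (chr g y' b c)) =ᶠ[𝓝 y] fun y' =>
        chr h (φ y') (fderiv ℝ φ y' b) (fderiv ℝ φ y' c) + fderiv ℝ (fderiv ℝ φ) y' b c :=
      H.eventually.mono fun y' H' => H'.map_chr b c
    have h1 := (hd.clm_apply ((hg.clm_apply (hasFDerivAt_const b y)).clm_apply
      (hasFDerivAt_const c y))).fderiv
    have h2 := (((hh.clm_apply (hd.clm_apply (hasFDerivAt_const b y))).clm_apply
      (hd.clm_apply (hasFDerivAt_const c y))).add
      ((hdd.hasFDerivAt.clm_apply (hasFDerivAt_const b y)).clm_apply (hasFDerivAt_const c y))).fderiv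
    have h3 := congrArg (fun L : F →L[ℝ] F' => L a) e.fderiv_eq
    have h2' := congrArg (fun L : F →L[ℝ] F' => L a) h2
    have h1' := congrArg (fun L : F →L[ℝ] F' => L a) h1
    simp only [ContinuousLinearMap.coe_comp, Function.comp_apply, add_apply,
      ContinuousLinearMap.flip_apply, zero_add, ContinuousLinearMap.comp_zero] at h1' h2'
    have h4 := h1'.symm.trans (h3.trans h2')
    rw [add_comm, h4]
    abel
  have third : fderiv ℝ (fderiv ℝ (fderiv ℝ φ)) y u v w = fderiv ℝ (fderiv ℝ (fderiv ℝ φ)) y v u w := by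
    have := (H.contDiffAt.fderiv_right (m := 2) (by norm_num)).isSymmSndFDerivAt
      (by norm_num [minSmoothness_of_isRCLikeNormedField]) u v
    rw [this]
  have k1 := key u v w
  have k2 := key v u w
  rw [← eq_sub_iff_add_eq'] at k1 k2
  simp only [riem, map_sub, map_add, k1, k2, H.map_chr, third, H.second_symm v u]
  abel

end IsPullbackAt

end Pullback

/-! ### Symmetries of the curvature tensor -/

section Symmetries

variable {F : Type*} [NormedAddCommGroup F] [NormedSpace ℝ F] [CompleteSpace F]
  {g : F → F →L[ℝ] F →L[ℝ] ℝ} {y : F}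

lemma riem_antisymm (G : F → F →L[ℝ] F →L[ℝ] F) (y u v w : F) :
    riem G y u v w = -riem G y v u w := by
  simp only [riem]; abel

lemma IsMetricAt.fderiv_chr_symm (hg : IsMetricAt g y) (u v w : F) :
    fderiv ℝ (chr g) y u v w = fderiv ℝ (chr g) y u w v := by
  have h1 : ∀ a b, fderiv ℝ (fun y' => chr g y' a b) y u = fderiv ℝ (chr g) y u a b := fun a b => by
    have := ((hg.differentiableAt_chr.hasFDerivAt.clm_apply (hasFDerivAt_const a y)).clm_apply
      (hasFDerivAt_const b y)).fderiv
    rw [this]; simp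
  rw [← h1, ← h1]
  have : (fun y' => chr g y' v w) =ᶠ[𝓝 y] fun y' => chr g y' w v :=
    hg.eventually.mono fun y' h => h.chr_symm v w
  rw [this.fderiv_eq]

lemma IsMetricAt.bianchi (hg : IsMetricAt g y) (u v w : F) :
    riem (chr g) y u v w + riem (chr g) y v w u + riem (chr g) y w u v = 0 := by
  simp only [riem, hg.fderiv_chr_symm w v u, hg.fderiv_chr_symm u w v, hg.fderiv_chr_symm v w u,
    hg.chr_symm w v, hg.chr_symm w u, hg.chr_symm v u]
  abel

lemma IsMetricAt.inner_riem_antisymm (hg : IsMetricAt g y) (a u v w : F) :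
    g y (riem (chr g) y a u v) w = -g y (riem (chr g) y a u w) v := by
  have hG := hg.differentiableAt_chr.hasFDerivAt
  have hgd := hg.differentiableAt.hasFDerivAt
  have h2 : DifferentiableAt ℝ (fderiv ℝ g) y :=
    (hg.contDiffAt.fderiv_right (m := 1) (by norm_num)).differentiableAt (by norm_num)
  have key : ∀ a u, fderiv ℝ (fderiv ℝ g) y a u v w =
      g y (chr g y a (chr g y u v)) w + g y (chr g y u v) (chr g y a w)
        + g y (fderiv ℝ (chr g) y a u v) w
        + (g y (chr g y a v) (chr g y u w) + g y v (chr g y a (chr g y u w)))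
        + g y v (fderiv ℝ (chr g) y a u w) := by
    intro a u
    have e : (fun y' => fderiv ℝ g y' u v w) =ᶠ[𝓝 y]
        fun y' => g y' (chr g y' u v) w + g y' v (chr g y' u w) :=
      hg.eventually.mono fun y' h => h.fderiv_eq u v w
    have d1 := (((h2.hasFDerivAt.clm_apply (hasFDerivAt_const u y)).clm_apply
      (hasFDerivAt_const v y)).clm_apply (hasFDerivAt_const w y)).fderiv
    have d2 := (((hgd.clm_apply ((hG.clm_apply (hasFDerivAt_const u y)).clm_apply
      (hasFDerivAt_const v y))).clm_apply (hasFDerivAt_const w y)).add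
      ((hgd.clm_apply (hasFDerivAt_const v y)).clm_apply ((hG.clm_apply (hasFDerivAt_const u y)).clm_apply
      (hasFDerivAt_const w y)))).fderiv
    have d3 := congrArg (fun L : F →L[ℝ] ℝ => L a) (d1.symm.trans (e.fderiv_eq.trans d2))
    simp only [ContinuousLinearMap.coe_comp, Function.comp_apply, add_apply,
      ContinuousLinearMap.flip_apply, zero_add, ContinuousLinearMap.comp_zero] at d3
    rw [d3, hg.fderiv_eq a (chr g y u v) w, hg.fderiv_eq a v]
    ring
  have hs : fderiv ℝ (fderiv ℝ g) y a u = fderiv ℝ (fderiv ℝ g) y u a :=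
    hg.contDiffAt.isSymmSndFDerivAt (by norm_num [minSmoothness_of_isRCLikeNormedField]) a u
  have k1 := key a u
  have k2 := key u a
  rw [hs, k2] at k1
  rw [hg.symm.self_of_nhds (riem (chr g) y a u w)]
  simp only [riem, map_add, map_sub, add_apply, sub_apply]
  linarith [hg.symm.self_of_nhds (chr g y a w) (chr g y u v)]

lemma IsMetricAt.inner_riem_pair (hg : IsMetricAt g y) (a b c d : F) :
    g y (riem (chr g) y a b c) d = g y (riem (chr g) y c d a) b := by
  have B : ∀ u v w z, g y (riem (chr g) y u v w) z + g y (riem (chr g) y v w u) z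
      + g y (riem (chr g) y w u v) z = 0 := fun u v w z => by
    rw [← add_apply, ← add_apply, ← map_add, ← map_add, hg.bianchi]; simp
  have A : ∀ u v w z, g y (riem (chr g) y u v w) z = -g y (riem (chr g) y v u w) z :=
    fun u v w z => by rw [riem_antisymm]; simp
  have C := hg.inner_riem_antisymm
  linarith [B a b c d, B b c d a, B c d a b, B d a b c, A b c a d, A c a b d, C a b c d, C b c a d,
    C c a b d, A b c d a, C b c d a, C c d b a, A c d b a, A d b c a, C d b c a, C c d a b, A d a c b,
    C d a c b, A a c d b, C a c d b, C d a b c, C a b d c, A a b d c, A b d a c, C b d a c,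
    A c a b d, A d b a c, C d b a c]

end Symmetries

/-! ### Comparison with the coordinate expressions in `ℝ⁴` -/

section Coordinates

variable {g : E 4 → E 4 →L[ℝ] E 4 →L[ℝ] ℝ} {y : E 4}

lemma sum_smul_e (x : E 4) : ∑ i, x i • e i = x := by
  ext j
  simp [Finset.sum_apply, Pi.single_apply]

lemma IsMetricAt.isUnit_det_gram (hg : IsMetricAt g y) : IsUnit (gram g y).det := by
  rw [isUnit_iff_ne_zero]
  intro h0
  obtain ⟨c, hc, hc0⟩ := Matrix.exists_mulVec_eq_zero_iff.2 h0
  apply hc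
  have h1 : ∑ j, c j • e j = 0 := by
    refine hg.ext_inner fun z => ?_
    rw [hg.symm.self_of_nhds, ← sum_smul_e z]
    simp only [map_zero, zero_apply, map_sum, map_smul, sum_apply,
      smul_apply]
    simp only [smul_zero, Finset.sum_const_zero, Finset.smul_sum]
    rw [Finset.sum_comm]
    refine Finset.sum_eq_zero fun i _ => ?_
    have := congrFun hc0 i
    simp only [Matrix.mulVec, dotProduct, gram, Matrix.of_apply, Pi.zero_apply] at this
    rw [← mul_zero (z i), ← this, Finset.mul_sum]
    refine Finset.sum_congr rfl fun j _ => ?_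
    simp only [smul_eq_mul]
    ring
  ext j
  have := congrArg (fun x : E 4 => x j) h1
  simpa [Finset.sum_apply, Pi.single_apply] using this

lemma IsMetricAt.christoffel_eq (hg : IsMetricAt g y) (v w : E 4) :
    christoffel g y v w = chr g y v w := by
  refine hg.eq_chr fun z => ?_
  have h1 : ∀ m, g y (christoffel g y v w) (e m) = koszul (fderiv ℝ g y) v w (e m) := by
    intro m
    have h2 : ∑ l, ((gram g y)⁻¹.transpose * gram g y) l m * koszul (fderiv ℝ g y) v w (e l) =
        koszul (fderiv ℝ g y) v w (e m) := by
      have ht : (gram g y).transpose = gram g y := by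
        ext i j; simp [gram, hg.symm.self_of_nhds (e j)]
      rw [Matrix.transpose_nonsing_inv, ht, Matrix.nonsing_inv_mul _ hg.isUnit_det_gram]
      simp [Matrix.one_apply]
    rw [← h2]
    simp only [christoffel, map_sum, map_smul, sum_apply, smul_apply, smul_eq_mul,
      Matrix.mul_apply, Matrix.transpose_apply, Finset.sum_mul]
    rw [Finset.sum_comm]
    refine Finset.sum_congr rfl fun l _ => Finset.sum_congr rfl fun k _ => ?_
    rw [koszul_apply, christoffelFirst, gram, Matrix.of_apply]
    ring
  rw [← sum_smul_e z]
  simp only [map_sum, map_smul, h1]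

lemma IsMetricAt.riemann_eq (hg : IsMetricAt g y) (u v w : E 4) :
    riemann g y u v w = riem (chr g) y u v w := by
  have h1 : ∀ u a b, fderiv ℝ (fun y' => christoffel g y' a b) y u = fderiv ℝ (chr g) y u a b :=
    fun u a b => by
    have := ((hg.differentiableAt_chr.hasFDerivAt.clm_apply (hasFDerivAt_const a y)).clm_apply
      (hasFDerivAt_const b y)).fderiv
    have e : (fun y' => christoffel g y' a b) =ᶠ[𝓝 y] fun y' => chr g y' a b :=
      hg.eventually.mono fun y' h => h.christoffel_eq a b
    rw [e.fderiv_eq, this]; simp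
  simp only [riemann, riem, h1, hg.christoffel_eq]

end Coordinates

/-! ### The curvature of a metric in Walker form -/

section WalkerForm

variable {X : Type*} [NormedAddCommGroup X] [NormedSpace ℝ X] [FiniteDimensional ℝ X]

lemma fderiv_clm_apply₂ {F G : Type*} [NormedAddCommGroup F] [NormedSpace ℝ F]
    [NormedAddCommGroup G] [NormedSpace ℝ G] {h : F → G →L[ℝ] G →L[ℝ] ℝ} {y : F}
    (hd : DifferentiableAt ℝ h y) (z : F) (a b : G) :
    fderiv ℝ (fun y' => h y' a b) y z = fderiv ℝ h y z a b := by
  have := ((hd.hasFDerivAt.clm_apply (hasFDerivAt_const a y)).clm_apply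
    (hasFDerivAt_const b y)).fderiv
  rw [this]; simp

/-- Near `a`, the metric `h` on `X × X*` is `2 dxⁱ ∘ dx^{i'} + q`, where `q` is a field of bilinear
forms on the base, depending on all coordinates. -/
structure IsWalkerFormAt (h : X × (X →L[ℝ] ℝ) → X × (X →L[ℝ] ℝ) →L[ℝ] X × (X →L[ℝ] ℝ) →L[ℝ] ℝ)
    (q : X × (X →L[ℝ] ℝ) → X →L[ℝ] X →L[ℝ] ℝ) (a : X × (X →L[ℝ] ℝ)) : Prop where
  metric : IsMetricAt h a
  eq : ∀ᶠ y in 𝓝 a, ∀ b c, h y b c = b.2 c.1 + c.2 b.1 + q y b.1 c.1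

namespace IsWalkerFormAt

variable {h : X × (X →L[ℝ] ℝ) → X × (X →L[ℝ] ℝ) →L[ℝ] X × (X →L[ℝ] ℝ) →L[ℝ] ℝ}
  {q : X × (X →L[ℝ] ℝ) → X →L[ℝ] X →L[ℝ] ℝ} {a : X × (X →L[ℝ] ℝ)}

lemma eventually (H : IsWalkerFormAt h q a) : ∀ᶠ y in 𝓝 a, IsWalkerFormAt h q y := by
  filter_upwards [H.metric.eventually, H.eq.eventually_nhds] with y b c using ⟨b, c⟩

lemma fderiv_vertical (H : IsWalkerFormAt h q a) (z : X × (X →L[ℝ] ℝ)) (β : X →L[ℝ] ℝ)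
    (c : X × (X →L[ℝ] ℝ)) : fderiv ℝ h a z (0, β) c = 0 := by
  rw [← fderiv_clm_apply₂ H.metric.differentiableAt]
  have : (fun y => h y (0, β) c) =ᶠ[𝓝 a] fun _ => β c.1 := by
    filter_upwards [H.eq] with y hy
    simp [hy]
  rw [this.fderiv_eq]
  simp

lemma fderiv_vertical' (H : IsWalkerFormAt h q a) (z : X × (X →L[ℝ] ℝ)) (β : X →L[ℝ] ℝ)
    (c : X × (X →L[ℝ] ℝ)) : fderiv ℝ h a z c (0, β) = 0 := by
  rw [H.metric.fderiv_symm, H.fderiv_vertical]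

lemma chr_vertical (H : IsWalkerFormAt h q a) (β : X →L[ℝ] ℝ) : chr h a (0, β) (0, β) = 0 := by
  symm
  refine H.metric.eq_chr fun z => ?_
  rw [koszul_apply, H.fderiv_vertical, H.fderiv_vertical]
  simp

lemma inner_chr_vertical (H : IsWalkerFormAt h q a) (u : X × (X →L[ℝ] ℝ)) (β : X →L[ℝ] ℝ)
    (z : X × (X →L[ℝ] ℝ)) :
    h a (chr h a u (0, β)) z = (1 / 2) * fderiv ℝ h a (0, β) u z := by
  rw [H.metric.inner_chr, koszul_apply, H.fderiv_vertical, H.fderiv_vertical']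
  ring

lemma chr_fst (H : IsWalkerFormAt h q a) (u : X × (X →L[ℝ] ℝ)) (β : X →L[ℝ] ℝ) :
    (chr h a u (0, β)).1 = 0 := by
  refine (Module.forall_dual_apply_eq_zero_iff ℝ _).1 fun β' => ?_
  have h1 := H.inner_chr_vertical u β (0, LinearMap.toContinuousLinearMap β')
  rw [H.eq.self_of_nhds, H.fderiv_vertical'] at h1
  simpa using h1

/-- The curvature of a Walker metric on the planes spanned by a horizontal vector `u` and a vertical
vector is a second derivative of the metric along the fibre. -/
lemma inner_riem (H : IsWalkerFormAt h q a) (u : X × (X →L[ℝ] ℝ)) (β : X →L[ℝ] ℝ) :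
    h a (riem (chr h) a u (0, β) (0, β)) u =
      -(1 / 2) * fderiv ℝ (fun y => fderiv ℝ (fun y' => q y' u.1 u.1) y (0, β)) a (0, β) := by
  have hG := H.metric.differentiableAt_chr.hasFDerivAt
  have h1 : fderiv ℝ (chr h) a u (0, β) (0, β) = 0 := by
    have e : (fun y => chr h y (0, β) (0, β)) =ᶠ[𝓝 a] fun _ => 0 :=
      H.eventually.mono fun y hy => hy.chr_vertical β
    have := ((hG.clm_apply (hasFDerivAt_const ((0, β) : X × (X →L[ℝ] ℝ)) a)).clm_apply
      (hasFDerivAt_const ((0, β) : X × (X →L[ℝ] ℝ)) a)).fderiv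
    have d := congrArg (fun L : X × (X →L[ℝ] ℝ) →L[ℝ] X × (X →L[ℝ] ℝ) => L u)
      (this.symm.trans e.fderiv_eq)
    simpa using d
  have hv : ∀ z c, fderiv ℝ h a z (chr h a u (0, β)) c = 0 := fun z c => by
    have : chr h a u (0, β) = (0, (chr h a u (0, β)).2) := Prod.ext (H.chr_fst u β) rfl
    rw [this, H.fderiv_vertical]
  have h2 : h a (chr h a (0, β) (chr h a u (0, β))) u = 0 := by
    rw [H.metric.chr_symm, H.inner_chr_vertical, hv, mul_zero]
  have h3 : h a (fderiv ℝ (chr h) a (0, β) u (0, β)) u =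
      (1 / 2) * fderiv ℝ (fun y => fderiv ℝ (fun y' => q y' u.1 u.1) y (0, β)) a (0, β) := by
    have e : (fun y => h y (chr h y u (0, β)) u) =ᶠ[𝓝 a]
        fun y => (1 / 2) * fderiv ℝ (fun y' => q y' u.1 u.1) y (0, β) := by
      filter_upwards [H.eventually] with y hy
      rw [hy.inner_chr_vertical, ← fderiv_clm_apply₂ hy.metric.differentiableAt]
      have e' : (fun y => h y u u) =ᶠ[𝓝 y] fun y => (u.2 u.1 + u.2 u.1) + q y u.1 u.1 :=
        hy.eq.mono fun y' hy' => hy' u u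
      rw [e'.fderiv_eq, fderiv_const_add]
    have d1 := ((H.metric.differentiableAt.hasFDerivAt.clm_apply ((hG.clm_apply
      (hasFDerivAt_const u a)).clm_apply
      (hasFDerivAt_const ((0, β) : X × (X →L[ℝ] ℝ)) a))).clm_apply (hasFDerivAt_const u a)).fderiv
    have d2 := congrArg (fun L : X × (X →L[ℝ] ℝ) →L[ℝ] ℝ => L (0, β)) (d1.symm.trans e.fderiv_eq)
    have e2 : (fun y => (1 / 2 : ℝ) * fderiv ℝ (fun y' => q y' u.1 u.1) y (0, β)) =
        (1 / 2 : ℝ) • fun y => fderiv ℝ (fun y' => q y' u.1 u.1) y (0, β) := rfl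
    rw [e2, fderiv_const_smul_field] at d2
    simp [hv] at d2
    simpa using d2
  simp only [riem, map_sub, map_add, sub_apply, add_apply, h1, H.chr_vertical, h2, h3, map_zero,
    zero_apply]
  ring

end IsWalkerFormAt

end WalkerForm

/-! ### The Hodge star on a four-dimensional space -/

section HodgeStar

variable {V : Type*} [AddCommGroup V] [Module ℝ V]

/-- The contraction `g^{ij} β_{ij}` of two bilinear forms, computed in the basis `b`. -/
def contraction (B β : V →ₗ[ℝ] V →ₗ[ℝ] ℝ) (b : Module.Basis (Fin 4) ℝ V) : ℝ :=
  ∑ k, ∑ m, (Matrix.of fun i j => B (b i) (b j))⁻¹ k m * β (b k) (b m)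

lemma gram_basis_change (B : V →ₗ[ℝ] V →ₗ[ℝ] ℝ) (b b' : Module.Basis (Fin 4) ℝ V) :
    (Matrix.of fun i j => B (b' i) (b' j)) =
      (b.toMatrix b').transpose * (Matrix.of fun i j => B (b i) (b j)) * b.toMatrix b' := by
  have := LinearMap.BilinForm.toMatrix_mul_basis_toMatrix b b' B
  have h : ∀ c : Module.Basis (Fin 4) ℝ V,
      LinearMap.BilinForm.toMatrix c B = Matrix.of fun i j => B (c i) (c j) := fun c => by
    ext i j; simp [LinearMap.BilinForm.toMatrix_apply]
  rw [h, h] at this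
  exact this.symm

lemma contraction_eq {B : V →ₗ[ℝ] V →ₗ[ℝ] ℝ} (β : V →ₗ[ℝ] V →ₗ[ℝ] ℝ)
    (b b' : Module.Basis (Fin 4) ℝ V) :
    contraction B β b = contraction B β b' := by
  have h : ∀ c : Module.Basis (Fin 4) ℝ V, contraction B β c =
      ((Matrix.of fun i j => B (c i) (c j))⁻¹ *
        (Matrix.of fun i j => β (c i) (c j)).transpose).trace := fun c => by
    simp [contraction, Matrix.trace, Matrix.mul_apply]
  rw [h b', h b, gram_basis_change B b b', gram_basis_change β b b']
  set T := b.toMatrix b'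
  set G := Matrix.of fun i j => B (b i) (b j)
  set A := Matrix.of fun i j => β (b i) (b j)
  have hT : IsUnit T.det := by
    have h1 : b'.toMatrix b * T = 1 := b'.toMatrix_mul_toMatrix_flip b
    exact IsUnit.of_mul_eq_one_right _ (by rw [← Matrix.det_mul, h1, Matrix.det_one])
  have hT' : IsUnit T.transpose.det := by rwa [Matrix.det_transpose]
  rw [Matrix.mul_inv_rev, Matrix.mul_inv_rev, Matrix.transpose_mul, Matrix.transpose_mul,
    Matrix.transpose_transpose]
  have : T⁻¹ * (G⁻¹ * T.transpose⁻¹) * (T.transpose * (A.transpose * T)) =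
      T⁻¹ * (G⁻¹ * A.transpose * T) := by
    simp only [Matrix.mul_assoc]
    rw [Matrix.nonsing_inv_mul_cancel_left _ _ hT']
  rw [this, Matrix.trace_mul_comm T⁻¹, Matrix.mul_assoc, Matrix.mul_nonsing_inv _ hT, Matrix.mul_one]

lemma exists_quadrilinear {f : V → V → V → V → ℝ}
    (h0 : ∀ a b w x y, f (a + b) w x y = f a w x y + f b w x y)
    (k0 : ∀ c a w x y, f (c • a) w x y = c * f a w x y)
    (h1 : ∀ a b w x y, f w (a + b) x y = f w a x y + f w b x y)
    (k1 : ∀ c a w x y, f w (c • a) x y = c * f w a x y)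
    (h2 : ∀ a b w x y, f w x (a + b) y = f w x a y + f w x b y)
    (k2 : ∀ c a w x y, f w x (c • a) y = c * f w x a y)
    (h3 : ∀ a b w x y, f w x y (a + b) = f w x y a + f w x y b)
    (k3 : ∀ c a w x y, f w x y (c • a) = c * f w x y a) :
    ∃ F : V →ₗ[ℝ] V →ₗ[ℝ] V →ₗ[ℝ] V →ₗ[ℝ] ℝ, ∀ v w x y, f v w x y = F v w x y := by
  let F2 : V → V → V →ₗ[ℝ] V →ₗ[ℝ] ℝ := fun v w => LinearMap.mk₂ ℝ (fun x y => f v w x y)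
    (fun _ _ _ => h2 _ _ _ _ _) (fun _ _ _ => k2 _ _ _ _ _) (fun _ _ _ => h3 _ _ _ _ _)
    (fun _ _ _ => k3 _ _ _ _ _)
  refine ⟨LinearMap.mk₂ ℝ F2 ?_ ?_ ?_ ?_, fun _ _ _ _ => rfl⟩
  · intro a b c; ext x y; exact h0 _ _ _ _ _
  · intro a b c; ext x y; exact k0 _ _ _ _ _
  · intro a b c; ext x y; exact h1 _ _ _ _ _
  · intro a b c; ext x y; exact k1 _ _ _ _ _

/-- An alternating 4-form as an iterated linear map. -/
lemma AlternatingMap.exists_curried (f : V [⋀^Fin 4]→ₗ[ℝ] ℝ) :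
    ∃ F : V →ₗ[ℝ] V →ₗ[ℝ] V →ₗ[ℝ] V →ₗ[ℝ] ℝ, ∀ v w x y, f ![v, w, x, y] = F v w x y := by
  have e0 : ∀ w x y z : V, Function.update ![0, w, x, y] 0 z = ![z, w, x, y] := by
    intros; ext i; fin_cases i <;> rfl
  have e1 : ∀ w x y z : V, Function.update ![w, 0, x, y] 1 z = ![w, z, x, y] := by
    intros; ext i; fin_cases i <;> rfl
  have e2 : ∀ w x y z : V, Function.update ![w, x, 0, y] 2 z = ![w, x, z, y] := by
    intros; ext i; fin_cases i <;> rfl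
  have e3 : ∀ w x y z : V, Function.update ![w, x, y, 0] 3 z = ![w, x, y, z] := by
    intros; ext i; fin_cases i <;> rfl
  have h0 : ∀ (a b w x y : V), f ![a + b, w, x, y] = f ![a, w, x, y] + f ![b, w, x, y] := by
    intro a b w x y
    simpa only [e0] using f.map_update_add ![0, w, x, y] 0 a b
  have k0 : ∀ (c : ℝ) (a w x y : V), f ![c • a, w, x, y] = c * f ![a, w, x, y] := by
    intro c a w x y
    simpa only [e0, smul_eq_mul] using f.map_update_smul ![0, w, x, y] 0 c a
  have h1 : ∀ (a b w x y : V), f ![w, a + b, x, y] = f ![w, a, x, y] + f ![w, b, x, y] := by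
    intro a b w x y
    simpa only [e1] using f.map_update_add ![w, 0, x, y] 1 a b
  have k1 : ∀ (c : ℝ) (a w x y : V), f ![w, c • a, x, y] = c * f ![w, a, x, y] := by
    intro c a w x y
    simpa only [e1, smul_eq_mul] using f.map_update_smul ![w, 0, x, y] 1 c a
  have h2 : ∀ (a b w x y : V), f ![w, x, a + b, y] = f ![w, x, a, y] + f ![w, x, b, y] := by
    intro a b w x y
    simpa only [e2] using f.map_update_add ![w, x, 0, y] 2 a b
  have k2 : ∀ (c : ℝ) (a w x y : V), f ![w, x, c • a, y] = c * f ![w, x, a, y] := by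
    intro c a w x y
    simpa only [e2, smul_eq_mul] using f.map_update_smul ![w, x, 0, y] 2 c a
  have h3 : ∀ (a b w x y : V), f ![w, x, y, a + b] = f ![w, x, y, a] + f ![w, x, y, b] := by
    intro a b w x y
    simpa only [e3] using f.map_update_add ![w, x, y, 0] 3 a b
  have k3 : ∀ (c : ℝ) (a w x y : V), f ![w, x, y, c • a] = c * f ![w, x, y, a] := by
    intro c a w x y
    simpa only [e3, smul_eq_mul] using f.map_update_smul ![w, x, y, 0] 3 c a
  exact exists_quadrilinear h0 k0 h1 k1 h2 k2 h3 k3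

/-- The bilinear form `(y, y') ↦ g^{km} F(v, w, c_k, y) α(c_m, y')`. -/
def hodgeForm (B : V →ₗ[ℝ] V →ₗ[ℝ] ℝ) (c : Module.Basis (Fin 4) ℝ V)
    (F : V →ₗ[ℝ] V →ₗ[ℝ] V →ₗ[ℝ] V →ₗ[ℝ] ℝ) (α : V →ₗ[ℝ] V →ₗ[ℝ] ℝ) (v w : V) :
    V →ₗ[ℝ] V →ₗ[ℝ] ℝ :=
  LinearMap.mk₂ ℝ (fun y y' => ∑ k, ∑ m, (Matrix.of fun i j => B (c i) (c j))⁻¹ k m *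
      (F v w (c k) y * α (c m) y'))
    (by intros; simp [add_mul, mul_add, Finset.sum_add_distrib])
    (by intros; simp [Finset.mul_sum, mul_left_comm, mul_assoc])
    (by intros; simp [mul_add, Finset.sum_add_distrib])
    (by intros; simp [Finset.mul_sum, mul_left_comm])

lemma hodgeForm_eq (B : V →ₗ[ℝ] V →ₗ[ℝ] ℝ) (b c : Module.Basis (Fin 4) ℝ V)
    (F : V →ₗ[ℝ] V →ₗ[ℝ] V →ₗ[ℝ] V →ₗ[ℝ] ℝ) (α : V →ₗ[ℝ] V →ₗ[ℝ] ℝ) (v w : V) :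
    hodgeForm B b F α v w = hodgeForm B c F α v w := by
  ext y y'
  exact contraction_eq (B := B) (LinearMap.mk₂ ℝ (fun x x' => F v w x y * α x' y')
    (by intros; simp; ring) (by intros; simp; ring) (by intros; simp; ring)
    (by intros; simp; ring)) b c

lemma hodgeStar_eq_contraction (B : V →ₗ[ℝ] V →ₗ[ℝ] ℝ) (b : Module.Basis (Fin 4) ℝ V)
    (α : V →ₗ[ℝ] V →ₗ[ℝ] ℝ) {F : V →ₗ[ℝ] V →ₗ[ℝ] V →ₗ[ℝ] V →ₗ[ℝ] ℝ}
    (hF : ∀ v w x y, √|(Matrix.of fun i j => B (b i) (b j)).det| * b.det ![v, w, x, y] = F v w x y)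
    (v w : V) :
    hodgeStar (fun x y => B x y) b (fun x y => α x y) v w =
      (1 / 2) * contraction B (hodgeForm B b F α v w) b := by
  simp only [hodgeStar, contraction, hodgeForm, LinearMap.mk₂_apply, Finset.mul_sum, hF]
  rw [Finset.sum_comm]
  refine Finset.sum_congr rfl fun l _ => ?_
  refine ((Finset.sum_congr rfl fun k _ => Finset.sum_comm).trans Finset.sum_comm).trans ?_
  refine Finset.sum_congr rfl fun n _ => Finset.sum_congr rfl fun k _ =>
    Finset.sum_congr rfl fun m _ => ?_
  ring

/-- The Hodge star only depends on the orientation. -/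
lemma hodgeStar_eq_of_det_pos (B : V →ₗ[ℝ] V →ₗ[ℝ] ℝ) (b b' : Module.Basis (Fin 4) ℝ V)
    (hb : 0 < b.det b') (α : V →ₗ[ℝ] V →ₗ[ℝ] ℝ) (v w : V) :
    hodgeStar (fun x y => B x y) b (fun x y => α x y) v w =
      hodgeStar (fun x y => B x y) b' (fun x y => α x y) v w := by
  obtain ⟨F₀, hF₀⟩ := AlternatingMap.exists_curried b.det
  have hF : ∀ v w x y, √|(Matrix.of fun i j => B (b i) (b j)).det| * b.det ![v, w, x, y] =
      (√|(Matrix.of fun i j => B (b i) (b j)).det| • F₀) v w x y := fun v w x y => by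
    simp [hF₀]
  have hF' : ∀ v w x y, √|(Matrix.of fun i j => B (b' i) (b' j)).det| * b'.det ![v, w, x, y] =
      (√|(Matrix.of fun i j => B (b i) (b j)).det| • F₀) v w x y := fun v w x y => by
    have h1 : b.det = b.det b' • b'.det := AlternatingMap.eq_smul_basis_det b' b.det
    have h2 : b.det b' = (b.toMatrix b').det := b.det_apply b'
    rw [← hF, gram_basis_change B b b', Matrix.det_mul, Matrix.det_mul, Matrix.det_transpose, ← h2]
    have h3 : |b.det b' * (Matrix.of fun i j => B (b i) (b j)).det * b.det b'| =
        b.det b' ^ 2 * |(Matrix.of fun i j => B (b i) (b j)).det| := by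
      rw [abs_mul, abs_mul, abs_of_pos hb]; ring
    have h4 : b.det ![v, w, x, y] = b.det b' * b'.det ![v, w, x, y] :=
      congrArg (fun f : V [⋀^Fin 4]→ₗ[ℝ] ℝ => f ![v, w, x, y]) h1
    rw [h3, Real.sqrt_mul (sq_nonneg _), Real.sqrt_sq hb.le, h4]
    ring
  rw [hodgeStar_eq_contraction B b α hF, hodgeStar_eq_contraction B b' α hF', hodgeForm_eq B b b',
    contraction_eq _ b b']

/-- A basis is normalized if its Gram matrix is `[[0, 1], [1, 0]]` in blocks of size two. Indices are
added in `Fin 4`, that is modulo four, so that `i ↦ i + 2` exchanges the dual basis vectors. -/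
def IsNormalized (B : V →ₗ[ℝ] V →ₗ[ℝ] ℝ) (b : Module.Basis (Fin 4) ℝ V) : Prop :=
  ∀ i j, B (b i) (b j) = if j = i + 2 then 1 else 0

lemma det_basis_apply (b : Module.Basis (Fin 4) ℝ V) (i j k l : Fin 4) :
    b.det ![b i, b j, b k, b l] =
      (Matrix.of fun r c => if r = ![i, j, k, l] c then (1 : ℝ) else 0).det := by
  rw [b.det_apply]
  congr 1
  ext r c
  rw [Module.Basis.toMatrix_apply, Matrix.of_apply]
  have : ![b i, b j, b k, b l] c = b (![i, j, k, l] c) := by fin_cases c <;> rfl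
  rw [this, Module.Basis.repr_self, Finsupp.single_apply]
  simp [eq_comm]

variable {B : V →ₗ[ℝ] V →ₗ[ℝ] ℝ} {b : Module.Basis (Fin 4) ℝ V}

lemma IsNormalized.gram_mul_self (hb : IsNormalized B b) :
    (Matrix.of fun i j => B (b i) (b j)) * (Matrix.of fun i j => B (b i) (b j)) = 1 := by
  ext i j
  simp only [Matrix.mul_apply, Matrix.of_apply, hb _ _, Matrix.one_apply]
  fin_cases i <;> fin_cases j <;> simp [Fin.sum_univ_four]

lemma IsNormalized.gram_inv (hb : IsNormalized B b) :
    (Matrix.of fun i j => B (b i) (b j))⁻¹ = Matrix.of fun i j => B (b i) (b j) :=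
  Matrix.inv_eq_left_inv hb.gram_mul_self

lemma IsNormalized.abs_det_gram (hb : IsNormalized B b) :
    |(Matrix.of fun i j => B (b i) (b j)).det| = 1 := by
  have := congrArg Matrix.det hb.gram_mul_self
  rw [Matrix.det_mul, Matrix.det_one, mul_self_eq_one_iff] at this
  rcases this with h | h <;> simp [h]

lemma IsNormalized.contraction_eq (hb : IsNormalized B b) (β : V →ₗ[ℝ] V →ₗ[ℝ] ℝ) :
    contraction B β b = ∑ k, β (b k) (b (k + 2)) := by
  have h : ∀ k m, (Matrix.of fun i j => B (b i) (b j))⁻¹ k m = if m = k + 2 then 1 else 0 := by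
    intro k m
    rw [hb.gram_inv, Matrix.of_apply, hb]
  simp [contraction, h]

lemma IsNormalized.hodgeStar_apply (hb : IsNormalized B b) (α : V → V → ℝ) (v w : V) :
    hodgeStar (fun x y => B x y) b α v w =
      (1 / 2) * ∑ k, ∑ l, b.det ![v, w, b k, b l] * α (b (k + 2)) (b (l + 2)) := by
  have h : ∀ k m, (Matrix.of fun i j => B (b i) (b j))⁻¹ k m = if m = k + 2 then 1 else 0 := by
    intro k m
    rw [hb.gram_inv, Matrix.of_apply, hb]
  simp only [hodgeStar, hb.abs_det_gram, h]
  simp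

/-- The Hodge star in a normalized basis. -/
lemma IsNormalized.hodgeStar_basis (hb : IsNormalized B b) {α : V → V → ℝ}
    (hα : ∀ v w, α v w = -α w v) (i j : Fin 4) :
    hodgeStar (fun x y => B x y) b α (b i) (b j) =
      !![0, α (b 0) (b 1), α (b 1) (b 3), -α (b 0) (b 3);
        -α (b 0) (b 1), 0, -α (b 1) (b 2), α (b 0) (b 2);
        -α (b 1) (b 3), α (b 1) (b 2), 0, α (b 2) (b 3);
        α (b 0) (b 3), -α (b 0) (b 2), -α (b 2) (b 3), 0] i j := by
  rw [hb.hodgeStar_apply]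
  simp only [det_basis_apply]
  fin_cases i <;> fin_cases j <;>
    simp [Matrix.det_succ_row_zero, Fin.sum_univ_succ, Fin.succAbove] <;>
    linarith [hα (b 0) (b 1), hα (b 0) (b 2), hα (b 0) (b 3), hα (b 1) (b 2), hα (b 1) (b 3),
      hα (b 2) (b 3)]

end HodgeStar

/-! ### Anti-self-dual Weyl tensors -/

section Algebra

/-- The components of an algebraic curvature tensor. -/
structure IsCurvatureLike (R : Fin 4 → Fin 4 → Fin 4 → Fin 4 → ℝ) : Prop where
  antisymm : ∀ i j k l, R i j k l = -R j i k l
  antisymm' : ∀ i j k l, R i j k l = -R i j l k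
  pair : ∀ i j k l, R i j k l = R k l i j
  bianchi : ∀ i j k l, R i j k l + R j k i l + R k i j l = 0

/-- The Ricci tensor of an algebraic curvature tensor in a normalized basis, where raising the index
`i` amounts to replacing it by `i + 2`. -/
def ricciOf (R : Fin 4 → Fin 4 → Fin 4 → Fin 4 → ℝ) (j k : Fin 4) : ℝ := ∑ i, R i j k (i + 2)

/-- The Weyl part of an algebraic curvature tensor in a normalized basis. -/
def weylOf (R : Fin 4 → Fin 4 → Fin 4 → Fin 4 → ℝ) (i j k l : Fin 4) : ℝ :=
  R i j k l - (1 / 2) * (ricciOf R j k * (if l = i + 2 then 1 else 0)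
      + (if k = j + 2 then 1 else 0) * ricciOf R i l - ricciOf R i k * (if l = j + 2 then 1 else 0)
      - (if k = i + 2 then 1 else 0) * ricciOf R j l)
    + ((∑ m, ricciOf R m (m + 2)) / 6) * ((if k = j + 2 then 1 else 0) * (if l = i + 2 then 1 else 0)
      - (if k = i + 2 then 1 else 0) * (if l = j + 2 then 1 else 0))

lemma weylOf_antisymm {R : Fin 4 → Fin 4 → Fin 4 → Fin 4 → ℝ} (hR : IsCurvatureLike R)
    (i j k l : Fin 4) : weylOf R i j k l = -weylOf R j i k l := by
  simp only [weylOf, hR.antisymm i j k l]; ring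

/-- For a curvature tensor which vanishes on the null anti-self-dual bivectors, the
anti-self-dual part of the Weyl tensor vanishes. -/
lemma weylOf_eq {R : Fin 4 → Fin 4 → Fin 4 → Fin 4 → ℝ} (hR : IsCurvatureLike R)
    (h1 : R 0 3 0 3 = 0) (h2 : R 1 2 1 2 = 0) (h3 : R 0 3 0 2 = R 0 3 1 3)
    (h4 : R 1 2 0 2 = R 1 2 1 3)
    (h5 : R 0 2 0 2 - 2 * R 0 2 1 3 + R 1 3 1 3 - 2 * R 0 3 1 2 = 0) (k l : Fin 4) :
    weylOf R 0 3 k l = 0 ∧ weylOf R 1 2 k l = 0 ∧ weylOf R 0 2 k l = weylOf R 1 3 k l := by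
  obtain ⟨A, A', P, B⟩ := hR
  have Z : ∀ i k l, R i i k l = 0 := fun i k l => by linarith [A i i k l]
  have Z' : ∀ i k l, R k l i i = 0 := fun i k l => by linarith [A' k l i i]
  have b := B 0 1 2 3
  fin_cases k <;> fin_cases l <;> refine ⟨?_, ?_, ?_⟩ <;>
    simp [weylOf, ricciOf, Fin.sum_univ_four, Z, Z', A 1 0, A 2 0, A 3 0, A 2 1, A 3 1, A 3 2,
      A' _ _ 1 0, A' _ _ 2 0, A' _ _ 3 0, A' _ _ 2 1, A' _ _ 3 1, A' _ _ 3 2,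
      P 0 2 0 1, P 0 3 0 1, P 1 2 0 1, P 1 3 0 1, P 2 3 0 1, P 0 3 0 2, P 1 2 0 2, P 1 3 0 2,
      P 2 3 0 2, P 1 2 0 3, P 1 3 0 3, P 2 3 0 3, P 1 3 1 2, P 2 3 1 2, P 2 3 1 3] at b h1 h2 h3 h4 h5 ⊢ <;>
    linarith

lemma quartic_eq_zero {a b c d e : ℝ}
    (h : ∀ s t : ℝ, a * s ^ 4 + b * s ^ 3 * t + c * s ^ 2 * t ^ 2 + d * s * t ^ 3 + e * t ^ 4 = 0) :
    a = 0 ∧ b = 0 ∧ c = 0 ∧ d = 0 ∧ e = 0 := by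
  have h1 := h 1 0
  have h2 := h 0 1
  have h3 := h 1 1
  have h4 := h 1 (-1)
  have h5 := h 1 2
  norm_num at h1 h2 h3 h4 h5
  refine ⟨?_, ?_, ?_, ?_, ?_⟩ <;> linarith

end Algebra

/-! ### The anti-self-dual part of the Weyl tensor of a metric -/

section WeylLocal

variable {g : E 4 → E 4 →L[ℝ] E 4 →L[ℝ] ℝ} {y : E 4}

/-- The curvature operator of a connection as an iterated linear map. -/
lemma exists_riem_trilinear {F : Type*} [NormedAddCommGroup F] [NormedSpace ℝ F]
    (G : F → F →L[ℝ] F →L[ℝ] F) (y : F) :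
    ∃ T : F →ₗ[ℝ] F →ₗ[ℝ] F →ₗ[ℝ] F, ∀ u v w, riem G y u v w = T u v w := by
  let T0 : F → F → F →ₗ[ℝ] F := fun u v =>
    ((fderiv ℝ G y u v - fderiv ℝ G y v u + G y u ∘L G y v - G y v ∘L G y u : F →L[ℝ] F) : F →ₗ[ℝ] F)
  refine ⟨LinearMap.mk₂ ℝ T0 ?_ ?_ ?_ ?_, fun _ _ _ => rfl⟩
  all_goals intros; ext x; simp [T0, smul_sub, smul_add]
  all_goals abel

/-- The Gram form of a metric at a point, as a linear map. -/
def metricForm (g : E 4 → E 4 →L[ℝ] E 4 →L[ℝ] ℝ) (y : E 4) : E 4 →ₗ[ℝ] E 4 →ₗ[ℝ] ℝ :=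
  LinearMap.mk₂ ℝ (fun v w => g y v w) (by simp) (by simp) (by simp) (by simp)

lemma metricForm_apply (v w : E 4) : metricForm g y v w = g y v w := rfl

lemma IsNormalized.repr_apply {b : Module.Basis (Fin 4) ℝ (E 4)}
    (hb : IsNormalized (metricForm g y) b) (x : E 4) (i : Fin 4) :
    b.repr x i = g y x (b (i + 2)) := by
  have h := congrArg (fun v => metricForm g y v (b (i + 2))) (b.sum_repr x)
  simp only [map_sum, map_smul, LinearMap.sum_apply, LinearMap.smul_apply, hb _ _] at h
  rw [← metricForm_apply, ← h]
  simp

lemma ricci_eq_trace (hg : IsMetricAt g y) {T : E 4 →ₗ[ℝ] E 4 →ₗ[ℝ] E 4 →ₗ[ℝ] E 4}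
    (hT : ∀ u v w, riem (chr g) y u v w = T u v w) (b : Module.Basis (Fin 4) ℝ (E 4)) (v w : E 4) :
    ricci g y v w = ∑ i, b.repr (T (b i) v w) i := by
  have h : ∀ c : Module.Basis (Fin 4) ℝ (E 4),
      LinearMap.trace ℝ (E 4) ((T.flip v).flip w) = ∑ i, c.repr (T (c i) v w) i := fun c => by
    rw [LinearMap.trace_eq_matrix_trace ℝ c, Matrix.trace]
    simp [LinearMap.toMatrix_apply]
  rw [← h b, h (EuclideanSpace.basisFun (Fin 4) ℝ).toBasis]
  simp [ricci, hg.riemann_eq, hT]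

/-- The components of the Weyl tensor in a normalized basis. -/
lemma weyl_basis (hg : IsMetricAt g y) {b : Module.Basis (Fin 4) ℝ (E 4)}
    (hb : IsNormalized (metricForm g y) b) (i j k l : Fin 4) :
    weyl g y (b i) (b j) (b k) (b l) =
      weylOf (fun i j k l => g y (riem (chr g) y (b i) (b j) (b k)) (b l)) i j k l := by
  obtain ⟨T, hT⟩ := exists_riem_trilinear (chr g) y
  have hr : ∀ v w, ricci g y v w = ∑ i, g y (T (b i) v w) (b (i + 2)) := fun v w => by
    rw [ricci_eq_trace hg hT b]
    simp only [hb.repr_apply]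
  let ρ : E 4 →ₗ[ℝ] E 4 →ₗ[ℝ] ℝ := LinearMap.mk₂ ℝ (fun v w => ricci g y v w)
    (by simp [hr, Finset.sum_add_distrib]) (by simp [hr, Finset.mul_sum])
    (by simp [hr, Finset.sum_add_distrib]) (by simp [hr, Finset.mul_sum])
  have hs : scalar g y = ∑ k, ricci g y (b k) (b (k + 2)) := by
    have h1 : scalar g y = contraction (metricForm g y) ρ (EuclideanSpace.basisFun (Fin 4) ℝ).toBasis := by
      simp [scalar, contraction, gram, metricForm_apply, ρ]
    rw [h1, contraction_eq _ _ b, hb.contraction_eq]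
    rfl
  have hG : ∀ i j, g y (b i) (b j) = if j = i + 2 then 1 else 0 := hb
  simp only [weyl, weylOf, hg.riemann_eq, hs, ricciOf, hG, hr, hT]

lemma weyl_antisymm (hg : IsMetricAt g y) (u v w z : E 4) :
    weyl g y u v w z = -weyl g y v u w z := by
  simp only [weyl, hg.riemann_eq, riem_antisymm _ _ u v, map_neg, neg_apply]
  ring

lemma exists_weyl_quadrilinear (hg : IsMetricAt g y) :
    ∃ W : E 4 →ₗ[ℝ] E 4 →ₗ[ℝ] E 4 →ₗ[ℝ] E 4 →ₗ[ℝ] ℝ, ∀ u v w z, weyl g y u v w z = W u v w z := by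
  obtain ⟨T, hT⟩ := exists_riem_trilinear (chr g) y
  have hr : ∀ v w, ricci g y v w = ∑ i, (T (e i) v w) i := fun v w => by
    simp [ricci, hg.riemann_eq, hT]
  have r1 : ∀ a b w, ricci g y (a + b) w = ricci g y a w + ricci g y b w := by
    simp [hr, Finset.sum_add_distrib]
  have r2 : ∀ (c : ℝ) a w, ricci g y (c • a) w = c * ricci g y a w := by
    simp [hr, Finset.mul_sum]
  have r3 : ∀ a b w, ricci g y w (a + b) = ricci g y w a + ricci g y w b := by
    simp [hr, Finset.sum_add_distrib]
  have r4 : ∀ (c : ℝ) a w, ricci g y w (c • a) = c * ricci g y w a := by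
    simp [hr, Finset.mul_sum]
  refine exists_quadrilinear (f := weyl g y) ?_ ?_ ?_ ?_ ?_ ?_ ?_ ?_ <;> intros <;>
    simp only [weyl, hg.riemann_eq, hT, r1, r2, r3, r4, map_add, map_smul, add_apply, smul_apply,
      smul_eq_mul, LinearMap.add_apply, LinearMap.smul_apply] <;> ring

/-- The anti-self-dual part of the Weyl tensor vanishes if and only if the curvature vanishes on
the null planes spanned by `s b₀ + t b₁` and `t b₂ - s b₃`, for a normalized basis `b`.

The bivectors of these planes are the null anti-self-dual ones, and they span the anti-self-dual
bivectors. Since `W_-` is a trace-free quadratic form on a three-dimensional space, it is determined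
by the five coefficients of the quartic that it defines on this null cone. On totally null planes,
the curvature agrees with the Weyl tensor. -/
theorem weyl_eq_hodgeStar_iff (hg : IsMetricAt g y) {b : Module.Basis (Fin 4) ℝ (E 4)}
    (hb : IsNormalized (metricForm g y) b) :
    (∀ u v w z, weyl g y u v w z =
        hodgeStar (fun x x' => g y x x') b (fun x x' => weyl g y x x' w z) u v) ↔
      ∀ s t : ℝ, g y (riem (chr g) y (s • b 0 + t • b 1) (t • b 2 - s • b 3) (t • b 2 - s • b 3))
        (s • b 0 + t • b 1) = 0 := by
  have hG : ∀ i j, g y (b i) (b j) = if j = i + 2 then 1 else 0 := hb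
  have hstar : ∀ w z i j, hodgeStar (fun x x' => g y x x') b (fun x x' => weyl g y x x' w z)
      (b i) (b j) = _ := fun w z i j =>
    hb.hodgeStar_basis (α := fun x x' => weyl g y x x' w z) (fun _ _ => weyl_antisymm hg _ _ _ _) i j
  obtain ⟨W, hW⟩ := exists_weyl_quadrilinear hg
  constructor
  · intro H s t
    have h03 : ∀ w z, W (b 0) (b 3) w z = 0 := fun w z => by
      have := H (b 0) (b 3) w z
      rw [hstar] at this
      simp [hW] at this
      linarith
    have h12 : ∀ w z, W (b 1) (b 2) w z = 0 := fun w z => by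
      have := H (b 1) (b 2) w z
      rw [hstar] at this
      simp [hW] at this
      linarith
    have h02 : ∀ w z, W (b 0) (b 2) w z = W (b 1) (b 3) w z := fun w z => by
      have := H (b 0) (b 2) w z
      rw [hstar] at this
      simpa [hW] using this
    set u := s • b 0 + t • b 1 with hu
    set v := t • b 2 - s • b 3 with hv
    have n1 : g y u u = 0 := by simp [hu, hG]
    have n2 : g y v v = 0 := by simp [hv, hG]
    have n3 : g y v u = 0 := by simp [hu, hv, hG]; ring
    have n4 : g y u v = 0 := by simp [hu, hv, hG]; ring
    have k : weyl g y u v v u = g y (riem (chr g) y u v v) u := by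
      simp only [weyl, n1, n2, n3, n4, hg.riemann_eq]; ring
    rw [← k, hW]
    have : ∀ w z, W u v w z = 0 := fun w z => by
      simp [hu, hv, h03, h12, h02]; ring
    exact this v u
  · intro H
    obtain ⟨T, hT⟩ := exists_riem_trilinear (chr g) y
    set R : Fin 4 → Fin 4 → Fin 4 → Fin 4 → ℝ :=
      fun i j k l => g y (riem (chr g) y (b i) (b j) (b k)) (b l) with hRdef
    have hR : IsCurvatureLike R :=
      ⟨fun i j k l => by simp only [hRdef]; rw [riem_antisymm]; simp,
        fun i j k l => hg.inner_riem_antisymm _ _ _ _, fun i j k l => hg.inner_riem_pair _ _ _ _,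
        fun i j k l => by
          simp only [hRdef, ← add_apply, ← map_add, hg.bianchi]; simp⟩
    have hq : ∀ s t : ℝ, R 0 3 0 3 * s ^ 4 + (2 * (R 0 3 1 3 - R 0 3 0 2)) * s ^ 3 * t
        + (R 0 2 0 2 - 2 * R 0 2 1 3 + R 1 3 1 3 - 2 * R 0 3 1 2) * s ^ 2 * t ^ 2
        + (2 * (R 1 2 0 2 - R 1 2 1 3)) * s * t ^ 3 + R 1 2 1 2 * t ^ 4 = 0 := by
      intro s t
      have h := H s t
      rw [hg.inner_riem_antisymm] at h
      have hT' : ∀ i j k l, g y (T (b i) (b j) (b k)) (b l) = R i j k l := fun i j k l => by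
        simp only [hRdef, hT]
      simp only [hT, map_add, map_sub, map_smul, LinearMap.add_apply, LinearMap.sub_apply,
        LinearMap.smul_apply, add_apply, sub_apply, smul_apply, smul_eq_mul, hT'] at h
      rw [hR.pair 0 2 0 3, hR.pair 0 2 1 2, hR.pair 1 3 0 2, hR.pair 1 3 0 3, hR.pair 1 2 0 3,
        hR.pair 1 3 1 2] at h
      linarith
    obtain ⟨q1, q2, q3, q4, q5⟩ := quartic_eq_zero hq
    have hw := weylOf_eq hR q1 q5 (by linarith) (by linarith) q3
    obtain ⟨D, hD⟩ := AlternatingMap.exists_curried b.det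
    have hstar' : ∀ u v w z, hodgeStar (fun x x' => g y x x') b (fun x x' => weyl g y x x' w z) u v =
        (1 / 2) * ∑ k, ∑ l, b.det ![u, v, b k, b l] * weyl g y (b (k + 2)) (b (l + 2)) w z :=
      fun u v w z => hb.hodgeStar_apply (fun x x' => weyl g y x x' w z) u v
    obtain ⟨M, hM'⟩ : ∃ M : E 4 →ₗ[ℝ] E 4 →ₗ[ℝ] E 4 →ₗ[ℝ] E 4 →ₗ[ℝ] ℝ, ∀ u v w z,
        W u v w z - (1 / 2) * ∑ k, ∑ l, D u v (b k) (b l) * W (b (k + 2)) (b (l + 2)) w z =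
          M u v w z := by
      refine exists_quadrilinear (f := fun u v w z => W u v w z -
        (1 / 2) * ∑ k, ∑ l, D u v (b k) (b l) * W (b (k + 2)) (b (l + 2)) w z)
        ?_ ?_ ?_ ?_ ?_ ?_ ?_ ?_ <;> intros <;>
      simp only [map_add, map_smul, LinearMap.add_apply, LinearMap.smul_apply,
        smul_eq_mul, Fin.sum_univ_four] <;> ring
    have hM : ∀ u v w z, weyl g y u v w z -
        hodgeStar (fun x x' => g y x x') b (fun x x' => weyl g y x x' w z) u v = M u v w z :=
      fun u v w z => by
        rw [hstar', ← hM']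
        simp only [hW, hD]
    have hM0 : M = 0 := by
      refine b.ext fun i => b.ext fun j => b.ext fun k => b.ext fun l => ?_
      rw [← hM, hstar]
      simp only [weyl_basis hg hb]
      obtain ⟨w1, w2, w3⟩ := hw k l
      have A := fun i j => weylOf_antisymm hR i j k l
      have A0 := A 0 0
      have A1 := A 1 1
      have A2 := A 2 2
      have A3 := A 3 3
      fin_cases i <;> fin_cases j <;> simp <;>
        linarith [A 0 1, A 0 2, A 0 3, A 1 2, A 1 3, A 2 3]
    intro u v w z
    have := hM u v w z
    rw [hM0] at this
    simp at this
    linarith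

end WeylLocal

/-! ### Composition operators on spaces of continuous functions -/

section CompositionOperator

variable {K : Type} [TopologicalSpace K] [CompactSpace K]
  {A : Type} [NormedAddCommGroup A] [NormedSpace ℝ A]

/-- Pointwise evaluation of a continuous family of linear maps on a continuous function. -/
def pointwiseApply (K : Type) [TopologicalSpace K] [CompactSpace K]
    (A : Type) [NormedAddCommGroup A] [NormedSpace ℝ A]
    (B : Type) [NormedAddCommGroup B] [NormedSpace ℝ B] :
    C(K, A →L[ℝ] B) →L[ℝ] C(K, A) →L[ℝ] C(K, B) :=
  LinearMap.mkContinuous₂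
    (LinearMap.mk₂ ℝ (fun (L : C(K, A →L[ℝ] B)) (h : C(K, A)) =>
        (⟨fun t => L t (h t), L.continuous.clm_apply h.continuous⟩ : C(K, B)))
      (fun _ _ _ => by ext; simp) (fun _ _ _ => by ext; simp)
      (fun _ _ _ => by ext; simp) (fun _ _ _ => by ext; simp)) 1
    (fun L h => by
      rw [one_mul]
      refine (ContinuousMap.norm_le _ (by positivity)).2 fun t => ?_
      exact (L t).le_of_opNorm_le_of_le (L.norm_coe_le_norm t) (h.norm_coe_le_norm t))

@[simp] lemma pointwiseApply_apply {B : Type} [NormedAddCommGroup B] [NormedSpace ℝ B]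
    (L : C(K, A →L[ℝ] B)) (h : C(K, A)) (t : K) : pointwiseApply K A B L h t = L t (h t) := rfl

lemma hasFDerivAt_comp_left {B : Type} [NormedAddCommGroup B] [NormedSpace ℝ B] (f : C(A, B))
    (f' : C(A, A →L[ℝ] B)) (hf : ∀ a, HasFDerivAt f (f' a) a) (u : C(K, A)) :
    HasFDerivAt (fun v : C(K, A) => f.comp v) (pointwiseApply K A B (f'.comp u)) u := by
  rw [hasFDerivAt_iff_isLittleO_nhds_zero, Asymptotics.isLittleO_iff]
  intro ε hε
  have hc : ContinuousAt (fun v : C(K, A) => f'.comp v) u :=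
    (ContinuousMap.continuous_postcomp f').continuousAt
  obtain ⟨δ, hδ, hd⟩ := Metric.continuousAt_iff.1 hc ε hε
  filter_upwards [Metric.ball_mem_nhds (0 : C(K, A)) hδ] with h hh
  rw [mem_ball_zero_iff] at hh
  refine (ContinuousMap.norm_le _ (by positivity)).2 fun t => ?_
  have bound : ∀ z ∈ segment ℝ (u t) (u t + h t), ‖f' z - f' (u t)‖ ≤ ε := by
    intro z hz
    rw [segment_eq_image'] at hz
    obtain ⟨s, hs, rfl⟩ := hz
    have h1 : dist (u + s • h) u < δ := by
      rw [dist_eq_norm, add_sub_cancel_left, norm_smul, Real.norm_eq_abs, abs_of_nonneg hs.1]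
      exact (mul_le_of_le_one_left (norm_nonneg _) hs.2).trans_lt hh
    have h2 := (ContinuousMap.dist_apply_le_dist t).trans (hd h1).le
    rw [dist_eq_norm] at h2
    simpa using h2
  have := Convex.norm_image_sub_le_of_norm_hasFDerivWithin_le'
    (fun z _ => (hf z).hasFDerivWithinAt) bound (convex_segment _ _) (left_mem_segment ℝ _ _)
    (right_mem_segment ℝ _ _)
  simp only [add_sub_cancel_left] at this
  refine this.trans (mul_le_mul_of_nonneg_left (h.norm_coe_le_norm t) hε.le)

/-- Composition with a smooth map is a smooth operator on continuous functions. -/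
lemma contDiff_comp_left {B : Type} [NormedAddCommGroup B] [NormedSpace ℝ B] (f : C(A, B))
    (hf : ContDiff ℝ ∞ f) : ContDiff ℝ ∞ (fun v : C(K, A) => f.comp v) := by
  rw [contDiff_infty]
  intro n
  induction n generalizing B with
  | zero => exact contDiff_zero.2 (ContinuousMap.continuous_postcomp f)
  | succ n ih =>
    have h1 : ContDiff ℝ ∞ (fderiv ℝ f) := hf.fderiv_right (by simp)
    let f' : C(A, A →L[ℝ] B) := ⟨fderiv ℝ f, h1.continuous⟩
    rw [Nat.cast_add, Nat.cast_one, contDiff_succ_iff_hasFDerivAt]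
    refine ⟨fun v => pointwiseApply K A B (f'.comp v),
      (pointwiseApply K A B).contDiff.comp (ih f' h1), fun u => ?_⟩
    exact hasFDerivAt_comp_left f f'
      (fun a => (hf.differentiable (by simp)).differentiableAt.hasFDerivAt) u

end CompositionOperator

/-! ### The smooth inverse function theorem -/

section InverseFunction

variable {A : Type*} [NormedAddCommGroup A] [NormedSpace ℝ A] [CompleteSpace A]
  {B : Type*} [NormedAddCommGroup B] [NormedSpace ℝ B]

/-- The inverse function theorem for smooth maps. -/
theorem exists_smooth_inverse {H : A → B} {U : Set A} (hU : IsOpen U) {a : A} (ha : a ∈ U)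
    (hH : ContDiffOn ℝ ∞ H U) (hinv : (fderiv ℝ H a).IsInvertible) :
    ∃ Θ : OpenPartialHomeomorph A B, a ∈ Θ.source ∧ Θ.source ⊆ U ∧ (∀ x, Θ x = H x) ∧
      (∀ x ∈ Θ.source, (fderiv ℝ H x).IsInvertible) ∧ ContDiffOn ℝ ∞ Θ.symm Θ.target := by
  have hat : ∀ x ∈ U, ContDiffAt ℝ ∞ H x := fun x hx => hH.contDiffAt (hU.mem_nhds hx)
  obtain ⟨L, hL⟩ := hinv
  have hd : HasFDerivAt H (L : A →L[ℝ] B) a := by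
    rw [hL]; exact ((hat a ha).differentiableAt (by simp)).hasFDerivAt
  let Θ₀ := (hat a ha).toOpenPartialHomeomorph H hd (by simp)
  have hev : ∀ᶠ x in 𝓝 a, x ∈ U ∧ (fderiv ℝ H x).IsInvertible := by
    have hc : ContinuousAt (fderiv ℝ H) a :=
      ((hat a ha).fderiv_right (m := 0) (by simp)).continuousAt
    exact (hU.eventually_mem ha).and
      (eventually_isInvertible_of_continuousAt hc ⟨L, hL⟩)
  obtain ⟨W, hW, hWo, haW⟩ := eventually_nhds_iff.1 hev
  refine ⟨Θ₀.restrOpen W hWo, ?_, ?_, fun x => rfl, ?_, ?_⟩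
  · rw [OpenPartialHomeomorph.restrOpen_source]
    exact ⟨ContDiffAt.mem_toOpenPartialHomeomorph_source _ _ _, haW⟩
  · rw [OpenPartialHomeomorph.restrOpen_source]
    exact fun x hx => (hW x hx.2).1
  · rw [OpenPartialHomeomorph.restrOpen_source]
    exact fun x hx => (hW x hx.2).2
  · intro y hy
    have hx := (Θ₀.restrOpen W hWo).map_target hy
    rw [OpenPartialHomeomorph.restrOpen_source] at hx
    have hx' := hW _ hx.2
    obtain ⟨M, hM⟩ := hx'.2
    refine (OpenPartialHomeomorph.contDiffAt_symm _ hy (f₀' := M) ?_ (hat _ hx'.1)).contDiffWithinAt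
    rw [hM]
    exact ((hat _ hx'.1).differentiableAt (by simp)).hasFDerivAt

end InverseFunction

/-! ### The Frobenius theorem for graphs -/

section Frobenius

open Set

variable {X : Type} [NormedAddCommGroup X] [NormedSpace ℝ X] [CompleteSpace X]
  {Y : Type} [NormedAddCommGroup Y] [NormedSpace ℝ Y] [CompleteSpace Y]

/-- The unit interval. -/
local notation "𝕀" => Icc (0 : ℝ) 1

/-- Integration `w ↦ (t ↦ ∫₀ᵗ w)` on continuous functions on the unit interval. -/
def primitiveL (X : Type) [NormedAddCommGroup X] [NormedSpace ℝ X] : C(𝕀, X) →L[ℝ] C(𝕀, X) :=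
  LinearMap.mkContinuous
    { toFun := fun w => ⟨fun t => ∫ τ in (0 : ℝ)..t, IccExtend zero_le_one w τ,
        (intervalIntegral.continuous_primitive (fun _ _ =>
          (w.continuous.Icc_extend').intervalIntegrable _ _) 0).comp continuous_subtype_val⟩
      map_add' := fun v w => by
        ext t
        simp only [ContinuousMap.coe_mk, ContinuousMap.add_apply]
        rw [← intervalIntegral.integral_add (v.continuous.Icc_extend'.intervalIntegrable _ _)
          (w.continuous.Icc_extend'.intervalIntegrable _ _)]
        rfl
      map_smul' := fun c w => by
        ext t
        simp only [ContinuousMap.coe_mk, ContinuousMap.smul_apply, RingHom.id_apply]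
        rw [← intervalIntegral.integral_smul]
        rfl } 1 fun w => by
    rw [one_mul]
    refine (ContinuousMap.norm_le _ (norm_nonneg _)).2 fun t => ?_
    have := intervalIntegral.norm_integral_le_of_norm_le_const (a := (0 : ℝ)) (b := t)
      (f := IccExtend zero_le_one w) (C := ‖w‖) fun x _ => w.norm_coe_le_norm _
    refine this.trans ?_
    rw [sub_zero, abs_of_nonneg t.2.1]
    exact mul_le_of_le_one_right (norm_nonneg _) t.2.2

lemma primitiveL_apply (w : C(𝕀, X)) (t : 𝕀) :
    primitiveL X w t = ∫ τ in (0 : ℝ)..t, IccExtend zero_le_one w τ := rfl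

/-- Constant functions on the unit interval. -/
def constL (X : Type) [NormedAddCommGroup X] [NormedSpace ℝ X] : X →L[ℝ] C(𝕀, X) :=
  LinearMap.mkContinuous
    { toFun := fun x => ContinuousMap.const _ x
      map_add' := fun _ _ => rfl
      map_smul' := fun _ _ => rfl } 1 fun x => by
    rw [one_mul]
    exact (ContinuousMap.norm_le _ (norm_nonneg _)).2 fun t => le_rfl

/-- The linear map `(u, y) ↦ (t ↦ (u(t), t y, y))`. -/
def rayL (X Y : Type) [NormedAddCommGroup X] [NormedSpace ℝ X] [NormedAddCommGroup Y]
    [NormedSpace ℝ Y] : C(𝕀, X) × Y →L[ℝ] C(𝕀, (X × Y) × Y) :=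
  LinearMap.mkContinuous
    { toFun := fun p => ⟨fun t => ((p.1 t, (t : ℝ) • p.2), p.2), by fun_prop⟩
      map_add' := fun _ _ => by ext <;> simp
      map_smul' := fun c _ => by ext <;> simp [smul_comm c] } 1 fun p => by
    rw [one_mul]
    refine (ContinuousMap.norm_le _ (norm_nonneg _)).2 fun t => ?_
    refine norm_prod_le_iff.2 ⟨norm_prod_le_iff.2 ⟨?_, ?_⟩, norm_snd_le p⟩
    · exact (p.1.norm_coe_le_norm t).trans (norm_fst_le p)
    · change ‖(t : ℝ) • p.2‖ ≤ _
      rw [norm_smul, Real.norm_eq_abs, abs_of_nonneg t.2.1]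
      exact (mul_le_of_le_one_left (norm_nonneg _) t.2.2).trans (norm_snd_le p)

lemma rayL_apply (p : C(𝕀, X) × Y) (t : 𝕀) : rayL X Y p t = ((p.1 t, (t : ℝ) • p.2), p.2) := rfl

/-- A smooth integrable field of graphs `{(B(z) η, η)}` has smooth integral manifolds: the solutions
`θ(x, ·)` of `∂_η θ = B(θ, y) η` with `θ(x, 0) = x` depend smoothly on `(x, y)`.

Along the rays `t ↦ t y`, the solution is found by the implicit function theorem in the space of
continuous functions on the unit interval. Its derivative in the direction `η` satisfies the same
linear integral equation as `t ↦ t B(u(t), t y) η`, by integrability, hence they agree. -/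
theorem exists_frobenius {B : X × Y → Y →L[ℝ] X} (hB : ContDiff ℝ ∞ B) (x₀ : X)
    {U : Set (X × Y)} (hU : U ∈ 𝓝 (x₀, (0 : Y)))
    (hint : ∀ z ∈ U, ∀ η ζ, fderiv ℝ B z (B z η, η) ζ = fderiv ℝ B z (B z ζ, ζ) η) :
    ∃ (θ : X × Y → X) (r : ℝ), 0 < r ∧ ContDiffOn ℝ ∞ θ (Metric.ball x₀ r ×ˢ Metric.ball 0 r) ∧
      (∀ x ∈ Metric.ball x₀ r, θ (x, 0) = x) ∧
      ∀ z ∈ Metric.ball x₀ r ×ˢ Metric.ball (0 : Y) r, ∀ η,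
        fderiv ℝ θ z (0, η) = B (θ z, z.2) η := by
  -- the right-hand side of the equation along rays
  have hfd : ContDiff ℝ ∞ (fun p : (X × Y) × Y => B p.1 p.2) :=
    (hB.comp contDiff_fst).clm_apply contDiff_snd
  let f : C((X × Y) × Y, X) := ⟨fun p => B p.1 p.2, hfd.continuous⟩
  let f' : C((X × Y) × Y, (X × Y) × Y →L[ℝ] X) :=
    ⟨fderiv ℝ (fun p : (X × Y) × Y => B p.1 p.2), (hfd.fderiv_right (m := 0) (by simp)).continuous⟩
  have hf' : ∀ p, HasFDerivAt f (f' p) p := fun p =>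
    (hfd.differentiable (by simp)).differentiableAt.hasFDerivAt
  have hf'_apply : ∀ p q, f' p q = fderiv ℝ B p.1 q.1 p.2 + B p.1 q.2 := by
    intro p q
    have h1 : HasFDerivAt (fun p : (X × Y) × Y => B p.1)
        ((fderiv ℝ B p.1).comp (ContinuousLinearMap.fst ℝ _ _)) p :=
      HasFDerivAt.comp (g := B) p (hB.differentiable (by simp)).differentiableAt.hasFDerivAt
        hasFDerivAt_fst
    have h2 := h1.clm_apply (hasFDerivAt_snd (p := p))
    rw [(hf' p).unique h2]
    simp [add_comm]
  let N : C(𝕀, X) × Y → C(𝕀, X) := fun q => f.comp (rayL X Y q)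
  have hN : ContDiff ℝ ∞ N := (contDiff_comp_left f hfd).comp (rayL X Y).contDiff
  have hN' : ∀ q, HasFDerivAt N
      ((pointwiseApply 𝕀 ((X × Y) × Y) X (f'.comp (rayL X Y q))).comp (rayL X Y)) q := fun q =>
    HasFDerivAt.comp (g := fun v : C(𝕀, (X × Y) × Y) => f.comp v) q
      (hasFDerivAt_comp_left f f' hf' _) (rayL X Y).hasFDerivAt
  let H : C(𝕀, X) × (X × Y) → C(𝕀, X) × (X × Y) := fun q =>
    (q.1 - constL X q.2.1 - primitiveL X (N (q.1, q.2.2)), q.2)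
  have hH : ContDiff ℝ ∞ H := by
    refine ContDiff.prodMk (((contDiff_fst).sub ((constL X).contDiff.comp
      (contDiff_fst.comp contDiff_snd))).sub ((primitiveL X).contDiff.comp (hN.comp ?_))) contDiff_snd
    exact contDiff_fst.prodMk (contDiff_snd.comp contDiff_snd)
  have hH' : ∀ q δ, fderiv ℝ H q δ = (δ.1 - constL X δ.2.1 - primitiveL X
      (pointwiseApply 𝕀 ((X × Y) × Y) X (f'.comp (rayL X Y (q.1, q.2.2)))
        (rayL X Y (δ.1, δ.2.2))), δ.2) := by
    intro q δ
    have h0 : HasFDerivAt (fun q : C(𝕀, X) × (X × Y) => (q.1, q.2.2)) _ q :=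
      (hasFDerivAt_fst (p := q)).prodMk
        ((ContinuousLinearMap.snd ℝ X Y).comp
          (ContinuousLinearMap.snd ℝ C(𝕀, X) (X × Y))).hasFDerivAt
    have h1 : HasFDerivAt (fun q : C(𝕀, X) × (X × Y) => constL X q.2.1) _ q :=
      (constL X).hasFDerivAt.comp q
        ((ContinuousLinearMap.fst ℝ X Y).comp
          (ContinuousLinearMap.snd ℝ C(𝕀, X) (X × Y))).hasFDerivAt
    have h2 : HasFDerivAt (fun q : C(𝕀, X) × (X × Y) => primitiveL X (N (q.1, q.2.2))) _ q :=
      (primitiveL X).hasFDerivAt.comp q (HasFDerivAt.comp (g := N) q (hN' _) h0)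
    have h3 : HasFDerivAt H _ q := (((hasFDerivAt_fst (p := q)).sub h1).sub h2).prodMk (hasFDerivAt_snd (p := q))
    rw [h3.fderiv]
    rfl
  -- the inverse function theorem at the constant solution
  let a₀ : C(𝕀, X) × (X × Y) := (constL X x₀, (x₀, 0))
  have hN0 : ∀ u, N (u, 0) = 0 := fun u => by
    ext t
    change B _ (0 : Y) = 0
    exact map_zero _
  have hHx : ∀ x, H (constL X x, (x, 0)) = (0, (x, 0)) := fun x => by
    simp [H, hN0]
  have hinv : (fderiv ℝ H a₀).IsInvertible := by
    have hl : ∀ δu : C(𝕀, X), fderiv ℝ H a₀ (δu, 0) = (δu, 0) := by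
      intro δu
      rw [hH']
      have : pointwiseApply 𝕀 ((X × Y) × Y) X (f'.comp (rayL X Y (a₀.1, a₀.2.2)))
          (rayL X Y (δu, 0)) = 0 := by
        ext t
        simp only [pointwiseApply_apply, ContinuousMap.comp_apply, hf'_apply, rayL_apply, a₀]
        simp
      simp [this]
    have hs : ∀ δ, (fderiv ℝ H a₀ δ).2 = δ.2 := fun δ => by rw [hH']
    set A := fderiv ℝ H a₀
    have hA : ∀ δ, A δ = (δ.1 + (A (0, δ.2)).1, δ.2) := fun δ => by
      refine Prod.ext ?_ (hs δ)
      have : δ = (δ.1, 0) + (0, δ.2) := by simp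
      conv_lhs => rw [this, map_add, hl]
      rfl
    refine ContinuousLinearMap.IsInvertible.of_inverse (g :=
      ((ContinuousLinearMap.fst ℝ C(𝕀, X) (X × Y) -
        (ContinuousLinearMap.fst ℝ C(𝕀, X) (X × Y)) ∘L A ∘L
        (ContinuousLinearMap.inr ℝ C(𝕀, X) (X × Y)) ∘L (ContinuousLinearMap.snd ℝ C(𝕀, X) (X × Y))).prod
        (ContinuousLinearMap.snd ℝ C(𝕀, X) (X × Y)))) ?_ ?_
    · refine ContinuousLinearMap.ext fun δ => ?_
      change A (δ.1 - (A (0, δ.2)).1, δ.2) = δ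
      rw [hA]
      simp
    · refine ContinuousLinearMap.ext fun δ => ?_
      change ((A δ).1 - (A (0, (A δ).2)).1, (A δ).2) = δ
      rw [hs, hA δ]
      simp
  obtain ⟨Θ, ha₀, -, hΘ, hΘinv, hΘs⟩ :=
    exists_smooth_inverse isOpen_univ (mem_univ a₀) hH.contDiffOn hinv
  have hΘ0 : Θ a₀ = (0, (x₀, 0)) := (hΘ a₀).trans (hHx x₀)
  have hsymm0 : Θ.symm (0, (x₀, 0)) = a₀ := by rw [← hΘ0, Θ.left_inv ha₀]
  have htgt : (0, (x₀, (0 : Y))) ∈ Θ.target := hΘ0 ▸ Θ.map_source ha₀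
  let S : X × Y → C(𝕀, X) × (X × Y) := fun z => Θ.symm (0, z)
  -- a neighbourhood on which the solution stays in `U`
  obtain ⟨ε, hε, hεU⟩ := Metric.mem_nhds_iff.1 hU
  have hcont : ContinuousAt S (x₀, 0) := by
    have h1 : ContinuousAt Θ.symm ((0 : C(𝕀, X)), (x₀, (0 : Y))) := Θ.continuousAt_symm htgt
    exact ContinuousAt.comp (g := Θ.symm) h1 (by fun_prop)
  have ev1 : ∀ᶠ z in 𝓝 (x₀, (0 : Y)), ((0 : C(𝕀, X)), z) ∈ Θ.target :=
    (by fun_prop : ContinuousAt (fun z : X × Y => ((0 : C(𝕀, X)), z)) (x₀, 0)).eventually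
      (Θ.open_target.mem_nhds htgt)
  have ev2 : ∀ᶠ z in 𝓝 (x₀, (0 : Y)), dist (S z) a₀ < ε := by
    have : S (x₀, 0) = a₀ := hsymm0
    have h := hcont.eventually (Metric.ball_mem_nhds _ hε)
    rwa [this] at h
  have ev3 : ∀ᶠ z in 𝓝 (x₀, (0 : Y)), (constL X z.1, (z.1, (0 : Y))) ∈ Θ.source := by
    refine (by fun_prop : ContinuousAt
      (fun z : X × Y => (constL X z.1, (z.1, (0 : Y)))) (x₀, 0)).eventually ?_
    exact Θ.open_source.mem_nhds ha₀
  obtain ⟨r, hr, hrev⟩ := Metric.eventually_nhds_iff_ball.1 (ev1.and (ev2.and ev3))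
  have hball : ∀ z ∈ Metric.ball x₀ r ×ˢ Metric.ball (0 : Y) r, z ∈ Metric.ball (x₀, (0 : Y)) r :=
    fun z hz => by rwa [ball_prod_same] at hz
  have hSs : ∀ z ∈ Metric.ball x₀ r ×ˢ Metric.ball (0 : Y) r, ContDiffAt ℝ ∞ S z := fun z hz => by
    have h1 := hΘs.contDiffAt (Θ.open_target.mem_nhds (hrev z (hball z hz)).1)
    exact ContDiffAt.comp (g := Θ.symm) z h1 (contDiffAt_const.prodMk contDiffAt_id)
  let ev : C(𝕀, X) →L[ℝ] X := ContinuousMap.evalCLM ℝ (⟨1, by simp⟩ : 𝕀)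
  refine ⟨fun z => ev (S z).1, r, hr, fun z hz => ?_, fun x hx => ?_, fun z hz η => ?_⟩
  · exact (ev.contDiff.contDiffAt.comp z (contDiffAt_fst.comp z (hSs z hz))).contDiffWithinAt
  · have h3 := (hrev (x, 0) (hball _ ⟨hx, Metric.mem_ball_self hr⟩)).2.2
    have : S (x, 0) = (constL X x, (x, 0)) := by
      change Θ.symm _ = _
      rw [← hHx, ← hΘ, Θ.left_inv h3]
    simp only [this]
    rfl
  · have hSz : ∀ z' ∈ Metric.ball x₀ r ×ˢ Metric.ball (0 : Y) r, H (S z') = (0, z') := fun z' hz' => by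
      rw [← hΘ]; exact Θ.right_inv (hrev z' (hball _ hz')).1
    have hS2 : (S z).2 = z := congrArg Prod.snd (hSz z hz)
    set u := (S z).1 with hu
    have hueq : ∀ t : 𝕀, u t = z.1 + ∫ τ in (0 : ℝ)..t, IccExtend zero_le_one (N (u, z.2)) τ := by
      intro t
      have h1 : u - constL X (S z).2.1 - primitiveL X (N (u, (S z).2.2)) = 0 :=
        congrArg Prod.fst (hSz z hz)
      rw [hS2] at h1
      have h2 := congrArg (fun w : C(𝕀, X) => w t) h1
      simp only [ContinuousMap.sub_apply, ContinuousMap.zero_apply, primitiveL_apply] at h2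
      rw [sub_eq_zero] at h2
      rw [← h2]
      change _ = z.1 + (u t - z.1)
      abel
    have huU : ∀ t : 𝕀, (u t, (t : ℝ) • z.2) ∈ U := by
      intro t
      apply hεU
      have h1 : dist (S z) a₀ < ε := (hrev z (hball z hz)).2.1
      rw [Prod.dist_eq, max_lt_iff, hS2] at h1
      rw [Metric.mem_ball, Prod.dist_eq, max_lt_iff]
      refine ⟨(ContinuousMap.dist_apply_le_dist t).trans_lt h1.1, ?_⟩
      have h2 := h1.2
      rw [Prod.dist_eq, max_lt_iff] at h2
      rw [dist_zero_right, norm_smul, Real.norm_eq_abs, abs_of_nonneg t.2.1]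
      refine (mul_le_of_le_one_left (norm_nonneg _) t.2.2).trans_lt ?_
      simpa [a₀] using h2.2
    -- the solution, extended to the line
    let n : ℝ → X := IccExtend zero_le_one (N (u, z.2))
    have hn : Continuous n := (N (u, z.2)).continuous.Icc_extend'
    let φ : ℝ → X := fun t => z.1 + ∫ τ in (0 : ℝ)..t, n τ
    have hφ : ∀ t, HasDerivAt φ (n t) t := fun t =>
      (intervalIntegral.integral_hasDerivAt_right (hn.intervalIntegrable _ _)
        (hn.stronglyMeasurableAtFilter _ _) hn.continuousAt).const_add _
    let ψ : ℝ → X := fun t => t • B (φ t, t • z.2) η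
    have hz' : ∀ t : ℝ, HasDerivAt (fun t : ℝ => (φ t, t • z.2)) (n t, z.2) t := fun t => by
      simpa using (hφ t).prodMk ((hasDerivAt_id t).smul_const z.2)
    have hψ : ∀ t, HasDerivAt ψ (t • fderiv ℝ B (φ t, t • z.2) (n t, z.2) η
        + B (φ t, t • z.2) η) t := fun t => by
      have h1 := HasFDerivAt.comp_hasDerivAt (l := B) t
        (hB.differentiable (by simp)).differentiableAt.hasFDerivAt (hz' t)
      have h2 := h1.clm_apply (hasDerivAt_const t η)
      have h3 : HasDerivAt ψ _ t := (hasDerivAt_id t).smul h2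
      simpa using h3
    have hψc : Continuous ψ := continuous_iff_continuousAt.2 fun t => (hψ t).continuousAt
    let w : C(𝕀, X) := ⟨fun t => ψ t, hψc.comp continuous_subtype_val⟩
    have hw : w = primitiveL X (pointwiseApply 𝕀 ((X × Y) × Y) X
        (f'.comp (rayL X Y (u, z.2))) (rayL X Y (w, η))) := by
      ext t
      rw [primitiveL_apply]
      set m := pointwiseApply 𝕀 ((X × Y) × Y) X (f'.comp (rayL X Y (u, z.2))) (rayL X Y (w, η))
      have hd : ∀ τ ∈ uIcc (0 : ℝ) t, HasDerivAt ψ (IccExtend zero_le_one m τ) τ := by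
        intro τ hτ
        rw [uIcc_of_le t.2.1] at hτ
        have hτ' : τ ∈ 𝕀 := ⟨hτ.1, hτ.2.trans t.2.2⟩
        convert hψ τ using 1
        have e1 : φ τ = u ⟨τ, hτ'⟩ := (hueq ⟨τ, hτ'⟩).symm
        have e2 : n τ = B (φ τ, τ • z.2) z.2 := by
          change IccExtend zero_le_one (N (u, z.2)) τ = _
          rw [IccExtend_of_mem _ _ hτ', e1]
          rfl
        rw [IccExtend_of_mem _ _ hτ']
        change f' _ _ = _
        rw [hf'_apply, rayL_apply, rayL_apply]
        have hi := hint _ (huU ⟨τ, hτ'⟩) z.2 η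
        rw [e2, e1, hi]
        congr 1
        change fderiv ℝ B (u ⟨τ, hτ'⟩, τ • z.2) (ψ τ, τ • η) z.2 = _
        have : (ψ τ, τ • η) = τ • (B (u ⟨τ, hτ'⟩, τ • z.2) η, η) := by
          simp only [ψ, e1, Prod.smul_mk]
        rw [this, map_smul]
        rfl
      have := intervalIntegral.integral_eq_sub_of_hasDerivAt hd
        (m.continuous.Icc_extend'.intervalIntegrable _ _)
      rw [this]
      change ψ t = ψ t - ψ 0
      simp [ψ]
    have hSd : DifferentiableAt ℝ S z := (hSs z hz).differentiableAt (by simp)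
    have hopen : Metric.ball x₀ r ×ˢ Metric.ball (0 : Y) r ∈ 𝓝 z :=
      (Metric.isOpen_ball.prod Metric.isOpen_ball).mem_nhds hz
    have hA : fderiv ℝ H (S z) (fderiv ℝ S z (0, η)) = (0, (0, η)) := by
      have e1 : (fun z' => H (S z')) =ᶠ[𝓝 z] fun z' => ((0 : C(𝕀, X)), z') :=
        Filter.eventually_of_mem hopen hSz
      have e2 := (HasFDerivAt.comp (g := H) z
        (hH.differentiable (by simp)).differentiableAt.hasFDerivAt hSd.hasFDerivAt).fderiv
      have e3 := (ContinuousLinearMap.inr ℝ C(𝕀, X) (X × Y)).hasFDerivAt (x := z)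
      have e4 := congrArg (fun L : X × Y →L[ℝ] C(𝕀, X) × (X × Y) => L (0, η))
        (e2.symm.trans (e1.fderiv_eq.trans e3.fderiv))
      simpa using e4
    have hA' : fderiv ℝ H (S z) (w, (0, η)) = (0, (0, η)) := by
      rw [hH', hS2]
      refine Prod.ext ?_ rfl
      change w - constL X 0 - primitiveL X _ = 0
      rw [map_zero, sub_zero, sub_eq_zero]
      exact hw
    have hSmem : S z ∈ Θ.source := Θ.map_target (hrev z (hball z hz)).1
    have hSw : fderiv ℝ S z (0, η) = (w, (0, η)) :=
      (hΘinv _ hSmem).injective (hA.trans hA'.symm)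
    have hfin := (((ev.comp (ContinuousLinearMap.fst ℝ C(𝕀, X) (X × Y))).hasFDerivAt
      (x := S z)).comp z hSd.hasFDerivAt).fderiv
    have hfin' : fderiv ℝ (fun z => ev (S z).1) z (0, η) = ev (fderiv ℝ S z (0, η)).1 :=
      congrArg (fun L : X × Y →L[ℝ] X => L (0, η)) hfin
    rw [hfin', hSw]
    change ψ 1 = B (u ⟨1, _⟩, z.2) η
    have e1 : φ 1 = u ⟨1, by simp⟩ := (hueq ⟨1, by simp⟩).symm
    simp [ψ, e1]

end Frobenius

/-! ### Metrics in charts -/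

open Filter Set

lemma isInvertible_of_injective {F F' : Type*} [NormedAddCommGroup F] [NormedSpace ℝ F]
    [FiniteDimensional ℝ F] [NormedAddCommGroup F'] [NormedSpace ℝ F'] [FiniteDimensional ℝ F']
    {L : F →L[ℝ] F'} (hL : Function.Injective L)
    (h : Module.finrank ℝ F = Module.finrank ℝ F') : L.IsInvertible :=
  ⟨(LinearEquiv.ofInjectiveOfFinrankEq (L : F →ₗ[ℝ] F') hL h).toContinuousLinearEquiv, by
    ext v; rfl⟩

section Frames

variable {n : ℕ} {M : Type*} [TopologicalSpace M] [ChartedSpace (E n) M] [IsManifold (𝓡 n) ∞ M]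

/-- The coordinate frame of the preferred chart at `p`, at the point with coordinates `y`. -/
def frame (p : M) (y : E n) : E n →L[ℝ] E n :=
  mfderiv (𝓡 n) (𝓡 n) (extChartAt (𝓡 n) p).symm y

lemma contMDiffAt_chartSymm {p : M} {y : E n} (hy : y ∈ (extChartAt (𝓡 n) p).target) :
    ContMDiffAt (𝓡 n) (𝓡 n) ∞ (extChartAt (𝓡 n) p).symm y :=
  (contMDiffOn_extChartAt_symm p).contMDiffAt ((isOpen_extChartAt_target p).mem_nhds hy)

lemma frame_eq (p : M) (y : E n) :
    frame p y = mfderivWithin (𝓡 n) (𝓡 n) (extChartAt (𝓡 n) p).symm (range (𝓡 n)) y := by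
  rw [frame, ModelWithCorners.range_eq_univ, mfderivWithin_univ]

lemma mfderiv_chart_frame {p : M} {y : E n} (hy : y ∈ (extChartAt (𝓡 n) p).target) (v : E n) :
    mfderiv (𝓡 n) (𝓡 n) (extChartAt (𝓡 n) p) ((extChartAt (𝓡 n) p).symm y) (frame p y v) = v := by
  have : IsManifold (𝓡 n) 1 M := IsManifold.of_le (n := ∞) (by simp)
  rw [frame_eq]
  exact congrArg (fun L : E n →L[ℝ] E n => L v)
    (mfderiv_extChartAt_comp_mfderivWithin_extChartAt_symm (I := 𝓡 n) (x := p) hy)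

lemma frame_mfderiv_chart {p : M} {y : E n} (hy : y ∈ (extChartAt (𝓡 n) p).target) (v : E n) :
    frame p y (mfderiv (𝓡 n) (𝓡 n) (extChartAt (𝓡 n) p) ((extChartAt (𝓡 n) p).symm y) v) = v := by
  have : IsManifold (𝓡 n) 1 M := IsManifold.of_le (n := ∞) (by simp)
  rw [frame_eq]
  exact congrArg (fun L : E n →L[ℝ] E n => L v)
    (mfderivWithin_extChartAt_symm_comp_mfderiv_extChartAt (I := 𝓡 n) (x := p) hy)

lemma frame_isInvertible {p : M} {y : E n} (hy : y ∈ (extChartAt (𝓡 n) p).target) :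
    (frame p y).IsInvertible :=
  ContinuousLinearMap.IsInvertible.of_inverse
    (g := (mfderiv (𝓡 n) (𝓡 n) (extChartAt (𝓡 n) p) ((extChartAt (𝓡 n) p).symm y) :
      E n →L[ℝ] E n))
    (ContinuousLinearMap.ext (frame_mfderiv_chart hy))
    (ContinuousLinearMap.ext (mfderiv_chart_frame hy))

lemma frame_self (p : M) : frame p (extChartAt (𝓡 n) p p) = ContinuousLinearMap.id ℝ (E n) := by
  have : IsManifold (𝓡 n) 1 M := IsManifold.of_le (n := ∞) (by simp)
  rw [frame_eq]
  exact mfderivWithin_range_extChartAt_symm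

lemma trivialization_field {p q : M} (hq : q ∈ (extChartAt (𝓡 n) p).source)
    (v : TangentSpace (𝓡 n) q) :
    (trivializationAt (E n) (TangentSpace (𝓡 n)) p ⟨q, v⟩).2 =
      mfderiv (𝓡 n) (𝓡 n) (extChartAt (𝓡 n) p) q v := by
  have : IsManifold (𝓡 n) 1 M := IsManifold.of_le (n := ∞) (by simp)
  rw [extChartAt_source] at hq
  have h := congrArg (fun L : E n →L[ℝ] E n => L v)
    (TangentBundle.continuousLinearMapAt_trivializationAt (I := 𝓡 n) hq)
  refine Eq.trans ?_ h
  exact (congrFun (Bundle.Trivialization.coe_linearMapAt_of_mem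
    (trivializationAt (E n) (TangentSpace (𝓡 n) : M → Type _) p) (R := ℝ) (by simpa using hq)) v).symm

end Frames

variable {N : Type*} [TopologicalSpace N] [ChartedSpace (E 4) N] [IsManifold (𝓡 4) ∞ N]

/-- The change of coordinates from the preferred chart at `p` to the one at `q`. -/
def transition (p q : N) (y : E 4) : E 4 := extChartAt (𝓡 4) q ((extChartAt (𝓡 4) p).symm y)

lemma inChart_apply (g : Metric N) (p : N) (y v w : E 4) :
    g.inChart p y v w = g.val ((extChartAt (𝓡 4) p).symm y) (frame p y v) (frame p y w) := rfl

lemma inChart_self (g : Metric N) (p : N) (v w : E 4) :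
    g.inChart p (extChartAt (𝓡 4) p p) v w = g.val p v w := by
  rw [inChart_apply, frame_self]
  have : ∀ x : N, x = p → ∀ v w : E 4, g.val x v w = g.val p v w := by rintro x rfl v w; rfl
  exact this _ (extChartAt_to_inv p) v w

lemma contDiffOn_inChart (g : Metric N) (p : N) :
    ContDiffOn ℝ ∞ (g.inChart p) (extChartAt (𝓡 4) p).target := by
  have : IsManifold (𝓡 4) 1 N := IsManifold.of_le (n := ∞) (by simp)
  have h1 := (Bundle.Trivialization.contMDiffOn_section_baseSet_iff (IB := 𝓡 4)
    (trivializationAt (E 4 →L[ℝ] E 4 →L[ℝ] ℝ)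
      (fun p : N => TangentSpace (𝓡 4) p →L[ℝ] TangentSpace (𝓡 4) p →L[ℝ] ℝ) p)).1
      (g.smooth.contMDiffOn)
  have h2 := h1.comp (contMDiffOn_extChartAt_symm (I := 𝓡 4) (n := ∞) p) (fun y hy => by
    have := (extChartAt (𝓡 4) p).map_target hy
    rw [extChartAt_source] at this
    simpa [hom_trivializationAt_baseSet] using this)
  refine (contMDiffOn_iff_contDiffOn.1 h2).congr fun y hy => ?_
  have hs := (extChartAt (𝓡 4) p).map_target hy
  rw [extChartAt_source] at hs
  ext v w
  rw [inChart_apply, frame_eq]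
  simp only [Function.comp_apply]
  rw [hom_trivializationAt_apply]
  dsimp only
  rw [inCoordinates_apply_eq₂ (by simpa using hs) (by simpa using hs) (by simp)]
  have e : mfderivWithin (𝓡 4) (𝓡 4) (extChartAt (𝓡 4) p).symm (range (𝓡 4)) y =
      (trivializationAt (E 4) (TangentSpace (𝓡 4)) p).symmL ℝ ((extChartAt (𝓡 4) p).symm y) := by
    rw [TangentBundle.symmL_trivializationAt hs, (extChartAt (𝓡 4) p).right_inv hy]
  have e' : ∀ v : E 4, (trivializationAt (E 4) (TangentSpace (𝓡 4)) p).symmL ℝ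
      ((extChartAt (𝓡 4) p).symm y) v = (trivializationAt (E 4) (TangentSpace (𝓡 4)) p).symm
      ((extChartAt (𝓡 4) p).symm y) v := fun v => by
    rw [Bundle.Trivialization.symmL_apply]
    simpa using hs
  rw [e]
  refine (congrArg₂ (fun a b : E 4 => g.val ((extChartAt (𝓡 4) p).symm y) a b) (e' v) (e' w)).trans ?_
  simp

lemma finrank_bilin : Module.finrank ℝ (E 4) = Module.finrank ℝ (E 4 →L[ℝ] ℝ) := by
  rw [← (LinearMap.toContinuousLinearMap (𝕜 := ℝ) (E := E 4) (F' := ℝ)).finrank_eq,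
    Module.finrank_linearMap, Module.finrank_self, mul_one]

lemma inChart_injective (g : Metric N) {p : N} {y : E 4}
    (hy : y ∈ (extChartAt (𝓡 4) p).target) : Function.Injective (g.inChart p y) := by
  refine (injective_iff_map_eq_zero (g.inChart p y)).2 fun v hv => ?_
  have h1 : frame p y v = 0 := g.nondegenerate _ _ fun w => by
    obtain ⟨w, rfl⟩ := (frame_isInvertible hy).surjective w
    have h2 : g.inChart p y v w = 0 := by rw [hv, zero_apply]
    rw [inChart_apply] at h2
    exact h2
  exact (frame_isInvertible hy).injective (h1.trans (map_zero _).symm)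

lemma isMetricAt_inChart (g : Metric N) {p : N} {y : E 4} (hy : y ∈ (extChartAt (𝓡 4) p).target) :
    IsMetricAt (g.inChart p) y where
  contDiffAt := ((contDiffOn_inChart g p).contDiffAt
    ((isOpen_extChartAt_target p).mem_nhds hy)).of_le (WithTop.coe_le_coe.2 le_top)
  symm := Eventually.of_forall fun y' v w => by
    rw [inChart_apply, inChart_apply]
    exact g.symm _ _ _
  invertible := isInvertible_of_injective (inChart_injective g hy) finrank_bilin

lemma transition_eq_self {p q : N} {y : E 4}
    (hq : (extChartAt (𝓡 4) p).symm y = q) : transition p q y = extChartAt (𝓡 4) q q := by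
  rw [transition, hq]

section Transition

variable {p q : N} {y : E 4} (hy : y ∈ (extChartAt (𝓡 4) p).target)
  (hq : (extChartAt (𝓡 4) p).symm y ∈ (extChartAt (𝓡 4) q).source)

include hy hq

lemma contMDiffAt_transition : ContMDiffAt (𝓡 4) (𝓡 4) ∞ (transition p q) y :=
  ContMDiffAt.comp (g := extChartAt (𝓡 4) q) y
    (contMDiffAt_extChartAt' (by rwa [extChartAt_source] at hq)) (contMDiffAt_chartSymm hy)

lemma contDiffAt_transition : ContDiffAt ℝ ∞ (transition p q) y :=
  contMDiffAt_iff_contDiffAt.1 (contMDiffAt_transition hy hq)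

lemma eventually_transition : ∀ᶠ y' in 𝓝 y, y' ∈ (extChartAt (𝓡 4) p).target ∧
    (extChartAt (𝓡 4) p).symm y' ∈ (extChartAt (𝓡 4) q).source ∧
    transition p q y' ∈ (extChartAt (𝓡 4) q).target ∧
    (extChartAt (𝓡 4) q).symm (transition p q y') = (extChartAt (𝓡 4) p).symm y' := by
  filter_upwards [(isOpen_extChartAt_target p).mem_nhds hy,
    (contMDiffAt_chartSymm hy).continuousAt.preimage_mem_nhds
      ((isOpen_extChartAt_source q).mem_nhds hq)] with y' h1 h2
  exact ⟨h1, h2, (extChartAt (𝓡 4) q).map_source h2, (extChartAt (𝓡 4) q).left_inv h2⟩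

lemma frame_fderiv_transition (v : E 4) :
    frame q (transition p q y) (fderiv ℝ (transition p q) y v) = frame p y v := by
  have hev := eventually_transition hy hq
  have h1 : (extChartAt (𝓡 4) q).symm ∘ transition p q =ᶠ[𝓝 y] (extChartAt (𝓡 4) p).symm :=
    hev.mono fun y' h => h.2.2.2
  have h2 := mfderiv_comp (I := 𝓡 4) (I' := 𝓡 4) (I'' := 𝓡 4) y
    ((contMDiffAt_chartSymm (hev.self_of_nhds).2.2.1).mdifferentiableAt (by simp))
    ((contMDiffAt_transition hy hq).mdifferentiableAt (by simp))
  rw [h1.mfderiv_eq, mfderiv_eq_fderiv] at h2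
  exact (congrArg (fun L : E 4 →L[ℝ] E 4 => L v) h2).symm

lemma fderiv_transition (v : E 4) : fderiv ℝ (transition p q) y v =
    mfderiv (𝓡 4) (𝓡 4) (extChartAt (𝓡 4) q) ((extChartAt (𝓡 4) p).symm y) (frame p y v) := by
  have : IsManifold (𝓡 4) 1 N := IsManifold.of_le (n := ∞) (by simp)
  have h2 := mfderiv_comp (I := 𝓡 4) (I' := 𝓡 4) (I'' := 𝓡 4) y
    (mdifferentiableAt_extChartAt (x := q) (by rwa [extChartAt_source] at hq))
    ((contMDiffAt_chartSymm hy).mdifferentiableAt (by simp))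
  rw [← mfderiv_eq_fderiv]
  exact congrArg (fun L : E 4 →L[ℝ] E 4 => L v) h2

/-- The coordinate expressions of the metric in two charts are related by pull-back. Hence curvature
conditions, which are stated at `q` in the chart at `q`, can be checked in the chart at `p`. -/
lemma isPullbackAt_transition (g : Metric N) :
    IsPullbackAt (transition p q) (g.inChart p) (g.inChart q) y := by
  have hev := eventually_transition hy hq
  obtain ⟨-, -, ht, -⟩ := hev.self_of_nhds
  refine ⟨(contDiffAt_transition hy hq).of_le (WithTop.coe_le_coe.2 le_top), ?_,
    isMetricAt_inChart g ht, ?_⟩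
  · refine isInvertible_of_injective (fun v w h => ?_) rfl
    refine (frame_isInvertible hy).injective ?_
    rw [← frame_fderiv_transition hy hq v, h, frame_fderiv_transition hy hq w]
  · filter_upwards [hev.eventually_nhds] with y' h v w
    obtain ⟨h1, h2, h3, h4⟩ := h.self_of_nhds
    rw [inChart_apply, inChart_apply, frame_fderiv_transition h1 h2, frame_fderiv_transition h1 h2]
    have : ∀ x x' : N, x = x' → ∀ v w : E 4, g.val x v w = g.val x' v w := by
      rintro x _ rfl v w; rfl
    exact (this _ _ h4 _ _).symm

end Transition

/-! ### The null distribution in charts -/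

variable {N : Type*} [TopologicalSpace N] [ChartedSpace (E 4) N] [IsManifold (𝓡 4) ∞ N]

section Fields

/-- A vector field is smooth if and only if its coordinate expression is. -/
lemma smoothFieldOn_iff {p : N} {U : Set N} (hU : IsOpen U) (hUp : U ⊆ (extChartAt (𝓡 4) p).source)
    {Y : ∀ q : N, TangentSpace (𝓡 4) q} :
    SmoothFieldOn U Y ↔ ContMDiffOn (𝓡 4) 𝓘(ℝ, E 4) ∞
      (fun q => (mfderiv (𝓡 4) (𝓡 4) (extChartAt (𝓡 4) p) q (Y q) : E 4)) U := by
  have h := Bundle.Trivialization.contMDiffOn_section_iff (IB := 𝓡 4) (n := ∞) (s := Y)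
    (trivializationAt (E 4) (TangentSpace (𝓡 4) : N → Type _) p) hU
    (by rw [extChartAt_source] at hUp; simpa using hUp)
  refine h.trans (contMDiffOn_congr fun q hq => ?_)
  exact trivialization_field (hUp hq) (Y q)

end Fields

section Planes

variable {g : Metric N} (D : WalkerDistribution g)

/-- The plane of the distribution in the coordinates of the preferred chart at `p`. -/
def planeInChart (p : N) (y : E 4) : Submodule ℝ (E 4) :=
  (show Submodule ℝ (E 4) from D.plane ((extChartAt (𝓡 4) p).symm y)).comap
    (frame p y : E 4 →ₗ[ℝ] E 4)

lemma mem_planeInChart {p : N} {y v : E 4} :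
    v ∈ planeInChart D p y ↔ frame p y v ∈ D.plane ((extChartAt (𝓡 4) p).symm y) := Iff.rfl

lemma mem_plane_congr {x x' : N} (h : x = x') (v : E 4) :
    (v ∈ D.plane x) = (v ∈ D.plane x') := by subst h; rfl

lemma inChart_null {p : N} {y v w : E 4} (hv : v ∈ planeInChart D p y)
    (hw : w ∈ planeInChart D p y) : g.inChart p y v w = 0 :=
  D.null _ _ hv _ hw

lemma finrank_planeInChart {p : N} {y : E 4} (hy : y ∈ (extChartAt (𝓡 4) p).target) :
    Module.finrank ℝ (planeInChart D p y) = 2 := by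
  obtain ⟨L, hL⟩ := frame_isInvertible hy
  rw [← D.rank_two ((extChartAt (𝓡 4) p).symm y)]
  rw [planeInChart, ← hL]
  exact (L.toLinearEquiv.ofSubmodule'
    (show Submodule ℝ (E 4) from D.plane ((extChartAt (𝓡 4) p).symm y))).finrank_eq

lemma exists_frame_planeInChart {p : N} {y₀ : E 4} (hy : y₀ ∈ (extChartAt (𝓡 4) p).target) :
    ∃ (U : Set (E 4)) (Z₁ Z₂ : E 4 → E 4), IsOpen U ∧ y₀ ∈ U ∧ U ⊆ (extChartAt (𝓡 4) p).target ∧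
      ContDiffOn ℝ ∞ Z₁ U ∧ ContDiffOn ℝ ∞ Z₂ U ∧
      ∀ y ∈ U, planeInChart D p y = Submodule.span ℝ {Z₁ y, Z₂ y} := by
  obtain ⟨V, hV, hpV, Y₁, Y₂, h1, h2, hs⟩ := D.smooth ((extChartAt (𝓡 4) p).symm y₀)
  set V' := V ∩ (extChartAt (𝓡 4) p).source with hV'
  have hV'o : IsOpen V' := hV.inter (isOpen_extChartAt_source p)
  have hsub : V' ⊆ (extChartAt (𝓡 4) p).source := inter_subset_right
  set U := (extChartAt (𝓡 4) p).target ∩ (extChartAt (𝓡 4) p).symm ⁻¹' V' with hU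
  have hUo : IsOpen U :=
    (contMDiffOn_extChartAt_symm (I := 𝓡 4) (n := ∞) p).continuousOn.isOpen_inter_preimage
      (isOpen_extChartAt_target p) hV'o
  have hsm := (contMDiffOn_extChartAt_symm (I := 𝓡 4) (n := ∞) p).mono
    (inter_subset_left : U ⊆ _)
  have key : ∀ Y, SmoothFieldOn V Y → ContDiffOn ℝ ∞ (fieldInChart p Y) U := fun Y hY =>
    contMDiffOn_iff_contDiffOn.1 (((smoothFieldOn_iff hV'o hsub).1 (hY.mono inter_subset_left)).comp
      hsm inter_subset_right)
  refine ⟨U, _, _, hUo, ⟨hy, hpV, (extChartAt (𝓡 4) p).map_target hy⟩, inter_subset_left,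
    key Y₁ h1, key Y₂ h2, fun y hy => ?_⟩
  ext v
  rw [mem_planeInChart, hs _ hy.2.1]
  have e1 : frame p y (fieldInChart p Y₁ y) = Y₁ ((extChartAt (𝓡 4) p).symm y) :=
    frame_mfderiv_chart hy.1 _
  have e2 : frame p y (fieldInChart p Y₂ y) = Y₂ ((extChartAt (𝓡 4) p).symm y) :=
    frame_mfderiv_chart hy.1 _
  constructor
  · intro h
    obtain ⟨a, b, hab⟩ := (Submodule.mem_span_pair (M := TangentSpace (𝓡 4) ((extChartAt (𝓡 4) p).symm y))).1 h
    refine Submodule.mem_span_pair.2 ⟨a, b, (frame_isInvertible hy.1).injective ?_⟩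
    rw [map_add, map_smul, map_smul, e1, e2]
    exact hab
  · intro h
    obtain ⟨a, b, rfl⟩ := Submodule.mem_span_pair.1 h
    refine (Submodule.mem_span_pair (M := TangentSpace (𝓡 4) ((extChartAt (𝓡 4) p).symm y))).2
      ⟨a, b, ?_⟩
    rw [map_add, map_smul, map_smul, e1, e2]
    rfl

lemma fieldInChart_transition {p q : N} {y : E 4} (hy : y ∈ (extChartAt (𝓡 4) p).target)
    (hq : (extChartAt (𝓡 4) p).symm y ∈ (extChartAt (𝓡 4) q).source) {Z : E 4 → E 4}
    {Y : ∀ q : N, TangentSpace (𝓡 4) q}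
    (hY : Y ((extChartAt (𝓡 4) p).symm y) = frame p y (Z y)) :
    fieldInChart q Y (transition p q y) = fderiv ℝ (transition p q) y (Z y) := by
  obtain ⟨-, -, -, h4⟩ := (eventually_transition hy hq).self_of_nhds
  rw [fderiv_transition hy hq, ← hY, fieldInChart]
  have : ∀ x x' : N, x = x' → (mfderiv (𝓡 4) (𝓡 4) (extChartAt (𝓡 4) q) x (Y x) : E 4) =
      mfderiv (𝓡 4) (𝓡 4) (extChartAt (𝓡 4) q) x' (Y x') := by rintro x _ rfl; rfl
  exact this _ _ h4

/-- In coordinates, a covariant derivative of a field in a parallel distribution is in the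
distribution. -/
lemma planeInChart_parallel {p : N} {U : Set (E 4)} (hU : IsOpen U)
    (hUt : U ⊆ (extChartAt (𝓡 4) p).target) {Z : E 4 → E 4} (hZ : ContDiffOn ℝ ∞ Z U)
    (hZD : ∀ y ∈ U, Z y ∈ planeInChart D p y) {y : E 4} (hy : y ∈ U) (v : E 4) :
    fderiv ℝ Z y v + chr (g.inChart p) y v (Z y) ∈ planeInChart D p y := by
  have : IsManifold (𝓡 4) 1 N := IsManifold.of_le (n := ∞) (by simp)
  set ψ := extChartAt (𝓡 4) p with hψ
  set V : Set N := ψ.source ∩ ψ ⁻¹' U with hV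
  have hVo : IsOpen V := (contMDiffOn_extChartAt (I := 𝓡 4) (n := ∞) (x := p)).continuousOn
    |>.isOpen_inter_preimage (by rw [← extChartAt_source (𝓡 4)]; exact isOpen_extChartAt_source p) hU
    |> fun h => by rw [← extChartAt_source (𝓡 4)] at h; exact h
  let Y : ∀ q : N, TangentSpace (𝓡 4) q := fun q => frame p (ψ q) (Z (ψ q))
  have hYc : ∀ y' ∈ U, Y (ψ.symm y') = frame p y' (Z y') := fun y' hy' => by
    change frame p (ψ (ψ.symm y')) (Z (ψ (ψ.symm y'))) = _
    rw [ψ.right_inv (hUt hy')]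
  have hYsm : SmoothFieldOn V Y := by
    refine (smoothFieldOn_iff hVo inter_subset_left).2 ?_
    refine ContMDiffOn.congr (f := fun q => Z (ψ q)) ?_ fun q hq => ?_
    · exact (contMDiffOn_iff_contDiffOn.2 hZ).comp
        ((contMDiffOn_extChartAt (I := 𝓡 4) (n := ∞) (x := p)).mono fun q hq => by
          rw [← extChartAt_source (𝓡 4)]; exact hq.1) fun q hq => hq.2
    · have h := mfderiv_chart_frame (ψ.map_source hq.1) (Z (ψ q))
      rw [ψ.left_inv hq.1] at h
      exact h
  have hYD : ∀ q ∈ V, Y q ∈ D.plane q := fun q hq => by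
    have h := hZD _ hq.2
    rw [mem_planeInChart] at h
    exact (mem_plane_congr D (ψ.left_inv hq.1) _).mp h
  have hyt := hUt hy
  have hqV : ψ.symm y ∈ V := ⟨ψ.map_target hyt, by
    change ψ (ψ.symm y) ∈ U
    rwa [ψ.right_inv hyt]⟩
  set q := ψ.symm y with hq
  have hqs : ψ.symm y ∈ (extChartAt (𝓡 4) q).source := mem_extChartAt_source q
  set φ := transition p q with hφ
  have hφy : φ y = extChartAt (𝓡 4) q q := transition_eq_self rfl
  have hpar := D.parallel V hVo Y hYsm hYD q hqV (frame p y v)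
  have hfr : ∀ w, fderiv ℝ φ y w = frame p y w := fun w => by
    rw [hφ, fderiv_transition hyt hqs]
    exact congrArg (fun L : E 4 →L[ℝ] E 4 => L (frame p y w)) (mfderiv_extChartAt_self (I := 𝓡 4) (x := q))
  have hev := eventually_transition hyt hqs
  have hfield : ∀ᶠ y' in 𝓝 y, fieldInChart q Y (φ y') = fderiv ℝ φ y' (Z y') := by
    filter_upwards [hU.mem_nhds hy, hev] with y' h1 h2
    exact fieldInChart_transition h2.1 h2.2.1 (hYc y' h1)
  have hZy : DifferentiableAt ℝ Z y :=
    (hZ.contDiffAt (hU.mem_nhds hy)).differentiableAt (by simp)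
  have hpb := isPullbackAt_transition hyt hqs g
  have hdiff : DifferentiableAt ℝ (fieldInChart q Y) (φ y) := by
    have hqt : φ y ∈ (extChartAt (𝓡 4) q).target := hev.self_of_nhds.2.2.1
    have hqp : (extChartAt (𝓡 4) q).symm (φ y) ∈ ψ.source := by
      rw [hev.self_of_nhds.2.2.2]; exact ψ.map_target hyt
    set ρ := transition q p with hρ
    have hρφ : ρ (φ y) = y := by
      rw [hρ, transition, hev.self_of_nhds.2.2.2]; exact ψ.right_inv hyt
    have hρd : DifferentiableAt ℝ ρ (φ y) :=
      (contDiffAt_transition hqt hqp).differentiableAt (by simp)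
    have hinv := eventually_transition hqt hqp
    have h1 : fieldInChart q Y =ᶠ[𝓝 (φ y)] (fun y' => fderiv ℝ φ y' (Z y')) ∘ ρ := by
      have hρc : Tendsto ρ (𝓝 (φ y)) (𝓝 y) := by
        have := hρd.continuousAt.tendsto
        rwa [hρφ] at this
      filter_upwards [hρc.eventually hfield, hinv] with x h1 h2
      rw [Function.comp_apply, ← h1]
      congr 1
      rw [hφ, transition, h2.2.2.2]
      exact ((extChartAt (𝓡 4) q).right_inv h2.1).symm
    refine DifferentiableAt.congr_of_eventuallyEq ?_ h1
    refine DifferentiableAt.comp _ ?_ hρd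
    rw [hρφ]
    exact hpb.differentiableAt_fderiv.clm_apply hZy
  have hcov := hpb.map_covariant hZy hdiff hfield v
  have hYq : frame p y (Z y) = Y q := (hYc y hy).symm
  have h5 : frame p y (fderiv ℝ Z y v + chr (g.inChart p) y v (Z y)) =
      fderiv ℝ (fieldInChart q Y) (extChartAt (𝓡 4) q q) (frame p y v) +
        christoffel (g.inChart q) (extChartAt (𝓡 4) q q) (frame p y v) (frame p y (Z y)) := by
    rw [← hfr, hcov, ← IsMetricAt.christoffel_eq hpb.metric, ← hφ, hfield.self_of_nhds, hfr, hfr,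
      hφy]
  rw [mem_planeInChart, h5, hYq]
  exact hpar

end Planes

/-! ### The anti-self-dual Weyl tensor in Walker coordinates -/

section Pullback

variable {F₁ F₂ F₃ : Type*} [NormedAddCommGroup F₁] [NormedSpace ℝ F₁] [CompleteSpace F₁]
  [NormedAddCommGroup F₂] [NormedSpace ℝ F₂] [CompleteSpace F₂]
  [NormedAddCommGroup F₃] [NormedSpace ℝ F₃] [CompleteSpace F₃]

lemma IsPullbackAt.comp {φ : F₁ → F₂} {χ : F₂ → F₃} {g₁ : F₁ → F₁ →L[ℝ] F₁ →L[ℝ] ℝ}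
    {g₂ : F₂ → F₂ →L[ℝ] F₂ →L[ℝ] ℝ} {g₃ : F₃ → F₃ →L[ℝ] F₃ →L[ℝ] ℝ} {y : F₁}
    (H' : IsPullbackAt χ g₂ g₃ (φ y)) (H : IsPullbackAt φ g₁ g₂ y) :
    IsPullbackAt (χ ∘ φ) g₁ g₃ y := by
  have hd : ∀ᶠ y' in 𝓝 y, fderiv ℝ (χ ∘ φ) y' = (fderiv ℝ χ (φ y')).comp (fderiv ℝ φ y') := by
    filter_upwards [H.eventually, H.contDiffAt.continuousAt.eventually H'.eventually] with y' a b
    exact fderiv_comp y' b.differentiableAt a.differentiableAt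
  refine ⟨H'.contDiffAt.comp y H.contDiffAt, ?_, H'.metric, ?_⟩
  · rw [hd.self_of_nhds]
    exact H'.invertible.comp H.invertible
  · filter_upwards [hd, H.eq, H.contDiffAt.continuousAt.eventually H'.eq] with y' a b c v w
    rw [b, c, a]
    rfl

end Pullback

/-- The standard coordinate covectors on `ℝ²`. -/
abbrev cov (i : Fin 2) : E 2 →L[ℝ] ℝ := EuclideanSpace.proj i

/-- The standard basis vectors of `ℝ²`. -/
abbrev vec (i : Fin 2) : E 2 := EuclideanSpace.single i 1

/-- The cotangent space `ℝ² × (ℝ²)*`, the model of the cotangent bundle of a surface. -/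
abbrev Cot : Type := E 2 × (E 2 →L[ℝ] ℝ)

/-- The field of bilinear forms on the base `ℝ²`, still depending on all four coordinates, to which a
metric on `ℝ² × (ℝ²)*` restricts on horizontal vectors. -/
def horizontal (h : Cot → Cot →L[ℝ] Cot →L[ℝ] ℝ) (c : Cot) : E 2 →L[ℝ] E 2 →L[ℝ] ℝ :=
  (h c).bilinearComp (ContinuousLinearMap.inl ℝ (E 2) (E 2 →L[ℝ] ℝ))
    (ContinuousLinearMap.inl ℝ (E 2) (E 2 →L[ℝ] ℝ))

lemma horizontal_apply (h : Cot → Cot →L[ℝ] Cot →L[ℝ] ℝ) (c : Cot) (u v : E 2) :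
    horizontal h c u v = h c (u, 0) (v, 0) := rfl

/-- A frame of `ℝ² × (ℝ²)*` that is normalized for the metric `2 dxⁱ ∘ dx^{i'} + q`. -/
def walkerFrame (q : E 2 →L[ℝ] E 2 →L[ℝ] ℝ) : Fin 4 → Cot :=
  ![(vec 0, -(1 / 2 : ℝ) • q (vec 0)), (vec 1, -(1 / 2 : ℝ) • q (vec 1)), (0, cov 0), (0, cov 1)]

lemma exists_normalized_basis {V : Type*} [AddCommGroup V] [Module ℝ V]
    (hV : Module.finrank ℝ V = 4) (B : V →ₗ[ℝ] V →ₗ[ℝ] ℝ) (v : Fin 4 → V)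
    (h : ∀ i j, B (v i) (v j) = if j = i + 2 then 1 else 0) :
    ∃ b : Module.Basis (Fin 4) ℝ V, (∀ i, b i = v i) ∧ IsNormalized B b := by
  have hli : LinearIndependent ℝ v := by
    rw [Fintype.linearIndependent_iff]
    intro c hc i
    have := congrArg (fun x => B x (v (i + 2))) hc
    simpa [h] using this
  have : Nonempty (Fin 4) := ⟨0⟩
  have hc : Fintype.card (Fin 4) = Module.finrank ℝ V := by rw [hV]; rfl
  refine ⟨basisOfLinearIndependentOfCardEqFinrank hli hc, fun i => ?_, fun i j => ?_⟩
  · simp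
  · simpa using h i j

lemma IsWalkerFormAt.symm {h : Cot → Cot →L[ℝ] Cot →L[ℝ] ℝ} {q : Cot → E 2 →L[ℝ] E 2 →L[ℝ] ℝ}
    {a : Cot} (H : IsWalkerFormAt h q a) (v w : E 2) : q a v w = q a w v := by
  have h1 := H.eq.self_of_nhds (v, 0) (w, 0)
  have h2 := H.eq.self_of_nhds (w, 0) (v, 0)
  rw [H.metric.symm.self_of_nhds, h2] at h1
  simpa using h1.symm

lemma IsWalkerFormAt.walkerFrame_inner {h : Cot → Cot →L[ℝ] Cot →L[ℝ] ℝ}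
    {q : Cot → E 2 →L[ℝ] E 2 →L[ℝ] ℝ} {a : Cot} (H : IsWalkerFormAt h q a) (i j : Fin 4) :
    h a (walkerFrame (q a) i) (walkerFrame (q a) j) = if j = i + 2 then 1 else 0 := by
  have hs := H.symm (vec 0) (vec 1)
  rw [H.eq.self_of_nhds]
  fin_cases i <;> fin_cases j <;>
    simp [walkerFrame] <;> linarith

section Manifold

variable {N : Type*} [TopologicalSpace N] [ChartedSpace (E 4) N] [IsManifold (𝓡 4) ∞ N]

/-- `W_-` in the preferred chart at the point. -/
lemma weylMinus_eq (g : Metric N) (q : N) (b : Module.Basis (Fin 4) ℝ (E 4)) (u v w z : E 4) :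
    g.weylMinus q b u v w z = (1 / 2) * (weyl (g.inChart q) (extChartAt (𝓡 4) q q) u v w z -
      hodgeStar (fun x x' => g.inChart q (extChartAt (𝓡 4) q q) x x') b
        (fun x x' => weyl (g.inChart q) (extChartAt (𝓡 4) q q) x x' w z) u v) := by
  have h1 : (fun x y : E 4 => g.val q x y) = fun x y => g.inChart q (extChartAt (𝓡 4) q q) x y :=
    funext fun x => funext fun y => (inChart_self g q x y).symm
  rw [← h1]
  rfl

lemma weyl_hodgeStar_congr {g : E 4 → E 4 →L[ℝ] E 4 →L[ℝ] ℝ} {y : E 4} (hg : IsMetricAt g y)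
    (b b' : Module.Basis (Fin 4) ℝ (E 4)) (hb : 0 < b.det b') (u v w z : E 4) :
    hodgeStar (fun x x' => g y x x') b (fun x x' => weyl g y x x' w z) u v =
      hodgeStar (fun x x' => g y x x') b' (fun x x' => weyl g y x x' w z) u v := by
  obtain ⟨W, hW⟩ := exists_weyl_quadrilinear hg
  have key := hodgeStar_eq_of_det_pos (metricForm g y) b b' hb
    (LinearMap.mk₂ ℝ (fun x x' => W x x' w z) (by simp) (by simp) (by simp) (by simp)) u v
  simp only [hW]
  exact key

/-- `W_-` depends on the frame only through its orientation. -/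
lemma weylMinus_congr (g : Metric N) (q : N) (b b' : Module.Basis (Fin 4) ℝ (TangentSpace (𝓡 4) q))
    (hb : 0 < b.det b') (u v w z : TangentSpace (𝓡 4) q) :
    g.weylMinus q b u v w z = g.weylMinus q b' u v w z :=
  (weylMinus_eq g q b u v w z).trans ((congrArg (fun c => (1 / 2) * (_ - c))
    (weyl_hodgeStar_congr (isMetricAt_inChart g (mem_extChartAt_target (I := 𝓡 4) q)) b b' hb
      u v w z)).trans (weylMinus_eq g q b' u v w z).symm)

/-- If `φ` is a coordinate system in which the metric is `2 dxⁱ ∘ dx^{i'} + Q`, then `W_-`, for the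
orientation of the frame `b` obtained from the coordinates, vanishes at `q` if and only if `Q(v, v)`
has vanishing second derivative along the fibre in the direction `β` with `β(v) = 0`, for all `v`. -/
theorem weylMinus_iff_of_walkerForm {g : Metric N} {q : N} {φ : Cot → E 4}
    {h : Cot → Cot →L[ℝ] Cot →L[ℝ] ℝ} {Q : Cot → E 2 →L[ℝ] E 2 →L[ℝ] ℝ} {a : Cot}
    (H : IsPullbackAt φ h (g.inChart q) a) (hφ : φ a = extChartAt (𝓡 4) q q)
    (hW : IsWalkerFormAt h Q a) :
    ∃ b : Module.Basis (Fin 4) ℝ (TangentSpace (𝓡 4) q),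
      (∀ i j, g.val q (b i) (b j) = if j = i + 2 then 1 else 0) ∧
      (∀ i, b i = fderiv ℝ φ a (walkerFrame (Q a) i)) ∧
      ((∀ u v w z, g.weylMinus q b u v w z = 0) ↔ ∀ s t : ℝ,
        fderiv ℝ (fun y => fderiv ℝ (fun y' => Q y' (s • vec 0 + t • vec 1) (s • vec 0 + t • vec 1))
          y (0, t • cov 0 - s • cov 1)) a (0, t • cov 0 - s • cov 1) = 0) := by
  have hg := isMetricAt_inChart g (mem_extChartAt_target (I := 𝓡 4) q)
  obtain ⟨b, hb, hn⟩ := exists_normalized_basis (by simp)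
    (metricForm (g.inChart q) (extChartAt (𝓡 4) q q))
    (fun i => fderiv ℝ φ a (walkerFrame (Q a) i)) (fun i j => by
      rw [metricForm_apply, ← hφ, ← H.eq.self_of_nhds, hW.walkerFrame_inner])
  have h1 : ∀ x y : E 4, g.val q x y = g.inChart q (extChartAt (𝓡 4) q q) x y :=
    fun x y => (inChart_self g q x y).symm
  refine ⟨b, fun i j => ?_, hb, ?_⟩
  · exact (h1 _ _).trans (hn i j)
  · have e : ∀ u v w z : E 4, g.weylMinus q b u v w z = 0 ↔
        weyl (g.inChart q) (extChartAt (𝓡 4) q q) u v w z =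
        hodgeStar (fun x x' => g.inChart q (extChartAt (𝓡 4) q q) x x') b
          (fun x x' => weyl (g.inChart q) (extChartAt (𝓡 4) q q) x x' w z) u v := by
      intro u v w z
      rw [weylMinus_eq g q b u v w z, mul_eq_zero, sub_eq_zero]
      norm_num
    refine (forall_congr' fun u => forall_congr' fun v => forall_congr' fun w =>
      forall_congr' fun z => e u v w z).trans ((weyl_eq_hodgeStar_iff hg hn).trans ?_)
    refine forall_congr' fun s => forall_congr' fun t => ?_
    have e1 : s • b 0 + t • b 1 = fderiv ℝ φ a (s • walkerFrame (Q a) 0 + t • walkerFrame (Q a) 1) := by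
      simp only [hb, map_add, map_smul]
    have e2 : t • b 2 - s • b 3 = fderiv ℝ φ a (0, t • cov 0 - s • cov 1) := by
      simp only [hb, ← map_smul, ← map_sub]
      simp [walkerFrame]
    rw [e1, e2, ← hφ, ← H.map_riem, ← H.eq.self_of_nhds, hW.inner_riem]
    have e3 : (s • walkerFrame (Q a) 0 + t • walkerFrame (Q a) 1).1 = s • vec 0 + t • vec 1 := by
      simp [walkerFrame]
    rw [e3]
    simp

end Manifold

/-! ### Adapted bases -/

section Adapted

variable {V : Type*} [AddCommGroup V] [Module ℝ V]

lemma det_of_upper_right_zero (M : Matrix (Fin 4) (Fin 4) ℝ) (h02 : M 0 2 = 0) (h03 : M 0 3 = 0)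
    (h12 : M 1 2 = 0) (h13 : M 1 3 = 0) :
    M.det = (M 0 0 * M 1 1 - M 0 1 * M 1 0) * (M 2 2 * M 3 3 - M 2 3 * M 3 2) := by
  have s1 : (1 : Fin 4).succAbove = ![0, 2, 3] := by decide
  have s2 : (2 : Fin 4).succAbove = ![0, 1, 3] := by decide
  have s3 : (3 : Fin 4).succAbove = ![0, 1, 2] := by decide
  rw [Matrix.det_succ_row_zero]
  simp [Fin.sum_univ_four, Matrix.det_fin_three, h02, h03, h12, h13, s1]
  ring

/-- Two bases adapted to a null plane `D` differ by a matrix of determinant one: it is block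
triangular, and the diagonal blocks are contragredient. -/
lemma IsAdapted.det_eq_one {B : V →ₗ[ℝ] V →ₗ[ℝ] ℝ} {D : Submodule ℝ V}
    (hD : ∀ v ∈ D, ∀ w ∈ D, B v w = 0) {b b' : Module.Basis (Fin 4) ℝ V}
    (hb : IsAdapted (fun x y => B x y) D b) (hb' : IsAdapted (fun x y => B x y) D b') :
    b.det b' = 1 := by
  obtain ⟨m2, m3, h02, h03, h12, h13⟩ := hb
  obtain ⟨m2', m3', h02', h03', h12', h13'⟩ := hb'
  have hx : ∀ x, x = b.repr x 0 • b 0 + b.repr x 1 • b 1 + b.repr x 2 • b 2 + b.repr x 3 • b 3 :=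
    fun x => by
      conv_lhs => rw [← b.sum_repr x]
      rw [Fin.sum_univ_four]
  have e2 : ∀ x, B x (b 2) = b.repr x 0 := fun x => by
    conv_lhs => rw [hx x]
    simp [h02, h12, hD _ m2 _ m2, hD _ m3 _ m2]
  have e3 : ∀ x, B x (b 3) = b.repr x 1 := fun x => by
    conv_lhs => rw [hx x]
    simp [h03, h13, hD _ m2 _ m3, hD _ m3 _ m3]
  have ey : ∀ y ∈ D, ∀ x, B x y = b.repr x 0 * b.repr y 2 + b.repr x 1 * b.repr y 3 :=
    fun y hy x => by
      conv_lhs => rw [hx y]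
      rw [← e2 y, ← e3 y, hD _ hy _ m2, hD _ hy _ m3, ← e2 x, ← e3 x]
      simp
      ring
  rw [b.det_apply, det_of_upper_right_zero]
  · simp only [Module.Basis.toMatrix_apply]
    simp only [ey _ m2', ey _ m3'] at h02' h03' h12' h13'
    linear_combination (b.repr (b' 1) 0 * b.repr (b' 3) 2 + b.repr (b' 1) 1 * b.repr (b' 3) 3) * h02' -
      (b.repr (b' 1) 0 * b.repr (b' 2) 2 + b.repr (b' 1) 1 * b.repr (b' 2) 3) * h03' + h13'
  all_goals
    simp only [Module.Basis.toMatrix_apply]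
    simp only [← e2, ← e3, hD _ m2' _ m2, hD _ m2' _ m3, hD _ m3' _ m2, hD _ m3' _ m3]

end Adapted

/-! ### Cut-off of smooth maps -/

section Cutoff

variable {A B : Type*} [NormedAddCommGroup A] [NormedSpace ℝ A] [FiniteDimensional ℝ A]
  [NormedAddCommGroup B] [NormedSpace ℝ B]

/-- A map that is smooth near a point agrees near this point with a globally smooth map. -/
lemma exists_contDiff_eventuallyEq {f : A → B} {U : Set A} (hU : IsOpen U) (hf : ContDiffOn ℝ ∞ f U)
    {a : A} (ha : a ∈ U) : ∃ F : A → B, ContDiff ℝ ∞ F ∧ F =ᶠ[𝓝 a] f := by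
  have : HasContDiffBump A := inferInstance
  obtain ⟨r, hr, hrU⟩ := Metric.isOpen_iff.1 hU a ha
  let χ : ContDiffBump a := ⟨r / 4, r / 2, by positivity, by linarith⟩
  refine ⟨fun x => χ x • f x, contDiff_iff_contDiffAt.2 fun x => ?_, ?_⟩
  · by_cases hx : x ∈ U
    · exact χ.contDiff.contDiffAt.smul (hf.contDiffAt (hU.mem_nhds hx))
    · refine (contDiffAt_const (c := (0 : B))).congr_of_eventuallyEq ?_
      have hx' : x ∈ (Metric.closedBall a (r / 2))ᶜ := fun h =>
        hx (hrU (Metric.closedBall_subset_ball (by linarith) h))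
      filter_upwards [Metric.isClosed_closedBall.isOpen_compl.mem_nhds hx'] with y hy
      have : χ y = 0 := χ.zero_of_le_dist (by
        rw [mem_compl_iff, Metric.mem_closedBall, not_le] at hy; exact hy.le)
      simp [this]
  · filter_upwards [χ.eventuallyEq_one] with x hx
    simp [hx]

end Cutoff

/-! ### Walker coordinates -/

section Diffeo

variable {A B C : Type*} [NormedAddCommGroup A] [NormedSpace ℝ A] [NormedAddCommGroup B]
  [NormedSpace ℝ B] [NormedAddCommGroup C] [NormedSpace ℝ C]

/-- A homeomorphism between open subsets of normed spaces is a diffeomorphism. -/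
structure IsDiffeo (Θ : OpenPartialHomeomorph A B) : Prop where
  contDiffOn : ContDiffOn ℝ ∞ Θ Θ.source
  contDiffOn_symm : ContDiffOn ℝ ∞ Θ.symm Θ.target

namespace IsDiffeo

variable {Θ : OpenPartialHomeomorph A B} {Ξ : OpenPartialHomeomorph B C}

lemma symm (hΘ : IsDiffeo Θ) : IsDiffeo Θ.symm := ⟨hΘ.contDiffOn_symm, hΘ.contDiffOn⟩

lemma trans (hΘ : IsDiffeo Θ) (hΞ : IsDiffeo Ξ) : IsDiffeo (Θ.trans Ξ) := by
  refine ⟨?_, ?_⟩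
  · refine hΞ.contDiffOn.comp (hΘ.contDiffOn.mono ?_) ?_ <;> intro x hx <;>
      rw [OpenPartialHomeomorph.trans_source] at hx
    exacts [hx.1, hx.2]
  · refine hΘ.contDiffOn_symm.comp (hΞ.contDiffOn_symm.mono ?_) ?_ <;> intro x hx <;>
      rw [OpenPartialHomeomorph.trans_target] at hx
    exacts [hx.1, hx.2]

lemma contDiffAt (hΘ : IsDiffeo Θ) {a : A} (ha : a ∈ Θ.source) : ContDiffAt ℝ ∞ Θ a :=
  hΘ.contDiffOn.contDiffAt (Θ.open_source.mem_nhds ha)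

lemma differentiableAt (hΘ : IsDiffeo Θ) {a : A} (ha : a ∈ Θ.source) : DifferentiableAt ℝ Θ a :=
  (hΘ.contDiffAt ha).differentiableAt (by simp)

lemma fderiv_symm_fderiv (hΘ : IsDiffeo Θ) {a : A} (ha : a ∈ Θ.source) (v : A) :
    fderiv ℝ Θ.symm (Θ a) (fderiv ℝ Θ a v) = v := by
  have h1 : Θ.symm ∘ Θ =ᶠ[𝓝 a] id := by
    filter_upwards [Θ.open_source.mem_nhds ha] with x hx using Θ.left_inv hx
  have h2 := fderiv_comp a (hΘ.symm.differentiableAt (Θ.map_source ha)) (hΘ.differentiableAt ha)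
  rw [h1.fderiv_eq, fderiv_id] at h2
  exact (congrArg (fun L : A →L[ℝ] A => L v) h2).symm

lemma fderiv_fderiv_symm (hΘ : IsDiffeo Θ) {b : B} (hb : b ∈ Θ.target) (v : B) :
    fderiv ℝ Θ (Θ.symm b) (fderiv ℝ Θ.symm b v) = v := by
  have h1 : Θ ∘ Θ.symm =ᶠ[𝓝 b] id := by
    filter_upwards [Θ.open_target.mem_nhds hb] with x hx using Θ.right_inv hx
  have h2 := fderiv_comp b (hΘ.differentiableAt (Θ.map_target hb)) (hΘ.symm.differentiableAt hb)
  rw [h1.fderiv_eq, fderiv_id] at h2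
  exact (congrArg (fun L : B →L[ℝ] B => L v) h2).symm

lemma isInvertible (hΘ : IsDiffeo Θ) {a : A} (ha : a ∈ Θ.source) : (fderiv ℝ Θ a).IsInvertible := by
  refine ContinuousLinearMap.IsInvertible.of_inverse (g := fderiv ℝ Θ.symm (Θ a))
    (ContinuousLinearMap.ext fun v => ?_) (ContinuousLinearMap.ext (hΘ.fderiv_symm_fderiv ha))
  have := hΘ.fderiv_fderiv_symm (Θ.map_source ha) v
  rwa [Θ.left_inv ha] at this

end IsDiffeo

/-- The pull-back of a field of bilinear forms. -/
def pull (φ : A → B) (G : B → B →L[ℝ] B →L[ℝ] ℝ) (a : A) : A →L[ℝ] A →L[ℝ] ℝ :=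
  (G (φ a)).bilinearComp (fderiv ℝ φ a) (fderiv ℝ φ a)

lemma pull_apply (φ : A → B) (G : B → B →L[ℝ] B →L[ℝ] ℝ) (a v w : A) :
    pull φ G a v w = G (φ a) (fderiv ℝ φ a v) (fderiv ℝ φ a w) := rfl

lemma contDiffOn_bilin_iff [FiniteDimensional ℝ A] {G : B → A →L[ℝ] A →L[ℝ] ℝ} {s : Set B} :
    ContDiffOn ℝ ∞ G s ↔ ∀ v w, ContDiffOn ℝ ∞ (fun b => G b v w) s := by
  rw [contDiffOn_clm_apply]
  exact forall_congr' fun v => contDiffOn_clm_apply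

lemma IsDiffeo.contDiffOn_pull [FiniteDimensional ℝ A] {Θ : OpenPartialHomeomorph A B}
    (hΘ : IsDiffeo Θ) {G : B → B →L[ℝ] B →L[ℝ] ℝ} {V : Set B} (hG : ContDiffOn ℝ ∞ G V) :
    ContDiffOn ℝ ∞ (pull Θ G) (Θ.source ∩ Θ ⁻¹' V) := by
  rw [contDiffOn_bilin_iff]
  intro v w
  have h1 : ContDiffOn ℝ ∞ (fderiv ℝ Θ) (Θ.source ∩ Θ ⁻¹' V) :=
    (hΘ.contDiffOn.fderiv_of_isOpen Θ.open_source (by simp)).mono inter_subset_left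
  have h2 : ContDiffOn ℝ ∞ (fun a => G (Θ a)) (Θ.source ∩ Θ ⁻¹' V) :=
    hG.comp (hΘ.contDiffOn.mono inter_subset_left) inter_subset_right
  exact (h2.clm_apply (h1.clm_apply contDiffOn_const)).clm_apply (h1.clm_apply contDiffOn_const)

lemma IsDiffeo.isPullbackAt_pull {Θ : OpenPartialHomeomorph A B}
    (hΘ : IsDiffeo Θ) {G : B → B →L[ℝ] B →L[ℝ] ℝ} {a : A} (ha : a ∈ Θ.source)
    (hG : IsMetricAt G (Θ a)) : IsPullbackAt Θ (pull Θ G) G a where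
  contDiffAt := (hΘ.contDiffAt ha).of_le (WithTop.coe_le_coe.2 le_top)
  invertible := hΘ.isInvertible ha
  metric := hG
  eq := Eventually.of_forall fun _ _ _ => rfl

end Diffeo

section GraphDistribution

variable {X Y : Type} [NormedAddCommGroup X] [NormedSpace ℝ X] [FiniteDimensional ℝ X]
  [NormedAddCommGroup Y] [NormedSpace ℝ Y] [FiniteDimensional ℝ Y]

/-- On the open set `Ω`, the distribution `{(B_z η, η)}` is null and parallel for the metric `G`. -/
structure IsNullParallelGraph (G : X × Y → X × Y →L[ℝ] X × Y →L[ℝ] ℝ) (B : X × Y → Y →L[ℝ] X)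
    (Ω : Set (X × Y)) : Prop where
  isOpen : IsOpen Ω
  contDiffOn : ContDiffOn ℝ ∞ G Ω
  metric : ∀ z ∈ Ω, IsMetricAt G z
  contDiffOn_graph : ContDiffOn ℝ ∞ B Ω
  null : ∀ z ∈ Ω, ∀ η ζ, G z (B z η, η) (B z ζ, ζ) = 0
  parallel : ∀ z ∈ Ω, ∀ η v, fderiv ℝ (fun z' => B z' η) z v + (chr G z v (B z η, η)).1 =
    B z (chr G z v (B z η, η)).2

namespace IsNullParallelGraph

variable {G : X × Y → X × Y →L[ℝ] X × Y →L[ℝ] ℝ} {B : X × Y → Y →L[ℝ] X} {Ω : Set (X × Y)}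

lemma differentiableAt (H : IsNullParallelGraph G B Ω) {z : X × Y} (hz : z ∈ Ω) :
    DifferentiableAt ℝ B z :=
  (H.contDiffOn_graph.contDiffAt (H.isOpen.mem_nhds hz)).differentiableAt (by simp)

lemma fderiv_apply (H : IsNullParallelGraph G B Ω) {z : X × Y} (hz : z ∈ Ω) (η : Y) (v : X × Y) :
    fderiv ℝ (fun z' => B z' η) z v = fderiv ℝ B z v η := by
  rw [((H.differentiableAt hz).hasFDerivAt.clm_apply (hasFDerivAt_const η z)).fderiv]
  simp

/-- A parallel distribution is integrable, since the Levi-Civita connection is torsion free. -/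
lemma integrable (H : IsNullParallelGraph G B Ω) {z : X × Y} (hz : z ∈ Ω) (η ζ : Y) :
    fderiv ℝ B z (B z η, η) ζ = fderiv ℝ B z (B z ζ, ζ) η := by
  have h1 := H.parallel z hz ζ (B z η, η)
  have h2 := H.parallel z hz η (B z ζ, ζ)
  rw [(H.metric z hz).chr_symm, ← h2, H.fderiv_apply hz, H.fderiv_apply hz,
    (H.metric z hz).chr_symm, add_left_inj] at h1
  exact h1

end IsNullParallelGraph

end GraphDistribution

section GraphDistribution

variable {X Y : Type} [NormedAddCommGroup X] [NormedSpace ℝ X] [FiniteDimensional ℝ X]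
  [NormedAddCommGroup Y] [NormedSpace ℝ Y] [FiniteDimensional ℝ Y]

namespace IsNullParallelGraph

variable {G : X × Y → X × Y →L[ℝ] X × Y →L[ℝ] ℝ} {B : X × Y → Y →L[ℝ] X} {Ω : Set (X × Y)}

/-- The leaves of a null parallel distribution are the fibres `{x = const}` in suitable
coordinates. -/
lemma exists_flattening (H : IsNullParallelGraph G B Ω) (h0 : (0 : X × Y) ∈ Ω) :
    ∃ Θ : OpenPartialHomeomorph (X × Y) (X × Y), 0 ∈ Θ.source ∧ Θ 0 = 0 ∧ IsDiffeo Θ ∧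
      ∀ z ∈ Θ.source, Θ z ∈ Ω ∧ ∀ η, fderiv ℝ Θ z (0, η) = (B (Θ z) η, η) := by
  have : CompleteSpace X := FiniteDimensional.complete ℝ X
  have : CompleteSpace Y := FiniteDimensional.complete ℝ Y
  obtain ⟨B', hB', hBB'⟩ := exists_contDiff_eventuallyEq H.isOpen H.contDiffOn_graph h0
  have hU : {z | z ∈ Ω ∧ B' =ᶠ[𝓝 z] B} ∈ 𝓝 ((0 : X), (0 : Y)) :=
    inter_mem (H.isOpen.mem_nhds h0) hBB'.eventually_nhds
  obtain ⟨θ, r, hr, hθ, hθ0, hθd⟩ := exists_frobenius hB' 0 hU (fun z hz η ζ => by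
    rw [hz.2.fderiv_eq, hz.2.self_of_nhds, H.integrable hz.1])
  set S : Set (X × Y) := Metric.ball 0 r ×ˢ Metric.ball 0 r with hS
  have hSo : IsOpen S := Metric.isOpen_ball.prod Metric.isOpen_ball
  have h0S : (0 : X × Y) ∈ S := ⟨Metric.mem_ball_self hr, Metric.mem_ball_self hr⟩
  have hθat : ∀ z ∈ S, DifferentiableAt ℝ θ z := fun z hz =>
    (hθ.contDiffAt (hSo.mem_nhds hz)).differentiableAt (by simp)
  set κ : X × Y → X × Y := fun z => (θ z, z.2) with hκ
  have hκS : ContDiffOn ℝ ∞ κ S := hθ.prodMk contDiffOn_snd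
  have hκ0 : κ 0 = 0 := by
    have := hθ0 0 (Metric.mem_ball_self hr)
    exact Prod.ext this rfl
  have hκd : ∀ z ∈ S, ∀ v, fderiv ℝ κ z v = (fderiv ℝ θ z v, v.2) := fun z hz v => by
    have h1 : HasFDerivAt κ ((fderiv ℝ θ z).prod (ContinuousLinearMap.snd ℝ X Y)) z :=
      (hθat z hz).hasFDerivAt.prodMk hasFDerivAt_snd
    rw [h1.fderiv]
    rfl
  have hin : ∀ᶠ z in 𝓝 (0 : X × Y), κ z ∈ Ω ∧ B' =ᶠ[𝓝 (κ z)] B := by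
    have hc : ContinuousAt κ 0 := (hκS.contDiffAt (hSo.mem_nhds h0S)).continuousAt
    have := hc.tendsto
    rw [hκ0] at this
    exact this.eventually hU
  obtain ⟨T, hTs, hTo, h0T⟩ := mem_nhds_iff.1 (inter_mem (hSo.mem_nhds h0S) hin)
  have hinv : (fderiv ℝ κ 0).IsInvertible := by
    refine isInvertible_of_injective ((injective_iff_map_eq_zero _).2 fun v hv => ?_) rfl
    rw [hκd 0 h0S] at hv
    obtain ⟨h1, h2⟩ := Prod.mk_eq_zero.1 hv
    have h3 : fderiv ℝ θ 0 (v.1, 0) = v.1 := by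
      have e : (fun x => θ (x, 0)) =ᶠ[𝓝 (0 : X)] id := by
        filter_upwards [Metric.ball_mem_nhds (0 : X) hr] with x hx using hθ0 x hx
      have d : HasFDerivAt (fun x => θ (x, 0)) ((fderiv ℝ θ (0, 0)).comp
          (ContinuousLinearMap.inl ℝ X Y)) 0 :=
        HasFDerivAt.comp (g := θ) (0 : X) (hθat 0 h0S).hasFDerivAt (hasFDerivAt_prodMk_left 0 0)
      have := d.fderiv.symm.trans (e.fderiv_eq.trans fderiv_id)
      exact congrArg (fun L : X →L[ℝ] X => L v.1) this
    have h4 : v = (v.1, 0) := Prod.ext rfl h2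
    rw [h4, h3] at h1
    rw [h4, h1]
    rfl
  obtain ⟨Θ, h0Θ, hΘT, hΘκ, hΘinv, hΘs⟩ := exists_smooth_inverse hTo h0T
    (hκS.mono fun z hz => (hTs hz).1) hinv
  have hΘκ' : (Θ : X × Y → X × Y) = κ := funext hΘκ
  refine ⟨Θ, h0Θ, by rw [hΘκ, hκ0], ⟨?_, hΘs⟩, fun z hz => ?_⟩
  · rw [hΘκ']
    exact hκS.mono fun z hz => (hTs (hΘT hz)).1
  · obtain ⟨hzS, hzΩ, hzB⟩ := hTs (hΘT hz)
    rw [hΘκ']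
    refine ⟨hzΩ, fun η => ?_⟩
    rw [hκd z hzS, hθd z hzS, ← hzB.self_of_nhds]

/-- A null parallel distribution of graphs remains null and parallel in coordinates in which its
leaves are the fibres `{x = const}`. -/
lemma flatten (H : IsNullParallelGraph G B Ω) {Θ : OpenPartialHomeomorph (X × Y) (X × Y)}
    (hΘ : IsDiffeo Θ) (h : ∀ z ∈ Θ.source, Θ z ∈ Ω ∧ ∀ η, fderiv ℝ Θ z (0, η) = (B (Θ z) η, η)) :
    IsNullParallelGraph (pull Θ G) 0 Θ.source := by
  have : CompleteSpace X := FiniteDimensional.complete ℝ X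
  have : CompleteSpace Y := FiniteDimensional.complete ℝ Y
  have hpb : ∀ z ∈ Θ.source, IsPullbackAt Θ (pull Θ G) G z := fun z hz =>
    hΘ.isPullbackAt_pull hz (H.metric _ (h z hz).1)
  refine ⟨Θ.open_source, (hΘ.contDiffOn_pull H.contDiffOn).mono fun z hz => ⟨hz, (h z hz).1⟩,
    fun z hz => (hpb z hz).isMetricAt, contDiffOn_const, fun z hz η ζ => ?_, fun z hz η v => ?_⟩
  · rw [pull_apply]
    simp only [Pi.zero_apply, zero_apply]
    rw [(h z hz).2, (h z hz).2, H.null _ (h z hz).1]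
  · have hB := H.differentiableAt (h z hz).1
    have hBη : HasFDerivAt (fun z' => (B z' η, η)) ((fderiv ℝ (fun z' => B z' η) (Θ z)).prod 0)
        (Θ z) := by
      refine HasFDerivAt.prodMk ?_ (hasFDerivAt_const η _)
      exact (hB.clm_apply (differentiableAt_const η)).hasFDerivAt
    have hc := (hpb z hz).map_covariant (Y := fun _ => ((0 : X), η)) (Y' := fun z' => (B z' η, η))
      (differentiableAt_const _) hBη.differentiableAt (by
        filter_upwards [Θ.open_source.mem_nhds hz] with y hy
        exact ((h y hy).2 η).symm) v
    rw [hBη.fderiv, fderiv_const_apply] at hc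
    set w := chr (pull Θ G) z v (0, η) with hw
    have e1 : fderiv ℝ Θ z w = fderiv ℝ Θ z (w.1, 0) + fderiv ℝ Θ z (0, w.2) := by
      rw [← map_add]; simp
    have hp := H.parallel (Θ z) (h z hz).1 η (fderiv ℝ Θ z v)
    rw [zero_apply, zero_add, e1, (h z hz).2] at hc
    -- the horizontal part of `w` is mapped to a vector in the distribution with second component `0`
    have e2 := congrArg Prod.fst hc
    have e3 := congrArg Prod.snd hc
    simp only [Prod.fst_add, Prod.snd_add, ContinuousLinearMap.prod_apply, zero_apply, zero_add]
      at e2 e3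
    rw [hp, ← e3, map_add] at e2
    have e4 : fderiv ℝ Θ z (w.1, 0) = fderiv ℝ Θ z (0, (fderiv ℝ Θ z (w.1, 0)).2) := by
      rw [(h z hz).2]
      exact Prod.ext (add_right_cancel e2) rfl
    have e5 : w.1 = 0 := congrArg Prod.fst ((hpb z hz).invertible.injective e4)
    simpa using e5

/-- If the fibres `{x = const}` are null and parallel, then the covector-valued functions
`M(z) η = h((0, η), (·, 0))` on the fibres are closed, hence have a primitive `p`. In the coordinates
`(x, p)`, the metric is `2 dxⁱ ∘ dpᵢ` plus a form on the base. -/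
lemma exists_fibre_coordinates {h : X × Y → X × Y →L[ℝ] X × Y →L[ℝ] ℝ}
    (H : IsNullParallelGraph h 0 Ω) (h0 : (0 : X × Y) ∈ Ω)
    (hXY : Module.finrank ℝ X = Module.finrank ℝ Y) :
    ∃ Θ : OpenPartialHomeomorph (X × Y) (X × (X →L[ℝ] ℝ)), 0 ∈ Θ.source ∧ Θ 0 = 0 ∧ IsDiffeo Θ ∧
      Θ.source ⊆ Ω ∧ ∀ z ∈ Θ.source, ∀ v, (fderiv ℝ Θ z v).1 = v.1 ∧
        ∀ η ξ, (fderiv ℝ Θ z (0, η)).2 ξ = h z (0, η) (ξ, 0) := by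
  have : CompleteSpace X := FiniteDimensional.complete ℝ X
  have : CompleteSpace Y := FiniteDimensional.complete ℝ Y
  let M : X × Y → Y →L[ℝ] X →L[ℝ] ℝ := fun z =>
    (h z).bilinearComp (ContinuousLinearMap.inr ℝ X Y) (ContinuousLinearMap.inl ℝ X Y)
  have hM : ∀ z η ξ, M z η ξ = h z (0, η) (ξ, 0) := fun z η ξ => rfl
  have hMs : ContDiffOn ℝ ∞ M Ω := by
    rw [contDiffOn_clm_apply]
    intro η
    rw [contDiffOn_clm_apply]
    intro ξ
    exact (H.contDiffOn.clm_apply contDiffOn_const).clm_apply contDiffOn_const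
  have hMd : ∀ z ∈ Ω, DifferentiableAt ℝ M z := fun z hz =>
    (hMs.contDiffAt (H.isOpen.mem_nhds hz)).differentiableAt (by simp)
  have hMfd : ∀ z ∈ Ω, ∀ v η ξ, fderiv ℝ M z v η ξ = fderiv ℝ h z v (0, η) (ξ, 0) := by
    intro z hz v η ξ
    have h1 := (((hMd z hz).hasFDerivAt.clm_apply (hasFDerivAt_const η z)).clm_apply
      (hasFDerivAt_const ξ z)).fderiv
    have h2 : fderiv ℝ (fun z' => h z' (0, η) (ξ, 0)) z v = fderiv ℝ M z v η ξ := by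
      rw [show fderiv ℝ (fun z' => h z' (0, η) (ξ, 0)) z = _ from h1]
      simp
    rw [← h2, fderiv_clm_apply₂ (H.metric z hz).differentiableAt]
  have hpar : ∀ z ∈ Ω, ∀ v η, chr h z v (0, η) = (0, (chr h z v (0, η)).2) := fun z hz v η => by
    have := H.parallel z hz η v
    exact Prod.ext (by simpa using this) rfl
  have hnull : ∀ z ∈ Ω, ∀ η ζ, h z (0, η) (0, ζ) = 0 := fun z hz η ζ => by
    simpa using H.null z hz η ζ
  have hclosed : ∀ z ∈ Ω, ∀ η ζ, fderiv ℝ M z (0, η) ζ = fderiv ℝ M z (0, ζ) η := by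
    intro z hz η ζ
    ext ξ
    have hm := H.metric z hz
    rw [hMfd z hz, hMfd z hz, hm.fderiv_eq, hm.fderiv_eq, hm.chr_symm (0, η) (0, ζ),
      hm.chr_symm (0, η) (ξ, 0), hm.chr_symm (0, ζ) (ξ, 0), hpar z hz (ξ, 0) η,
      hpar z hz (ξ, 0) ζ, hnull z hz, hnull z hz]
  obtain ⟨M', hM', hMM'⟩ := exists_contDiff_eventuallyEq H.isOpen hMs h0
  -- the system `∂_η (x, p) = (0, M(x, y) η)`
  let K' : (X × (X →L[ℝ] ℝ)) × Y →L[ℝ] X × Y :=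
    ((ContinuousLinearMap.fst ℝ _ _).comp (ContinuousLinearMap.fst ℝ _ _)).prod
      (ContinuousLinearMap.snd ℝ _ _)
  let J : (X →L[ℝ] ℝ) →L[ℝ] X × (X →L[ℝ] ℝ) := ContinuousLinearMap.inr ℝ _ _
  let B' : (X × (X →L[ℝ] ℝ)) × Y → Y →L[ℝ] X × (X →L[ℝ] ℝ) := fun z => J.comp (M' (K' z))
  have hB' : ContDiff ℝ ∞ B' := contDiff_const.clm_comp (hM'.comp K'.contDiff)
  have hB'd : ∀ z v η, fderiv ℝ B' z v η = (0, fderiv ℝ M' (K' z) (K' v) η) := by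
    intro z v η
    have h1 : HasFDerivAt (fun z => M' (K' z)) ((fderiv ℝ M' (K' z)).comp K') z :=
      HasFDerivAt.comp (g := M') z ((hM'.differentiable (by simp)) _).hasFDerivAt K'.hasFDerivAt
    have h2 := ((hasFDerivAt_const J z).clm_comp h1).fderiv
    rw [show fderiv ℝ B' z = _ from h2]
    simp [J]
  have hU : {z | K' z ∈ Ω ∧ M' =ᶠ[𝓝 (K' z)] M} ∈ 𝓝 ((0 : X × (X →L[ℝ] ℝ)), (0 : Y)) := by
    have hc : Tendsto K' (𝓝 0) (𝓝 0) := by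
      have := K'.continuous.continuousAt (x := 0)
      rwa [ContinuousAt, map_zero] at this
    exact hc.eventually (inter_mem (H.isOpen.mem_nhds h0) hMM'.eventually_nhds)
  obtain ⟨θ, r, hr, hθ, hθ0, hθd⟩ := exists_frobenius hB' 0 hU (fun z hz η ζ => by
    rw [hB'd, hB'd, hz.2.fderiv_eq]
    have e : ∀ η, K' (B' z η, η) = (0, η) := fun η => rfl
    rw [e, e, hclosed _ hz.1])
  set S : Set ((X × (X →L[ℝ] ℝ)) × Y) := Metric.ball 0 r ×ˢ Metric.ball 0 r with hS
  have hSo : IsOpen S := Metric.isOpen_ball.prod Metric.isOpen_ball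
  have hθat : ∀ z ∈ S, DifferentiableAt ℝ θ z := fun z hz =>
    (hθ.contDiffAt (hSo.mem_nhds hz)).differentiableAt (by simp)
  let ι : X × Y →L[ℝ] (X × (X →L[ℝ] ℝ)) × Y :=
    ((ContinuousLinearMap.inl ℝ _ _).comp (ContinuousLinearMap.fst ℝ _ _)).prod
      (ContinuousLinearMap.snd ℝ _ _)
  have hKι : ∀ z, K' (ι z) = z := fun z => rfl
  set κ : X × Y → X × (X →L[ℝ] ℝ) := fun z => (z.1, (θ (ι z)).2) with hκ
  set S' : Set (X × Y) := ι ⁻¹' S with hS'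
  have hS'o : IsOpen S' := hSo.preimage ι.continuous
  have h0S' : (0 : X × Y) ∈ S' := by
    change ι 0 ∈ S
    rw [map_zero]
    exact ⟨Metric.mem_ball_self hr, Metric.mem_ball_self hr⟩
  have hκS : ContDiffOn ℝ ∞ κ S' :=
    contDiffOn_fst.prodMk (contDiff_snd.comp_contDiffOn (hθ.comp ι.contDiff.contDiffOn fun z hz => hz))
  have hθι : ∀ x ∈ Metric.ball (0 : X) r, (x, (0 : X →L[ℝ] ℝ)) ∈ Metric.ball (0 : X × (X →L[ℝ] ℝ)) r :=
    fun x hx => by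
      rw [mem_ball_zero_iff] at hx ⊢
      rw [Prod.norm_def, norm_zero]
      exact max_lt hx hr
  have hκx0 : ∀ x ∈ Metric.ball (0 : X) r, κ (x, 0) = (x, 0) := fun x hx => by
    have := hθ0 _ (hθι x hx)
    change (x, (θ ((x, 0), 0)).2) = (x, 0)
    rw [this]
  have hfst : ∀ z ∈ S', (θ (ι z)).1 = z.1 := by
    rintro ⟨x, y⟩ hz
    have hd : ∀ y' ∈ Metric.ball (0 : Y) r, HasFDerivAt (fun y' => (θ ((x, 0), y')).1) (0 : Y →L[ℝ] X) y' := by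
      intro y' hy'
      have h1 := HasFDerivAt.comp (g := θ) y' (hθat ((x, 0), y') ⟨hz.1, hy'⟩).hasFDerivAt
        (hasFDerivAt_prodMk_right (x, (0 : X →L[ℝ] ℝ)) y')
      refine h1.fst.congr_fderiv ?_
      ext η
      have h3 := hθd ((x, 0), y') ⟨hz.1, hy'⟩ η
      simpa [B', J] using congrArg Prod.fst h3
    have hc := Metric.isOpen_ball.is_const_of_fderiv_eq_zero (𝕜 := ℝ)
      (convex_ball (0 : Y) r).isPreconnected
      (fun y' hy' => (hd y' hy').differentiableAt.differentiableWithinAt)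
      (fun y' hy' => (hd y' hy').fderiv) hz.2 (Metric.mem_ball_self hr)
    have h4 := hθ0 (x, 0) hz.1
    exact hc.trans (congrArg Prod.fst h4)
  have hκd : ∀ z ∈ S', ∀ v, fderiv ℝ κ z v = (v.1, (fderiv ℝ θ (ι z) (ι v)).2) := fun z hz v => by
    have h1 := HasFDerivAt.comp (g := θ) z (hθat (ι z) hz).hasFDerivAt ι.hasFDerivAt
    have h2 := HasFDerivAt.comp (g := Prod.snd) z hasFDerivAt_snd h1
    have h3 : HasFDerivAt κ _ z := hasFDerivAt_fst.prodMk h2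
    rw [h3.fderiv]
    rfl
  have hκη : ∀ z ∈ S', M' z = M z → ∀ η ξ, (fderiv ℝ κ z (0, η)).2 ξ = h z (0, η) (ξ, 0) := by
    intro z hz hMz η ξ
    rw [hκd z hz]
    have e1 : ι (0, η) = (0, η) := rfl
    have e2 : K' (θ (ι z), (ι z).2) = z := Prod.ext (hfst z hz) rfl
    change (fderiv ℝ θ (ι z) (ι (0, η))).2 ξ = _
    rw [e1, hθd (ι z) hz η]
    change M' (K' (θ (ι z), (ι z).2)) η ξ = _
    rw [e2, hMz]
    rfl
  obtain ⟨T, hTs, hTo, h0T⟩ := mem_nhds_iff.1 (inter_mem (hS'o.mem_nhds h0S')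
    (inter_mem (H.isOpen.mem_nhds h0) hMM'))
  have hinv : (fderiv ℝ κ 0).IsInvertible := by
    refine isInvertible_of_injective ((injective_iff_map_eq_zero _).2 fun v hv => ?_) ?_
    · have h1 : v.1 = 0 := by
        rw [hκd 0 h0S'] at hv
        exact congrArg Prod.fst hv
      have h2 : v = (0, v.2) := Prod.ext h1 rfl
      have h3 : h 0 v = 0 := by
        ext ξ
        · have := hκη 0 h0S' hMM'.self_of_nhds v.2 ξ
          rw [← h2, hv] at this
          simpa [h2.symm] using this.symm
        · rw [h2]
          exact hnull 0 h0 _ _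
      exact (H.metric 0 h0).invertible.injective (h3.trans (map_zero _).symm)
    · rw [Module.finrank_prod, Module.finrank_prod, ← hXY,
        ← (LinearMap.toContinuousLinearMap (𝕜 := ℝ) (E := X) (F' := ℝ)).finrank_eq,
        Module.finrank_linearMap, Module.finrank_self, mul_one]
  obtain ⟨Θ, h0Θ, hΘT, hΘκ, hΘinv, hΘs⟩ := exists_smooth_inverse hTo h0T
    (hκS.mono fun z hz => (hTs hz).1) hinv
  have hΘκ' : (Θ : X × Y → X × (X →L[ℝ] ℝ)) = κ := funext hΘκ
  refine ⟨Θ, h0Θ, ?_, ⟨?_, hΘs⟩, fun z hz => (hTs (hΘT hz)).2.1, fun z hz v => ?_⟩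
  · rw [hΘκ]
    exact hκx0 0 (Metric.mem_ball_self hr)
  · rw [hΘκ']
    exact hκS.mono fun z hz => (hTs (hΘT hz)).1
  · obtain ⟨hzS, hzΩ, hzM⟩ := hTs (hΘT hz)
    rw [hΘκ']
    exact ⟨by rw [hκd z hzS], hκη z hzS hzM⟩

/-- Walker's normal form: a metric with a null parallel distribution of half the dimension is
`2 dxⁱ ∘ dxⁱ' + q` in suitable coordinates, with the distribution spanned by the `∂_{i'}`. -/
theorem exists_walkerForm (H : IsNullParallelGraph G B Ω) (h0 : (0 : X × Y) ∈ Ω)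
    (hXY : Module.finrank ℝ X = Module.finrank ℝ Y) :
    ∃ Θ : OpenPartialHomeomorph (X × (X →L[ℝ] ℝ)) (X × Y), 0 ∈ Θ.source ∧ Θ 0 = 0 ∧ IsDiffeo Θ ∧
      (∀ c ∈ Θ.source, Θ c ∈ Ω) ∧
      (∀ c ∈ Θ.source, ∀ β, ∃ η, fderiv ℝ Θ c (0, β) = (B (Θ c) η, η)) ∧
      ∀ c ∈ Θ.source, ∀ v w, pull Θ G c v w =
        v.2 w.1 + w.2 v.1 + pull Θ G c (v.1, 0) (w.1, 0) := by
  obtain ⟨Θ₁, h01, e01, d1, hΘ₁⟩ := H.exists_flattening h0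
  have H₁ := H.flatten d1 hΘ₁
  obtain ⟨Θ₂, h02, e02, d2, hs2, hΘ₂⟩ := H₁.exists_fibre_coordinates h01 hXY
  have hmem : ∀ c ∈ (Θ₂.symm.trans Θ₁).source, c ∈ Θ₂.target ∧ Θ₂.symm c ∈ Θ₁.source :=
    fun c hc => by rwa [OpenPartialHomeomorph.trans_source] at hc
  have hz0 : Θ₂.symm 0 = 0 := by
    rw [← e02]
    exact (Θ₂.left_inv h02).trans rfl
  have hd : ∀ c ∈ (Θ₂.symm.trans Θ₁).source, ∀ v, fderiv ℝ (Θ₂.symm.trans Θ₁) c v =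
      fderiv ℝ Θ₁ (Θ₂.symm c) (v.1, (fderiv ℝ Θ₂.symm c v).2) := fun c hc v => by
    have h1 := fderiv_comp c (d1.differentiableAt (hmem c hc).2)
      (d2.symm.differentiableAt (hmem c hc).1)
    have h2 : (fderiv ℝ Θ₂.symm c v).1 = v.1 := by
      have := (hΘ₂ _ (Θ₂.map_target (hmem c hc).1) (fderiv ℝ Θ₂.symm c v)).1
      rw [d2.fderiv_fderiv_symm (hmem c hc).1] at this
      exact this.symm
    rw [← h2]
    exact congrArg (fun L : X × (X →L[ℝ] ℝ) →L[ℝ] X × Y => L v) h1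
  -- the pull-back metric, with the cross terms expressed through `dp = p_x dx + M dy`
  have key : ∀ c ∈ (Θ₂.symm.trans Θ₁).source, ∀ v w, pull (Θ₂.symm.trans Θ₁) G c v w =
      pull Θ₁ G (Θ₂.symm c) (v.1, 0) (w.1, 0)
        + (v.2 w.1 - (fderiv ℝ Θ₂ (Θ₂.symm c) (v.1, 0)).2 w.1)
        + (w.2 v.1 - (fderiv ℝ Θ₂ (Θ₂.symm c) (w.1, 0)).2 v.1) := by
    intro c hc v w
    have hz := Θ₂.map_target (hmem c hc).1
    set z := Θ₂.symm c with hzdef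
    have h1 : ∀ v : X × (X →L[ℝ] ℝ), ∀ ξ, pull Θ₁ G z (0, (fderiv ℝ Θ₂.symm c v).2) (ξ, 0) =
        v.2 ξ - (fderiv ℝ Θ₂ z (v.1, 0)).2 ξ := fun v ξ => by
      rw [← (hΘ₂ z hz 0).2]
      have h2 := d2.fderiv_fderiv_symm (hmem c hc).1 v
      have h3 : (fderiv ℝ Θ₂.symm c v).1 = v.1 := by
        have := (hΘ₂ z hz (fderiv ℝ Θ₂.symm c v)).1
        rw [h2] at this
        exact this.symm
      have h4 : fderiv ℝ Θ₂.symm c v = (v.1, 0) + (0, (fderiv ℝ Θ₂.symm c v).2) :=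
        Prod.ext (by simp [h3]) (by simp)
      rw [← hzdef, h4, map_add] at h2
      conv_rhs => rw [← h2]
      simp [(hΘ₂ z hz _).1]
    have hnull := H₁.null z (hmem c hc).2 (fderiv ℝ Θ₂.symm c v).2 (fderiv ℝ Θ₂.symm c w).2
    have hsplit : ∀ (x : X) (y : Y), (x, y) = (x, 0) + (0, y) := fun x y => by simp
    have hsym := (H₁.metric z (hmem c hc).2).symm.self_of_nhds
    have e1 : pull (Θ₂.symm.trans Θ₁) G c v w = pull Θ₁ G z (v.1, (fderiv ℝ Θ₂.symm c v).2)
        (w.1, (fderiv ℝ Θ₂.symm c w).2) := by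
      rw [pull_apply, hd c hc, hd c hc]
      rfl
    simp only [Pi.zero_apply, zero_apply] at hnull
    rw [e1, hsplit v.1, hsplit w.1, map_add, map_add, add_apply, add_apply, hnull, h1,
      hsym (v.1, 0) (0, _), h1]
    ring
  refine ⟨Θ₂.symm.trans Θ₁, ?_, ?_, d2.symm.trans d1, fun c hc => (hΘ₁ _ (hmem c hc).2).1,
    fun c hc β => ⟨(fderiv ℝ Θ₂.symm c (0, β)).2, ?_⟩, fun c hc v w => ?_⟩
  · rw [OpenPartialHomeomorph.trans_source]
    refine ⟨?_, ?_⟩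
    · have := Θ₂.map_source h02
      rwa [e02] at this
    · change Θ₂.symm 0 ∈ Θ₁.source
      rwa [hz0]
  · change Θ₁ (Θ₂.symm 0) = 0
    rw [hz0, e01]
  · rw [hd c hc, (hΘ₁ _ (hmem c hc).2).2]
    rfl
  · rw [key c hc v w, key c hc (v.1, 0) (w.1, 0)]
    simp only [zero_apply]
    ring

end IsNullParallelGraph

end GraphDistribution

lemma pull_trans {A B C : Type*} [NormedAddCommGroup A] [NormedSpace ℝ A] [NormedAddCommGroup B]
    [NormedSpace ℝ B] [NormedAddCommGroup C] [NormedSpace ℝ C] {Θ : OpenPartialHomeomorph A B}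
    {Ξ : OpenPartialHomeomorph B C} (hΘ : IsDiffeo Θ) (hΞ : IsDiffeo Ξ)
    (G : C → C →L[ℝ] C →L[ℝ] ℝ) {a : A} (ha : a ∈ (Θ.trans Ξ).source) :
    pull (Θ.trans Ξ) G a = pull Θ (pull Ξ G) a ∧
      ∀ v, fderiv ℝ (Θ.trans Ξ) a v = fderiv ℝ Ξ (Θ a) (fderiv ℝ Θ a v) := by
  rw [OpenPartialHomeomorph.trans_source] at ha
  have h1 : fderiv ℝ (Θ.trans Ξ) a = (fderiv ℝ Ξ (Θ a)).comp (fderiv ℝ Θ a) :=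
    fderiv_comp a (hΞ.differentiableAt ha.2) (hΘ.differentiableAt ha.1)
  refine ⟨?_, fun v => by rw [h1]; rfl⟩
  ext v w
  rw [pull_apply, h1]
  rfl

/-- A complement of a plane in `ℝ⁴` gives linear coordinates in which the plane is `{0} × ℝ²`. -/
lemma exists_linear_coordinates (P : Submodule ℝ (E 4)) (hP : Module.finrank ℝ P = 2) :
    ∃ A : E 4 ≃L[ℝ] E 2 × E 2, ∀ v ∈ P, (A v).1 = 0 := by
  obtain ⟨Q, hQ⟩ := P.exists_isCompl
  have h := Submodule.finrank_add_eq_of_isCompl hQ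
  rw [hP] at h
  have h4 : Module.finrank ℝ (E 4) = 4 := by simp
  have hQ2 : Module.finrank ℝ Q = Module.finrank ℝ (E 2) := by
    rw [h4] at h
    simp only [finrank_euclideanSpace, Fintype.card_fin]
    omega
  have hP2 : Module.finrank ℝ P = Module.finrank ℝ (E 2) := by simpa using hP
  let e := (Submodule.prodEquivOfIsCompl Q P hQ.symm).symm.trans
    ((LinearEquiv.ofFinrankEq Q (E 2) hQ2).prodCongr (LinearEquiv.ofFinrankEq P (E 2) hP2))
  refine ⟨e.toContinuousLinearEquiv, fun v hv => ?_⟩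
  have h1 : (Submodule.prodEquivOfIsCompl Q P hQ.symm).symm v = (0, ⟨v, hv⟩) :=
    Submodule.prodEquivOfIsCompl_symm_apply_right Q P hQ.symm ⟨v, hv⟩
  change (e v).1 = 0
  simp [e, h1]

section Manifold

variable {N : Type*} [TopologicalSpace N] [ChartedSpace (E 4) N] [IsManifold (𝓡 4) ∞ N]
  {g : Metric N} (D : WalkerDistribution g)

set_option maxHeartbeats 400000 in
/-- In suitable affine coordinates of a chart, the distribution is a field of graphs. -/
lemma exists_isNullParallelGraph (p : N) :
    ∃ (Ξ : OpenPartialHomeomorph (E 2 × E 2) (E 4)) (B : E 2 × E 2 → E 2 →L[ℝ] E 2)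
      (Ω : Set (E 2 × E 2)), IsDiffeo Ξ ∧ Ξ.source = univ ∧ Ξ 0 = extChartAt (𝓡 4) p p ∧ 0 ∈ Ω ∧
      (∀ z ∈ Ω, Ξ z ∈ (extChartAt (𝓡 4) p).target ∧
        ∀ η, fderiv ℝ Ξ z (B z η, η) ∈ planeInChart D p (Ξ z)) ∧
      IsNullParallelGraph (pull Ξ (g.inChart p)) B Ω := by
  set y₀ := extChartAt (𝓡 4) p p with hy₀
  have hy₀t : y₀ ∈ (extChartAt (𝓡 4) p).target := mem_extChartAt_target p
  obtain ⟨A, hA⟩ := exists_linear_coordinates (planeInChart D p y₀) (finrank_planeInChart D hy₀t)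
  obtain ⟨U, Z₁, Z₂, hU, hyU, hUt, hZ₁, hZ₂, hspan⟩ := exists_frame_planeInChart D hy₀t
  let Ξ : OpenPartialHomeomorph (E 2 × E 2) (E 4) :=
    (A.symm.toHomeomorph.trans (Homeomorph.addLeft y₀)).toOpenPartialHomeomorph
  have hΞ : ∀ z, Ξ z = y₀ + A.symm z := fun z => rfl
  have hΞs : ∀ y, Ξ.symm y = A (-y₀ + y) := fun y => rfl
  have hΞd : ∀ z, HasFDerivAt Ξ (A.symm : E 2 × E 2 →L[ℝ] E 4) z := fun z =>
    (A.symm : E 2 × E 2 →L[ℝ] E 4).hasFDerivAt.const_add y₀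
  have dΞ : IsDiffeo Ξ :=
    ⟨(contDiff_const.add (A.symm : E 2 × E 2 →L[ℝ] E 4).contDiff).contDiffOn,
      ((A : E 4 →L[ℝ] E 2 × E 2).contDiff.comp (contDiff_const.add contDiff_id)).contDiffOn⟩
  have hΞ0 : Ξ 0 = y₀ := by rw [hΞ, map_zero, add_zero]
  -- the frame of the distribution, and its component along the second factor
  let m : E 2 × E 2 → E 2 →L[ℝ] E 2 × E 2 := fun z =>
    (cov 0).smulRight (A (Z₁ (Ξ z))) + (cov 1).smulRight (A (Z₂ (Ξ z)))
  have hm : ∀ z t, m z t = A (t 0 • Z₁ (Ξ z) + t 1 • Z₂ (Ξ z)) := fun z t => by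
    simp [m]
  set Ω₁ : Set (E 2 × E 2) := Ξ ⁻¹' U with hΩ₁
  have hΩ₁o : IsOpen Ω₁ := hU.preimage (by
    exact (contDiff_const.add (A.symm : E 2 × E 2 →L[ℝ] E 4).contDiff (n := 0)).continuous)
  have h0Ω₁ : (0 : E 2 × E 2) ∈ Ω₁ := by
    change Ξ 0 ∈ U
    rwa [hΞ0]
  have hms : ContDiffOn ℝ ∞ m Ω₁ := by
    have hA : ∀ Z : E 4 → E 4, ContDiffOn ℝ ∞ Z U → ContDiffOn ℝ ∞ (fun z => A (Z (Ξ z))) Ω₁ :=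
      fun Z hZ => (A : E 4 →L[ℝ] E 2 × E 2).contDiff.comp_contDiffOn
        (hZ.comp (dΞ.contDiffOn.mono (subset_univ _)) fun z hz => hz)
    exact (contDiffOn_const.smulRight (hA _ hZ₁)).add (contDiffOn_const.smulRight (hA _ hZ₂))
  let n : E 2 × E 2 → E 2 →L[ℝ] E 2 := fun z => (ContinuousLinearMap.snd ℝ _ _).comp (m z)
  have hns : ContDiffOn ℝ ∞ n Ω₁ := contDiffOn_const.clm_comp hms
  set Ω : Set (E 2 × E 2) := {z | z ∈ Ω₁ ∧ (n z).IsInvertible} with hΩ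
  have hΩo : IsOpen Ω := isOpen_iff_mem_nhds.2 fun z hz => inter_mem (hΩ₁o.mem_nhds hz.1)
    (eventually_isInvertible_of_continuousAt
      (hns.contDiffAt (hΩ₁o.mem_nhds hz.1)).continuousAt hz.2)
  let B : E 2 × E 2 → E 2 →L[ℝ] E 2 := fun z =>
    ((ContinuousLinearMap.fst ℝ _ _).comp (m z)).comp (n z).inverse
  have hBs : ContDiffOn ℝ ∞ B Ω := by
    refine (contDiffOn_const.clm_comp (hms.mono fun z hz => hz.1)).clm_comp fun z hz => ?_
    exact ((hz.2.contDiffAt_map_inverse (n := ∞)).comp z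
      (hns.contDiffAt (hΩ₁o.mem_nhds hz.1))).contDiffWithinAt
  have hBm : ∀ z ∈ Ω, ∀ t, m z t = (B z (n z t), n z t) := fun z hz t =>
    Prod.ext (by simp [B, hz.2.inverse_apply_self]) rfl
  have hmem : ∀ z ∈ Ω, ∀ v, A.symm v ∈ planeInChart D p (Ξ z) ↔ v.1 = B z v.2 := by
    intro z hz v
    rw [hspan _ hz.1, Submodule.mem_span_pair]
    constructor
    · rintro ⟨a, b, hab⟩
      have h1 : m z !₂[a, b] = v := by
        rw [hm]
        simp [hab]
      rw [← h1, hBm z hz]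
    · intro hv
      set t := (n z).inverse v.2 with ht
      have h1 : n z t = v.2 := hz.2.self_apply_inverse _
      have h2 : m z t = v := by
        rw [hBm z hz, h1, ← hv]
      refine ⟨t 0, t 1, ?_⟩
      rw [← h2, hm]
      simp
  have h0Ω : (0 : E 2 × E 2) ∈ Ω := by
    refine ⟨h0Ω₁, isInvertible_of_injective ((injective_iff_map_eq_zero _).2 fun t ht => ?_) rfl⟩
    have h1 : t 0 • Z₁ y₀ + t 1 • Z₂ y₀ = 0 := by
      have hP : t 0 • Z₁ y₀ + t 1 • Z₂ y₀ ∈ planeInChart D p y₀ := by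
        rw [hspan _ hyU]
        exact Submodule.mem_span_pair.2 ⟨_, _, rfl⟩
      refine A.injective (Prod.ext ((hA _ hP).trans (by simp)) ?_)
      have h2 : (m 0 t).2 = 0 := ht
      rw [hm, hΞ0] at h2
      rw [h2]
      simp
    have hli : LinearIndependent ℝ ![Z₁ y₀, Z₂ y₀] := by
      rw [linearIndependent_iff_card_eq_finrank_span]
      have h3 := finrank_planeInChart D hy₀t
      rw [hspan _ hyU] at h3
      rw [Set.finrank, Matrix.range_cons_cons_empty, h3]
      rfl
    have h4 := LinearIndependent.pair_iff.1 hli _ _ h1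
    ext i
    fin_cases i
    exacts [h4.1, h4.2]
  have hfd : ∀ z, fderiv ℝ Ξ z = (A.symm : E 2 × E 2 →L[ℝ] E 4) := fun z => (hΞd z).fderiv
  have hgraph : ∀ z ∈ Ω, ∀ η, fderiv ℝ Ξ z (B z η, η) ∈ planeInChart D p (Ξ z) :=
    fun z hz η => by
      rw [hfd]
      exact (hmem z hz _).2 rfl
  have hpb : ∀ z ∈ Ω, IsPullbackAt Ξ (pull Ξ (g.inChart p)) (g.inChart p) z := fun z hz =>
    dΞ.isPullbackAt_pull (mem_univ z) (isMetricAt_inChart g (hUt hz.1))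
  refine ⟨Ξ, B, Ω, dΞ, rfl, hΞ0, h0Ω, fun z hz => ⟨hUt hz.1, hgraph z hz⟩, hΩo,
    (dΞ.contDiffOn_pull (contDiffOn_inChart g p)).mono fun z hz => ⟨mem_univ z, hUt hz.1⟩,
    fun z hz => (hpb z hz).isMetricAt, hBs,
    fun z hz η ζ => ?_, fun z hz η v => ?_⟩
  · rw [pull_apply]
    exact inChart_null D (hgraph z hz η) (hgraph z hz ζ)
  set V : Set (E 4) := Ξ.symm ⁻¹' Ω with hV
  have hVo : IsOpen V := hΩo.preimage (by
    exact ((A : E 4 →L[ℝ] E 2 × E 2).contDiff.comp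
      (contDiff_const.add contDiff_id) (n := 0)).continuous)
  have hVΞ : ∀ y ∈ V, Ξ (Ξ.symm y) = y := fun y hy => Ξ.right_inv (mem_univ y)
  let Z : E 4 → E 4 := fun y => A.symm (B (Ξ.symm y) η, η)
  have hZs : ContDiffOn ℝ ∞ Z V := by
    refine (A.symm : E 2 × E 2 →L[ℝ] E 4).contDiff.comp_contDiffOn (ContDiffOn.prodMk ?_ contDiffOn_const)
    exact (hBs.comp (dΞ.contDiffOn_symm.mono (subset_univ _)) fun y hy => hy).clm_apply
      contDiffOn_const
  have hZV : ∀ y ∈ V, Z y ∈ planeInChart D p y := fun y hy => by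
    have := (hmem (Ξ.symm y) hy (B (Ξ.symm y) η, η)).2 rfl
    rwa [hVΞ y hy] at this
  have hsymm : ∀ z, Ξ.symm (Ξ z) = z := fun z => Ξ.left_inv (mem_univ z)
  have hzV : Ξ z ∈ V := by
    change Ξ.symm (Ξ z) ∈ Ω
    rwa [hsymm]
  have hpar := planeInChart_parallel D hVo (fun y hy => by
    have := hUt (show Ξ (Ξ.symm y) ∈ U from hy.1)
    rwa [hVΞ y hy] at this) hZs hZV hzV (fderiv ℝ Ξ z v)
  have hBd : HasFDerivAt (fun z' => (B z' η, η)) ((fderiv ℝ (fun z' => B z' η) z).prod 0) z := by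
    refine HasFDerivAt.prodMk ?_ (hasFDerivAt_const η _)
    exact (((hBs.contDiffAt (hΩo.mem_nhds hz)).differentiableAt (by simp)).clm_apply
      (differentiableAt_const η)).hasFDerivAt
  have hcov := (hpb z hz).map_covariant (Y := fun z' => (B z' η, η)) (Y' := Z)
    hBd.differentiableAt ((hZs.contDiffAt (hVo.mem_nhds hzV)).differentiableAt (by simp))
    (Eventually.of_forall fun z' => by
      change A.symm (B (Ξ.symm (Ξ z')) η, η) = _
      rw [hsymm, hfd]
      rfl) v
  rw [← hcov, hfd] at hpar
  have := (hmem z hz _).1 hpar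
  rw [hBd.fderiv] at this
  simpa using this

/-- Walker coordinates centred at a point, over the preferred chart. -/
theorem exists_walkerChart (p : N) :
    ∃ Θ : OpenPartialHomeomorph Cot (E 4), 0 ∈ Θ.source ∧ Θ 0 = extChartAt (𝓡 4) p p ∧ IsDiffeo Θ ∧
      (∀ c ∈ Θ.source, Θ c ∈ (extChartAt (𝓡 4) p).target) ∧
      (∀ c ∈ Θ.source, ∀ β, fderiv ℝ Θ c (0, β) ∈ planeInChart D p (Θ c)) ∧
      ∀ c ∈ Θ.source, ∀ v w, pull Θ (g.inChart p) c v w =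
        v.2 w.1 + w.2 v.1 + pull Θ (g.inChart p) c (v.1, 0) (w.1, 0) := by
  obtain ⟨Ξ, B, Ω, dΞ, hΞs, hΞ0, h0, hΩ, H⟩ := exists_isNullParallelGraph D p
  obtain ⟨Θ, h0Θ, hΘ0, dΘ, hΘΩ, hΘB, hW⟩ := H.exists_walkerForm h0 rfl
  have hsrc : (Θ.trans Ξ).source = Θ.source := by
    rw [OpenPartialHomeomorph.trans_source, hΞs, preimage_univ, inter_univ]
  refine ⟨Θ.trans Ξ, by rwa [hsrc], ?_, dΘ.trans dΞ, fun c hc => ?_, fun c hc β => ?_,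
    fun c hc v w => ?_⟩
  · change Ξ (Θ 0) = _
    rw [hΘ0, hΞ0]
  · rw [hsrc] at hc
    exact (hΩ _ (hΘΩ c hc)).1
  · rw [(pull_trans dΘ dΞ (g.inChart p) hc).2]
    rw [hsrc] at hc
    obtain ⟨η, hη⟩ := hΘB c hc β
    rw [hη]
    exact (hΩ _ (hΘΩ c hc)).2 η
  · rw [(pull_trans dΘ dΞ (g.inChart p) hc).1]
    rw [hsrc] at hc
    exact hW c hc v w

end Manifold

/-! ### The metric of the cotangent bundle in coordinates -/

section Cotangent

variable {S : Type} [TopologicalSpace S] [ChartedSpace (E 2) S] [IsManifold (𝓡 2) ∞ S]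

lemma frame_mfderiv_chart' {n : ℕ} {M : Type*} [TopologicalSpace M] [ChartedSpace (E n) M]
    [IsManifold (𝓡 n) ∞ M] {p q : M} (hq : q ∈ (extChartAt (𝓡 n) p).source) (v : E n) :
    frame p (extChartAt (𝓡 n) p q) (mfderiv (𝓡 n) (𝓡 n) (extChartAt (𝓡 n) p) q v) = v := by
  have h := frame_mfderiv_chart ((extChartAt (𝓡 n) p).map_source hq) v
  rwa [(extChartAt (𝓡 n) p).left_inv hq] at h

lemma mfderiv_chart_frame' {n : ℕ} {M : Type*} [TopologicalSpace M] [ChartedSpace (E n) M]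
    [IsManifold (𝓡 n) ∞ M] {p q : M} (hq : q ∈ (extChartAt (𝓡 n) p).source) (v : E n) :
    mfderiv (𝓡 n) (𝓡 n) (extChartAt (𝓡 n) p) q (frame p (extChartAt (𝓡 n) p q) v) = v := by
  have h := mfderiv_chart_frame ((extChartAt (𝓡 n) p).map_source hq) v
  rwa [(extChartAt (𝓡 n) p).left_inv hq] at h

lemma mem_cotangent_source {z₀ z : Cotangent S} :
    z ∈ (extChartAt cotModel z₀).source ↔ z.proj ∈ (extChartAt (𝓡 2) z₀.proj).source := by
  rw [extChartAt_source, extChartAt_source]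
  simp [FiberBundle.chartedSpace_chartAt, hom_trivializationAt_source]
  exact fun h => h

lemma extChartAt_cotangent_snd {z₀ z : Cotangent S} (hz : z ∈ (extChartAt cotModel z₀).source)
    (v : E 2) : (extChartAt cotModel z₀ z).2 v =
      z.2 (frame z₀.proj (extChartAt (𝓡 2) z₀.proj z.proj) v) := by
  have : IsManifold (𝓡 2) 1 S := IsManifold.of_le (n := ∞) (by simp)
  rw [mem_cotangent_source] at hz
  have hz' := hz
  rw [extChartAt_source] at hz'
  have h1 : (extChartAt cotModel z₀ z).2 = ContinuousLinearMap.inCoordinates (E 2)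
      (fun p : S => TangentSpace (𝓡 2) p) ℝ (fun _ : S => ℝ) z₀.proj z.proj z₀.proj z.proj z.2 := by
    have := congrArg Prod.snd (hom_chart (HB := E 2) z₀ z)
    exact this
  have e : frame z₀.proj (extChartAt (𝓡 2) z₀.proj z.proj) =
      (trivializationAt (E 2) (TangentSpace (𝓡 2)) z₀.proj).symmL ℝ z.proj := by
    rw [TangentBundle.symmL_trivializationAt hz', frame_eq]
  rw [h1, e]
  simp [ContinuousLinearMap.inCoordinates]
  rfl

lemma mdifferentiableAt_extChartAt_cotangent {z₀ z : Cotangent S}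
    (hz : z ∈ (extChartAt cotModel z₀).source) :
    MDifferentiableAt cotModel 𝓘(ℝ, Cot) (extChartAt cotModel z₀) z := by
  have : IsManifold cotModel 1 (Cotangent S) := IsManifold.of_le (n := ∞) (by simp)
  exact mdifferentiableAt_extChartAt (by rwa [extChartAt_source] at hz)

/-- The coordinates of a tangent vector of the cotangent bundle. -/
def cotVec (z₀ z : Cotangent S) (ξ : TangentSpace cotModel z) : Cot :=
  mfderiv cotModel 𝓘(ℝ, Cot) (extChartAt cotModel z₀) z ξ

lemma dproj_eq {z₀ z : Cotangent S} (hz : z ∈ (extChartAt cotModel z₀).source)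
    (ξ : TangentSpace cotModel z) :
    dproj z ξ = frame z₀.proj (extChartAt (𝓡 2) z₀.proj z.proj) (cotVec z₀ z ξ).1 := by
  have : IsManifold (𝓡 2) 1 S := IsManifold.of_le (n := ∞) (by simp)
  have hzs := mem_cotangent_source.1 hz
  have h1 := mfderiv_comp (I := cotModel) (I' := 𝓡 2) (I'' := 𝓡 2) z
    (mdifferentiableAt_extChartAt (x := z₀.proj) (by rwa [extChartAt_source] at hzs))
    (Bundle.mdifferentiableAt_proj (fun p : S => TangentSpace (𝓡 2) p →L[ℝ] ℝ))
  have h2 := mfderiv_comp (I := cotModel) (I' := 𝓘(ℝ, Cot)) (I'' := 𝓡 2) z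
    (g := (Prod.fst : Cot → E 2))
    (differentiableAt_fst.mdifferentiableAt) (mdifferentiableAt_extChartAt_cotangent hz)
  have h3 : (Prod.fst : Cot → E 2) ∘ extChartAt cotModel z₀ =
      extChartAt (𝓡 2) z₀.proj ∘ Bundle.TotalSpace.proj := rfl
  rw [h3, h1, mfderiv_eq_fderiv, fderiv_fst] at h2
  have h4 : (mfderiv (𝓡 2) (𝓡 2) (extChartAt (𝓡 2) z₀.proj) z.proj (dproj z ξ) : E 2) =
      (cotVec z₀ z ξ).1 := congrArg (fun L : Cot →L[ℝ] E 2 => L ξ) h2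
  rw [← h4]
  exact (frame_mfderiv_chart' hzs (dproj z ξ)).symm

end Cotangent

section Cotangent

variable {S : Type} [TopologicalSpace S] [ChartedSpace (E 2) S] [IsManifold (𝓡 2) ∞ S]

lemma mdifferentiableAt_iotaField {Y : ∀ p : S, TangentSpace (𝓡 2) p} {z : Cotangent S}
    (hY : MDifferentiableAt (𝓡 2) ((𝓡 2).prod 𝓘(ℝ, E 2))
      (fun p => (⟨p, Y p⟩ : Bundle.TotalSpace (E 2) (fun p : S => TangentSpace (𝓡 2) p))) z.proj) :
    MDifferentiableAt cotModel 𝓘(ℝ, ℝ) (iotaField Y) z := by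
  have : IsManifold (𝓡 2) 1 S := IsManifold.of_le (n := ∞) (by simp)
  have h1 : MDifferentiableAt cotModel ((𝓡 2).prod 𝓘(ℝ, ℝ))
      (fun z' : Cotangent S =>
        Bundle.TotalSpace.mk' ℝ (E := fun _ : S => ℝ) z'.proj (z'.2 (Y z'.proj))) z := by
    refine MDifferentiableAt.clm_bundle_apply (𝕜 := ℝ) (F₁ := E 2) (F₂ := ℝ)
      (E₁ := fun p : S => TangentSpace (𝓡 2) p) (E₂ := fun _ : S => ℝ)
      (b := fun z' : Cotangent S => z'.proj) (ϕ := fun z' => z'.2) (v := fun z' => Y z'.proj) ?_ ?_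
    · exact mdifferentiableAt_id
    · exact MDifferentiableAt.comp z hY (Bundle.mdifferentiableAt_proj _)
  rw [mdifferentiableAt_totalSpace] at h1
  exact h1.2

/-- The function `Y ↦ ξ(ιY) - ω(∇_{π_* ξ} Y)` of a vector field `Y`. -/
def vertForm (nab : CovariantDerivative (𝓡 2) (E 2) (fun p : S => TangentSpace (𝓡 2) p))
    (z : Cotangent S) (ξ : TangentSpace cotModel z) (Y : ∀ p : S, TangentSpace (𝓡 2) p) : ℝ :=
  mvfderiv cotModel (iotaField Y) z ξ - z.2 (nab Y z.proj (dproj z ξ))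

lemma tensorialAt_vertForm
    (nab : CovariantDerivative (𝓡 2) (E 2) (fun p : S => TangentSpace (𝓡 2) p))
    (z : Cotangent S) (ξ : TangentSpace cotModel z) :
    TensorialAt (𝓡 2) (E 2) (vertForm nab z ξ) z.proj := by
  have hπ := Bundle.mdifferentiableAt_proj (IB := 𝓡 2) (F := E 2 →L[ℝ] ℝ)
    (fun p : S => TangentSpace (𝓡 2) p →L[ℝ] ℝ) (p := z)
  constructor
  · intro f σ hf hσ
    have h1 : iotaField (f • σ) = (fun z' : Cotangent S => f z'.proj) * iotaField σ := by
      ext z'; simp [iotaField]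
    have hf' : MDifferentiableAt cotModel 𝓘(ℝ, ℝ) (fun z' : Cotangent S => f z'.proj) z :=
      hf.comp z hπ
    have h2 : mvfderiv cotModel (fun z' : Cotangent S => f z'.proj) z ξ =
        mvfderiv (𝓡 2) f z.proj (dproj z ξ) := mvfderiv_comp_apply z hf hπ ξ
    rw [vertForm, vertForm, h1, mvfderiv_mul hf' (mdifferentiableAt_iotaField hσ),
      nab.isCovariantDerivativeOnUniv.leibniz hσ hf]
    simp only [add_apply, smul_apply, h2, map_add, map_smul, smul_eq_mul,
      ContinuousLinearMap.smulRight_apply, iotaField]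
    ring
  · intro σ τ hσ hτ
    have h1 : iotaField (σ + τ) = iotaField σ + iotaField τ := by
      ext z'; simp [iotaField]
    rw [vertForm, vertForm, vertForm, h1, mvfderiv_add (mdifferentiableAt_iotaField hσ)
      (mdifferentiableAt_iotaField hτ), nab.isCovariantDerivativeOnUniv.add hσ hτ]
    simp only [add_apply, map_add]
    ring

/-- The vector field with constant coordinates `v` in the preferred chart at `p`. -/
def coordField {n : ℕ} {M : Type*} [TopologicalSpace M] [ChartedSpace (E n) M]
    [IsManifold (𝓡 n) ∞ M] (p : M) (v : E n) (q : M) : TangentSpace (𝓡 n) q :=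
  (frame p (extChartAt (𝓡 n) p q) v : E n)

lemma mdifferentiableAt_coordField {p q : S} (hq : q ∈ (extChartAt (𝓡 2) p).source) (v : E 2) :
    MDifferentiableAt (𝓡 2) ((𝓡 2).prod 𝓘(ℝ, E 2))
      (fun p' => (⟨p', coordField p v p'⟩ :
        Bundle.TotalSpace (E 2) (fun p : S => TangentSpace (𝓡 2) p))) q := by
  have : IsManifold (𝓡 2) 1 S := IsManifold.of_le (n := ∞) (by simp)
  have hq' := hq
  rw [extChartAt_source] at hq'
  refine (Bundle.Trivialization.mdifferentiableAt_section_iff (IB := 𝓡 2)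
    (e := trivializationAt (E 2) (TangentSpace (𝓡 2) : S → Type _) p) (s := coordField p v)
    (by simpa using hq')).2 ?_
  refine (mdifferentiableAt_const (c := v)).congr_of_eventuallyEq ?_
  filter_upwards [(isOpen_extChartAt_source p).mem_nhds hq] with x hx
  rw [trivialization_field hx]
  exact mfderiv_chart_frame' hx v

lemma vertPart_eq {z₀ z : Cotangent S} (hz : z ∈ (extChartAt cotModel z₀).source)
    (nab : CovariantDerivative (𝓡 2) (E 2) (fun p : S => TangentSpace (𝓡 2) p))
    (ξ : TangentSpace cotModel z) (v : E 2) :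
    vertPart nab z ξ (coordField z₀.proj v z.proj) = (cotVec z₀ z ξ).2 v -
      z.2 (nab (coordField z₀.proj v) z.proj (dproj z ξ)) := by
  have : IsManifold (𝓡 2) 1 S := IsManifold.of_le (n := ∞) (by simp)
  have hzs := mem_cotangent_source.1 hz
  have h1 : vertPart nab z ξ (coordField z₀.proj v z.proj) =
      vertForm nab z ξ (coordField z₀.proj v) := by
    refine (tensorialAt_vertForm nab z ξ).pointwise (FiberBundle.mdifferentiableAt_extend ..)
      (mdifferentiableAt_coordField hzs v) ?_
    simp
  rw [h1, vertForm]
  congr 1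
  have h2 : iotaField (coordField z₀.proj v) =ᶠ[𝓝 z]
      (fun c : Cot => c.2 v) ∘ extChartAt cotModel z₀ := by
    filter_upwards [(isOpen_extChartAt_source z₀).mem_nhds hz] with z' hz'
    exact (extChartAt_cotangent_snd hz' v).symm
  have hL : HasFDerivAt (fun c : Cot => c.2 v)
      ((ContinuousLinearMap.apply ℝ ℝ v).comp (ContinuousLinearMap.snd ℝ (E 2) (E 2 →L[ℝ] ℝ)))
      (extChartAt cotModel z₀ z) :=
    ((ContinuousLinearMap.apply ℝ ℝ v).comp
      (ContinuousLinearMap.snd ℝ (E 2) (E 2 →L[ℝ] ℝ))).hasFDerivAt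
  have h3 := mfderiv_comp (I := cotModel) (I' := 𝓘(ℝ, Cot)) (I'' := 𝓘(ℝ, ℝ)) z
    hL.differentiableAt.mdifferentiableAt (mdifferentiableAt_extChartAt_cotangent hz)
  rw [← h2.mfderiv_eq, mfderiv_eq_fderiv, hL.fderiv] at h3
  exact congrArg (fun L : Cot →L[ℝ] ℝ => L ξ) h3

end Cotangent

section Cotangent

variable {S : Type} [TopologicalSpace S] [ChartedSpace (E 2) S] [IsManifold (𝓡 2) ∞ S]

/-- The horizontal part of the metric of the cotangent bundle at `z`, in the coordinates induced by
the preferred chart at `p`: the metric is the sum of `2 dxⁱ ∘ dx^{i'}` and this form, evaluated on the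
coordinates `u` and `v` of the projections of two tangent vectors. -/
def SurfaceData.baseForm (d : SurfaceData S) (p : S) (z : Cotangent S) (u v : E 2) : ℝ :=
  z.2 (d.X z.proj) * (z.2 (coordField p u z.proj) * z.2 (coordField p v z.proj)) +
    (1 / 2) * (z.2 (coordField p u z.proj) * z.2 (d.T z.proj (coordField p v z.proj)) +
      z.2 (d.T z.proj (coordField p u z.proj)) * z.2 (coordField p v z.proj)) -
    z.2 (d.nab (coordField p v) z.proj (coordField p u z.proj)) -
    z.2 (d.nab (coordField p u) z.proj (coordField p v z.proj)) +
    d.Phi z.proj (coordField p u z.proj) (coordField p v z.proj)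

lemma dproj_eq_coordField {z₀ z : Cotangent S} (hz : z ∈ (extChartAt cotModel z₀).source)
    (ξ : TangentSpace cotModel z) :
    dproj z ξ = coordField z₀.proj (cotVec z₀ z ξ).1 z.proj := dproj_eq hz ξ

/-- The metric of the cotangent bundle in coordinates has Walker's form. -/
lemma extension_eq (d : SurfaceData S) {z₀ z : Cotangent S}
    (hz : z ∈ (extChartAt cotModel z₀).source) (ξ η : TangentSpace cotModel z) :
    d.extension z ξ η = (cotVec z₀ z ξ).2 (cotVec z₀ z η).1 + (cotVec z₀ z η).2 (cotVec z₀ z ξ).1 +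
      d.baseForm z₀.proj z (cotVec z₀ z ξ).1 (cotVec z₀ z η).1 := by
  rw [SurfaceData.extension, riemannianExtension]
  simp only [symProd, iotaId, iotaEnd, iotaField, ContinuousLinearMap.id_apply]
  rw [dproj_eq_coordField hz ξ, dproj_eq_coordField hz η, vertPart_eq hz, vertPart_eq hz,
    dproj_eq_coordField hz ξ, dproj_eq_coordField hz η, SurfaceData.baseForm]
  ring

lemma snd_eq {z₀ z : Cotangent S} (hz : z ∈ (extChartAt cotModel z₀).source)
    (v : TangentSpace (𝓡 2) z.proj) :
    z.2 v = (extChartAt cotModel z₀ z).2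
      (mfderiv (𝓡 2) (𝓡 2) (extChartAt (𝓡 2) z₀.proj) z.proj v) := by
  refine Eq.trans ?_ (extChartAt_cotangent_snd hz _).symm
  exact (congrArg (fun u : E 2 => (z.2 : E 2 →L[ℝ] ℝ) u)
    (frame_mfderiv_chart' (mem_cotangent_source.1 hz) v)).symm

/-- In coordinates, the quadratic form of the metric on a horizontal vector `v` is a cubic
polynomial in the fibre coordinate `ω`, whose part of degree at least two is divisible by `ω(v)`. -/
lemma exists_baseForm_self (d : SurfaceData S) (p : S) (v : E 2) :
    ∃ (X T G : E 2 → E 2) (P : E 2 → ℝ), ∀ z₀ z : Cotangent S, z₀.proj = p →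
      z ∈ (extChartAt cotModel z₀).source → ∀ c, extChartAt cotModel z₀ z = c →
      d.baseForm p z v v = c.2 (X c.1) * (c.2 v) ^ 2 + c.2 v * c.2 (T c.1) - 2 * c.2 (G c.1) +
        P c.1 := by
  let ψ := extChartAt (𝓡 2) p
  refine ⟨fun x => mfderiv (𝓡 2) (𝓡 2) ψ (ψ.symm x) (d.X (ψ.symm x)),
    fun x => mfderiv (𝓡 2) (𝓡 2) ψ (ψ.symm x) (d.T (ψ.symm x) (coordField p v (ψ.symm x))),
    fun x => mfderiv (𝓡 2) (𝓡 2) ψ (ψ.symm x)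
      (d.nab (coordField p v) (ψ.symm x) (coordField p v (ψ.symm x))),
    fun x => d.Phi (ψ.symm x) (coordField p v (ψ.symm x)) (coordField p v (ψ.symm x)), ?_⟩
  rintro z₀ z rfl hz c rfl
  have h1 : ψ.symm (extChartAt cotModel z₀ z).1 = z.proj :=
    (extChartAt (𝓡 2) z₀.proj).left_inv (mem_cotangent_source.1 hz)
  have h2 : z.2 (coordField z₀.proj v z.proj) = (extChartAt cotModel z₀ z).2 v :=
    (extChartAt_cotangent_snd hz v).symm
  have h3 : ∀ Y : ∀ q : S, TangentSpace (𝓡 2) q, ∀ q, q = z.proj →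
      z.2 (Y z.proj) = (extChartAt cotModel z₀ z).2 (mfderiv (𝓡 2) (𝓡 2) ψ q (Y q)) := by
    rintro Y q rfl
    exact snd_eq hz _
  have h4 : ∀ f : S → ℝ, f (ψ.symm (extChartAt cotModel z₀ z).1) = f z.proj :=
    fun f => congrArg f h1
  have e1 := h3 d.X _ h1
  have e2 := h3 (fun q => d.T q (coordField z₀.proj v q)) _ h1
  have e3 := h3 (fun q => d.nab (coordField z₀.proj v) q (coordField z₀.proj v q)) _ h1
  have e4 := h4 fun q => d.Phi q (coordField z₀.proj v q) (coordField z₀.proj v q)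
  rw [SurfaceData.baseForm, h2, e1, e2, e3, ← e4]
  ring

end Cotangent

/-- A `C²` function that agrees near `a` with a function which is affine on the lines in the
direction `v` has vanishing second derivative in that direction. -/
lemma fderiv_fderiv_eq_zero {A : Type*} [NormedAddCommGroup A] [NormedSpace ℝ A] {F : A → ℝ} {a v : A}
    (hF : ContDiffAt ℝ 2 F a) {G L : A → ℝ} (hFG : F =ᶠ[𝓝 a] G)
    (hG : ∀ y, ∀ t : ℝ, G (y + t • v) = G y + t * L y) :
    fderiv ℝ (fun y => fderiv ℝ F y v) a v = 0 := by
  have h1 : ∀ᶠ y in 𝓝 a, fderiv ℝ F y v = L y := by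
    filter_upwards [hF.eventually (by simp), hFG.eventuallyEq_nhds] with y hy hy'
    rw [hy'.fderiv_eq]
    have hd : DifferentiableAt ℝ G y := (hy.differentiableAt (by simp)).congr_of_eventuallyEq hy'.symm
    have h2 : HasDerivAt (fun t : ℝ => G (y + t • v)) (fderiv ℝ G y v) 0 := by
      have : HasFDerivAt G (fderiv ℝ G y) (y + (0 : ℝ) • v) := by simpa using hd.hasFDerivAt
      refine this.comp_hasDerivAt (0 : ℝ) ?_
      simpa using ((hasDerivAt_id (0 : ℝ)).smul_const v).const_add y
    have h3 : HasDerivAt (fun t : ℝ => G (y + t • v)) (L y) 0 := by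
      simp only [hG]
      simpa using ((hasDerivAt_id (0 : ℝ)).mul_const (L y)).const_add (G y)
    exact h2.unique h3
  have hd : DifferentiableAt ℝ (fun y => fderiv ℝ F y v) a :=
    ((hF.fderiv_right (m := 1) (by norm_num)).differentiableAt (by simp)).clm_apply
      (differentiableAt_const v)
  have hL : ∀ y, ∀ t : ℝ, L (y + t • v) = L y := by
    intro y t
    have e1 := hG (y + t • v) 1
    rw [add_assoc, ← add_smul, hG y, hG y] at e1
    linarith
  have h2 : HasDerivAt (fun t : ℝ => fderiv ℝ F (a + t • v) v)
      (fderiv ℝ (fun y => fderiv ℝ F y v) a v) 0 := by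
    have : HasFDerivAt (fun y => fderiv ℝ F y v) (fderiv ℝ (fun y => fderiv ℝ F y v) a)
        (a + (0 : ℝ) • v) := by simpa using hd.hasFDerivAt
    refine HasFDerivAt.comp_hasDerivAt (f := fun t : ℝ => a + t • v) (0 : ℝ) this ?_
    simpa using ((hasDerivAt_id (0 : ℝ)).smul_const v).const_add a
  have h3 : HasDerivAt (fun t : ℝ => fderiv ℝ F (a + t • v) v) 0 0 := by
    refine (hasDerivAt_const (0 : ℝ) (L a)).congr_of_eventuallyEq ?_
    have hc : Tendsto (fun t : ℝ => a + t • v) (𝓝 0) (𝓝 a) := by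
      have : Continuous fun t : ℝ => a + t • v := by fun_prop
      simpa using this.tendsto 0
    filter_upwards [hc.eventually h1] with t ht
    rw [ht, hL]
  exact h2.unique h3

/-! ### Self-duality of the metrics on cotangent bundles -/

lemma finrank_dual_plane : Module.finrank ℝ (E 2 →L[ℝ] ℝ) = 2 := by
  rw [← (LinearMap.toContinuousLinearMap (𝕜 := ℝ) (E := E 2) (F' := ℝ)).finrank_eq]
  simp

lemma finrank_cot : Module.finrank ℝ Cot = Module.finrank ℝ (E 4) := by
  rw [Module.finrank_prod, finrank_dual_plane]
  simp

section Cotangent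

variable {S : Type} [TopologicalSpace S] [ChartedSpace (E 2) S] [IsManifold (𝓡 2) ∞ S]
  {N : Type*} [TopologicalSpace N] [ChartedSpace (E 4) N] [IsManifold (𝓡 4) ∞ N]

lemma cotVec_injective {z₀ z : Cotangent S} (hz : z ∈ (extChartAt cotModel z₀).source) :
    Function.Injective (cotVec z₀ z) := by
  have : IsManifold cotModel 1 (Cotangent S) := IsManifold.of_le (n := ∞) (by simp)
  exact (isInvertible_mfderiv_extChartAt (I := cotModel) hz).bijective.injective

/-- A local diffeomorphism to the cotangent bundle of a surface, in coordinates. -/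
lemma exists_coordinate_expression {f : N → Cotangent S} {p : N}
    (hf : IsLocalDiffeomorphAt (𝓡 4) cotModel ∞ f p) :
    ∃ κ : OpenPartialHomeomorph (E 4) Cot, IsDiffeo κ ∧ extChartAt (𝓡 4) p p ∈ κ.source ∧
      ∀ y ∈ κ.source, y ∈ (extChartAt (𝓡 4) p).target ∧
        f ((extChartAt (𝓡 4) p).symm y) ∈ (extChartAt cotModel (f p)).source ∧
        κ y = extChartAt cotModel (f p) (f ((extChartAt (𝓡 4) p).symm y)) ∧
        ∀ v : E 4, fderiv ℝ κ y v = cotVec (f p) (f ((extChartAt (𝓡 4) p).symm y))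
          (mfderiv (𝓡 4) cotModel f ((extChartAt (𝓡 4) p).symm y) (frame p y v)) := by
  obtain ⟨Φ, hpΦ, hfΦ⟩ := hf
  have hloc : ∀ q ∈ Φ.source, IsLocalDiffeomorphAt (𝓡 4) cotModel ∞ f q :=
    fun q hq => ⟨Φ, hq, hfΦ⟩
  have hfc : ContinuousOn f Φ.source := fun q hq =>
    (hloc q hq).contMDiffAt.continuousAt.continuousWithinAt
  have : IsManifold (𝓡 4) 1 N := IsManifold.of_le (n := ∞) (by simp)
  set ψ := extChartAt (𝓡 4) p with hψ
  set W := Φ.source ∩ f ⁻¹' (extChartAt cotModel (f p)).source with hWdef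
  have hW : IsOpen W := hfc.isOpen_inter_preimage Φ.open_source (isOpen_extChartAt_source _)
  set U := ψ.target ∩ ψ.symm ⁻¹' W with hUdef
  have hU : IsOpen U := (continuousOn_extChartAt_symm p).isOpen_inter_preimage
    (isOpen_extChartAt_target p) hW
  have hpinv : ψ.symm (ψ p) = p := extChartAt_to_inv p
  have hpU : ψ p ∈ U := by
    refine ⟨mem_extChartAt_target p, ?_⟩
    rw [mem_preimage, hpinv]
    exact ⟨hpΦ, mem_extChartAt_source (f p)⟩
  let K : E 4 → Cot := fun y => extChartAt cotModel (f p) (f (ψ.symm y))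
  have hKd : ∀ y ∈ U, ContDiffAt ℝ ∞ K y := by
    intro y hy
    have h1 := contMDiffAt_chartSymm hy.1
    have h2 := (hloc _ hy.2.1).contMDiffAt
    have h3 : ContMDiffAt cotModel 𝓘(ℝ, Cot) ∞ (extChartAt cotModel (f p)) (f (ψ.symm y)) :=
      contMDiffAt_extChartAt' (by rw [← extChartAt_source (I := cotModel)]; exact hy.2.2)
    exact ((h3.comp _ h2).comp y h1).contDiffAt
  have hKv : ∀ y ∈ U, ∀ v : E 4, fderiv ℝ K y v = cotVec (f p) (f (ψ.symm y))
      (mfderiv (𝓡 4) cotModel f (ψ.symm y) (frame p y v)) := by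
    intro y hy v
    have h1 := (contMDiffAt_chartSymm hy.1).mdifferentiableAt (by simp)
    have h2 := (hloc _ hy.2.1).mdifferentiableAt (by simp)
    have h4 := mfderiv_comp (I := 𝓡 4) (I' := 𝓡 4) (I'' := cotModel) y (g := f) (f := ψ.symm) h2 h1
    have h5 := mfderiv_comp (I := 𝓡 4) (I' := cotModel) (I'' := 𝓘(ℝ, Cot)) y
      (g := extChartAt cotModel (f p)) (f := f ∘ ψ.symm)
      (mdifferentiableAt_extChartAt_cotangent hy.2.2) (h2.comp y h1)
    rw [h4] at h5
    have h6 : mfderiv (𝓡 4) 𝓘(ℝ, Cot) (extChartAt cotModel (f p) ∘ (f ∘ ψ.symm)) y =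
      fderiv ℝ K y := mfderiv_eq_fderiv
    rw [h6] at h5
    exact congrArg (fun L : E 4 →L[ℝ] Cot => L v) h5
  have hinv : (fderiv ℝ K (ψ p)).IsInvertible := by
    refine isInvertible_of_injective ?_ finrank_cot.symm
    intro v w hvw
    rw [hKv _ hpU, hKv _ hpU] at hvw
    have h1 := cotVec_injective hpU.2.2 hvw
    have h2 := ((hloc _ hpU.2.1).mfderivToContinuousLinearEquiv (by simp)).injective h1
    exact (frame_isInvertible hpU.1).bijective.injective h2
  obtain ⟨κ, h0, hκU, hκK, -, hκs⟩ := exists_smooth_inverse hU hpU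
    (fun y hy => (hKd y hy).contDiffWithinAt) hinv
  have hκ' : ⇑κ = K := funext hκK
  refine ⟨κ, ⟨?_, hκs⟩, h0, fun y hy => ⟨(hκU hy).1, (hκU hy).2.2, hκK y, ?_⟩⟩
  · rw [hκ']
    exact fun y hy => (hKd y (hκU hy)).contDiffWithinAt
  · rw [hκ']
    exact hKv y (hκU hy)

/-- An isometry onto an open part of the cotangent bundle of a surface that preserves the canonical
orientations exists only if the Walker metric is self-dual. -/
theorem weylMinus_eq_zero_of_isometry {g : Metric N} (D : WalkerDistribution g) (d : SurfaceData S)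
    {f : N → Cotangent S} {p : N} (hf : IsLocalIsometryAt g d f p)
    (ho : PreservesOrientationAt D d f p) (b : Module.Basis (Fin 4) ℝ (TangentSpace (𝓡 4) p))
    (hb : IsAdapted (fun x y => g.val p x y) (D.plane p) b) (u v w z : TangentSpace (𝓡 4) p) :
    g.weylMinus p b u v w z = 0 := by
  obtain ⟨κ, hκ, h0, hκs⟩ := exists_coordinate_expression hf.1
  set ψ := extChartAt (𝓡 4) p with hψ
  set y₀ := ψ p with hy₀
  have hpinv : ψ.symm y₀ = p := extChartAt_to_inv p
  -- the metric in the coordinates of the cotangent bundle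
  let h := pull κ.symm (g.inChart p)
  let Q : Cot → E 2 →L[ℝ] E 2 →L[ℝ] ℝ := horizontal h
  have haT : κ y₀ ∈ κ.symm.source := κ.map_source h0
  have hinv : κ.symm (κ y₀) = y₀ := κ.left_inv h0
  have hform : ∀ᶠ y in 𝓝 y₀, ∀ a b : Cot, h (κ y) a b = a.2 b.1 + b.2 a.1 +
      d.baseForm (f p).proj (f (ψ.symm y)) a.1 b.1 := by
    have hc : Tendsto ψ.symm (𝓝 y₀) (𝓝 p) := by
      have := continuousAt_extChartAt_symm (I := 𝓡 4) p
      rwa [ContinuousAt, hpinv] at this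
    filter_upwards [κ.open_source.mem_nhds h0, hc.eventually hf.2] with y hy hiso a b
    obtain ⟨hyt, hys, hyκ, hyd⟩ := hκs y hy
    have e1 : ∀ a : Cot, cotVec (f p) (f (ψ.symm y)) (mfderiv (𝓡 4) cotModel f (ψ.symm y)
        (frame p y (fderiv ℝ κ.symm (κ y) a))) = a := by
      intro a
      rw [← hyd]
      have := hκ.fderiv_fderiv_symm (κ.map_source hy) a
      rwa [κ.left_inv hy] at this
    have e2 : h (κ y) a b = g.val (ψ.symm y) (frame p y (fderiv ℝ κ.symm (κ y) a))
        (frame p y (fderiv ℝ κ.symm (κ y) b)) := by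
      rw [pull_apply, κ.left_inv hy, inChart_apply]
    refine e2.trans ((hiso _ _).symm.trans ((extension_eq d hys _ _).trans ?_))
    rw [e1, e1]
  have hform' : ∀ᶠ c in 𝓝 (κ y₀), c ∈ κ.target ∧ ∀ a b : Cot, h c a b = a.2 b.1 + b.2 a.1 +
      d.baseForm (f p).proj (f (ψ.symm (κ.symm c))) a.1 b.1 := by
    have hc : Tendsto κ.symm (𝓝 (κ y₀)) (𝓝 y₀) := by
      have := (hκ.symm.differentiableAt haT).continuousAt
      rwa [ContinuousAt, hinv] at this
    filter_upwards [κ.open_target.mem_nhds haT, hc.eventually hform] with c hc h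
    rw [κ.right_inv hc] at h
    exact ⟨hc, h⟩
  have H : IsPullbackAt κ.symm h (g.inChart p) (κ y₀) :=
    hκ.symm.isPullbackAt_pull haT (by
      rw [hinv]; exact isMetricAt_inChart g (mem_extChartAt_target p))
  have hW : IsWalkerFormAt h Q (κ y₀) := by
    refine ⟨H.isMetricAt, ?_⟩
    filter_upwards [hform'] with c hc a b
    have e : Q c a.1 b.1 = h c (a.1, 0) (b.1, 0) := rfl
    rw [e, hc.2, hc.2]
    simp
  obtain ⟨B, hB1, hB2, hB3⟩ := weylMinus_iff_of_walkerForm H hinv hW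
  -- the frame `B` is mapped to an adapted frame of the cotangent bundle
  let L := (hf.1.mfderivToContinuousLinearEquiv (by simp)).toLinearEquiv
  have hL : ∀ x, L x = mfderiv (𝓡 4) cotModel f p x := fun x => rfl
  have hval : ∀ i j, d.extension (f p) (B.map L i) (B.map L j) = if j = i + 2 then 1 else 0 := by
    intro i j
    rw [← hB1 i j, ← hf.2.self_of_nhds]
    rfl
  have hvert : ∀ i : Fin 4, 2 ≤ i → B.map L i ∈ vertical (f p) := by
    intro i hi
    have e1 : cotVec (f p) (f p) (B.map L i) = walkerFrame (Q (κ y₀)) i := by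
      obtain ⟨hyt, hys, hyκ, hyd⟩ := hκs y₀ h0
      have e2 := hyd (fderiv ℝ κ.symm (κ y₀) (walkerFrame (Q (κ y₀)) i))
      rw [frame_self] at e2
      have e3 := hκ.fderiv_fderiv_symm haT (walkerFrame (Q (κ y₀)) i)
      rw [hinv] at e3
      rw [e3] at e2
      have e4 : ∀ q : N, q = p → ∀ x : E 4, cotVec (f p) (f q) (mfderiv (𝓡 4) cotModel f q x) =
        cotVec (f p) (f p) (mfderiv (𝓡 4) cotModel f p x) := by rintro q rfl x; rfl
      refine Eq.trans ?_ ((e4 _ hpinv _).symm.trans e2.symm)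
      rw [Module.Basis.map_apply, hB2 i]
      rfl
    have e2 : dproj (f p) (B.map L i) = 0 := by
      rw [dproj_eq (mem_extChartAt_source (I := cotModel) (f p)), e1]
      fin_cases i <;> first | (exact absurd hi (by decide)) | exact map_zero _
    exact e2
  have hB' : IsAdapted (d.extension (f p)) (vertical (f p)) (B.map L) :=
    ⟨hvert 2 (by decide), hvert 3 (by decide), by rw [hval]; rfl, by rw [hval]; rfl,
      by rw [hval]; rfl, by rw [hval]; rfl⟩
  have hdet := ho.self_of_nhds b (B.map L) hb hB'
  have hdet' : 0 < B.det b := by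
    rw [Module.Basis.det_map] at hdet
    convert hdet using 2
    ext i
    exact (L.symm_apply_apply (b i)).symm
  rw [← weylMinus_congr g p B b hdet']
  refine hB3.2 (fun s t => ?_) u v w z
  obtain ⟨X, T, G, P, hXTGP⟩ := exists_baseForm_self d (f p).proj (s • vec 0 + t • vec 1)
  have hβ : (t • cov 0 - s • cov 1) (s • vec 0 + t • vec 1) = 0 := by
    simp [cov, vec, mul_comm]
  have hQ : ContDiffAt ℝ 2 (fun y' => Q y' (s • vec 0 + t • vec 1) (s • vec 0 + t • vec 1)) (κ y₀) :=
    (hW.metric.contDiffAt.clm_apply contDiffAt_const).clm_apply contDiffAt_const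
  refine fderiv_fderiv_eq_zero hQ (G := fun c => c.2 (X c.1) * (c.2 (s • vec 0 + t • vec 1)) ^ 2 +
    c.2 (s • vec 0 + t • vec 1) * c.2 (T c.1) - 2 * c.2 (G c.1) + P c.1)
    (L := fun c => (t • cov 0 - s • cov 1) (X c.1) * (c.2 (s • vec 0 + t • vec 1)) ^ 2 +
      c.2 (s • vec 0 + t • vec 1) * (t • cov 0 - s • cov 1) (T c.1) -
      2 * (t • cov 0 - s • cov 1) (G c.1)) ?_ ?_
  · filter_upwards [hform'] with c hc
    have hys := hκs _ (κ.map_target hc.1)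
    have e : Q c (s • vec 0 + t • vec 1) (s • vec 0 + t • vec 1) =
      h c (s • vec 0 + t • vec 1, 0) (s • vec 0 + t • vec 1, 0) := rfl
    rw [e, hc.2, ← hXTGP (f p) _ rfl hys.2.1 c (hys.2.2.1.symm.trans (κ.right_inv hc.1))]
    simp
  · intro c r
    simp only [Prod.fst_add, Prod.snd_add, Prod.smul_fst, Prod.smul_snd, smul_zero, add_zero,
      add_apply, smul_apply, hβ]
    simp only [smul_eq_mul]
    ring

end Cotangent

/-! ### Metrics whose restriction to the fibres is cubic -/

section FibreDerivatives

/-- The derivative of a function of `(x, ω)` in the direction `β` of the fibre. -/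
def vd (β : E 2 →L[ℝ] ℝ) (F : Cot → ℝ) (c : Cot) : ℝ := fderiv ℝ F c (0, β)

variable {Ω : Set Cot} {F G H : Cot → ℝ}

lemma vd_comb (s t : ℝ) (β γ : E 2 →L[ℝ] ℝ) (F : Cot → ℝ) (c : Cot) :
    vd (s • β + t • γ) F c = s * vd β F c + t * vd γ F c := by
  have : ((0 : E 2), s • β + t • γ) = s • ((0 : E 2), β) + t • ((0 : E 2), γ) := by simp
  rw [vd, this, map_add, map_smul, map_smul]
  rfl

lemma contDiffOn_vd (hΩ : IsOpen Ω) (hF : ContDiffOn ℝ ∞ F Ω) (β : E 2 →L[ℝ] ℝ) :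
    ContDiffOn ℝ ∞ (vd β F) Ω :=
  (hF.fderiv_of_isOpen hΩ (by simp)).clm_apply contDiffOn_const

lemma differentiableAt_of_contDiffOn (hΩ : IsOpen Ω) (hF : ContDiffOn ℝ ∞ F Ω) {c : Cot}
    (hc : c ∈ Ω) : DifferentiableAt ℝ F c :=
  (hF.contDiffAt (hΩ.mem_nhds hc)).differentiableAt (by simp)

lemma vd_congr (hΩ : IsOpen Ω) (h : EqOn F G Ω) (β : E 2 →L[ℝ] ℝ) : EqOn (vd β F) (vd β G) Ω := by
  intro c hc
  have : F =ᶠ[𝓝 c] G := by filter_upwards [hΩ.mem_nhds hc] with y hy using h hy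
  rw [vd, vd, this.fderiv_eq]

lemma vd_zero (hΩ : IsOpen Ω) (h : ∀ c ∈ Ω, F c = 0) (β : E 2 →L[ℝ] ℝ) : ∀ c ∈ Ω, vd β F c = 0 := by
  intro c hc
  rw [vd_congr hΩ (G := fun _ => 0) h β hc]
  simp [vd]

lemma vd_comm (hΩ : IsOpen Ω) (hF : ContDiffOn ℝ ∞ F Ω) (β γ : E 2 →L[ℝ] ℝ) :
    EqOn (vd β (vd γ F)) (vd γ (vd β F)) Ω := by
  intro c hc
  have hF' := hF.contDiffAt (hΩ.mem_nhds hc)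
  have hd : DifferentiableAt ℝ (fderiv ℝ F) c :=
    (hF'.fderiv_right (m := 1) (by exact WithTop.coe_le_coe.2 le_top)).differentiableAt (by simp)
  have h : ∀ β γ : E 2 →L[ℝ] ℝ, vd β (vd γ F) c = fderiv ℝ (fderiv ℝ F) c (0, β) (0, γ) := by
    intro β γ
    have := (hd.hasFDerivAt.clm_apply (hasFDerivAt_const ((0 : E 2), γ) c)).fderiv
    have h2 := congrArg (fun L : Cot →L[ℝ] ℝ => L (0, β)) this
    refine h2.trans ?_
    simp
  rw [h, h]
  exact hF'.isSymmSndFDerivAt (by simp; exact WithTop.coe_le_coe.2 le_top) _ _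

lemma vd_lin (hΩ : IsOpen Ω) (hF : ContDiffOn ℝ ∞ F Ω) (hG : ContDiffOn ℝ ∞ G Ω)
    (β : E 2 →L[ℝ] ℝ) (k l : ℝ) :
    EqOn (vd β (fun c => k * F c + l * G c)) (fun c => k * vd β F c + l * vd β G c) Ω := by
  intro c hc
  have h1 := ((differentiableAt_of_contDiffOn hΩ hF hc).hasFDerivAt.const_mul k).add
    ((differentiableAt_of_contDiffOn hΩ hG hc).hasFDerivAt.const_mul l)
  have h2 := congrArg (fun L : Cot →L[ℝ] ℝ => L (0, β)) h1.fderiv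
  refine h2.trans ?_
  simp [vd]

lemma vd_vd_comb (hΩ : IsOpen Ω) (hF : ContDiffOn ℝ ∞ F Ω) (s t : ℝ) (β γ : E 2 →L[ℝ] ℝ) :
    EqOn (vd (s • β + t • γ) (vd (s • β + t • γ) F)) (fun c => s ^ 2 * vd β (vd β F) c +
      2 * s * t * vd β (vd γ F) c + t ^ 2 * vd γ (vd γ F) c) Ω := by
  intro c hc
  have h : vd (s • β + t • γ) F = fun c => s * vd β F c + t * vd γ F c :=
    funext (vd_comb s t β γ F)
  have hβ := contDiffOn_vd hΩ hF β
  have hγ := contDiffOn_vd hΩ hF γ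
  rw [vd_comb, h, vd_lin hΩ hβ hγ β s t hc, vd_lin hΩ hβ hγ γ s t hc]
  beta_reduce
  rw [vd_comm hΩ hF γ β hc]
  ring

lemma vd_vd_vd_comb (hΩ : IsOpen Ω) (hF : ContDiffOn ℝ ∞ F Ω) (s t : ℝ) (β γ : E 2 →L[ℝ] ℝ) :
    EqOn (vd (s • β + t • γ) (vd (s • β + t • γ) (vd (s • β + t • γ) F)))
      (fun c => s ^ 3 * vd β (vd β (vd β F)) c + 3 * s ^ 2 * t * vd β (vd β (vd γ F)) c +
      3 * s * t ^ 2 * vd β (vd γ (vd γ F)) c + t ^ 3 * vd γ (vd γ (vd γ F)) c) Ω := by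
  intro c hc
  have h : vd (s • β + t • γ) F = fun c => s * vd β F c + t * vd γ F c :=
    funext (vd_comb s t β γ F)
  have hβ := contDiffOn_vd hΩ hF β
  have hγ := contDiffOn_vd hΩ hF γ
  have hD : ContDiffOn ℝ ∞ (vd (s • β + t • γ) F) Ω := contDiffOn_vd hΩ hF _
  have e1 : ∀ δ ε : E 2 →L[ℝ] ℝ, EqOn (vd δ (vd ε (vd (s • β + t • γ) F)))
      (fun c => s * vd δ (vd ε (vd β F)) c + t * vd δ (vd ε (vd γ F)) c) Ω := by
    intro δ ε c hc
    rw [h, vd_congr hΩ (vd_lin hΩ hβ hγ ε s t) δ hc,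
      vd_lin hΩ (contDiffOn_vd hΩ hβ ε) (contDiffOn_vd hΩ hγ ε) δ s t hc]
  rw [vd_vd_comb hΩ hD s t β γ hc]
  beta_reduce
  rw [e1 _ _ hc, e1 _ _ hc, e1 _ _ hc]
  beta_reduce
  rw [vd_congr hΩ (vd_comm hΩ hF γ β) β hc, vd_congr hΩ (vd_comm hΩ hF γ β) γ hc,
    vd_comm hΩ hγ γ β hc]
  ring

/-- Taylor's formula on the fibres, for a function whose third derivative along the fibre is
constant. -/
lemma taylor_fibre (hΩ : IsOpen Ω) (hF : ContDiffOn ℝ ∞ F Ω) {x : E 2} {w : E 2 →L[ℝ] ℝ}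
    (hw : ∀ t ∈ Icc (0 : ℝ) 1, (x, t • w) ∈ Ω) {K : ℝ}
    (hK : ∀ t ∈ Icc (0 : ℝ) 1, vd w (vd w (vd w F)) (x, t • w) = K) :
    F (x, w) = F (x, 0) + vd w F (x, 0) + (1 / 2) * vd w (vd w F) (x, 0) + (1 / 6) * K := by
  have hder : ∀ G : Cot → ℝ, ContDiffOn ℝ ∞ G Ω → ∀ t ∈ Icc (0 : ℝ) 1,
      HasDerivAt (fun t : ℝ => G (x, t • w)) (vd w G (x, t • w)) t := by
    intro G hG t ht
    have h1 := (differentiableAt_of_contDiffOn hΩ hG (hw t ht)).hasFDerivAt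
    refine HasFDerivAt.comp_hasDerivAt (f := fun t : ℝ => ((x, t • w) : Cot)) t h1 ?_
    refine (hasDerivAt_const t x).prodMk ?_
    simpa using (hasDerivAt_id t).smul_const w
  have huniq : ∀ f g f' : ℝ → ℝ, (∀ t ∈ Icc (0 : ℝ) 1, HasDerivAt f (f' t) t) →
      (∀ t ∈ Icc (0 : ℝ) 1, HasDerivAt g (f' t) t) → f 0 = g 0 → ∀ t ∈ Icc (0 : ℝ) 1, f t = g t := by
    intro f g f' hf hg h0
    exact eq_of_has_deriv_right_eq (f' := f')
      (fun t ht => (hf t ⟨ht.1, ht.2.le⟩).hasDerivWithinAt)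
      (fun t ht => (hg t ⟨ht.1, ht.2.le⟩).hasDerivWithinAt)
      (fun t ht => (hf t ht).continuousAt.continuousWithinAt)
      (fun t ht => (hg t ht).continuousAt.continuousWithinAt) h0
  have hF1 := contDiffOn_vd hΩ hF w
  have hF2 := contDiffOn_vd hΩ hF1 w
  have e2 := huniq (fun t => vd w (vd w F) (x, t • w)) (fun t => vd w (vd w F) (x, 0) + K * t) _
    (hder _ hF2) (fun t ht => by
      rw [hK t ht]
      simpa using ((hasDerivAt_id t).const_mul K).const_add (vd w (vd w F) (x, 0))) (by simp)
  have e1 := huniq (fun t => vd w F (x, t • w))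
    (fun t => vd w F (x, 0) + vd w (vd w F) (x, 0) * t + (1 / 2) * K * t ^ 2) _
    (hder _ hF1) (fun t ht => by
      rw [e2 t ht]
      have := (((hasDerivAt_id t).const_mul (vd w (vd w F) (x, 0))).const_add (vd w F (x, 0))).add
        ((hasDerivAt_pow 2 t).const_mul ((1 / 2) * K))
      refine this.congr_deriv ?_
      simp; ring) (by simp)
  have e0 := huniq (fun t => F (x, t • w))
    (fun t => F (x, 0) + vd w F (x, 0) * t + (1 / 2) * vd w (vd w F) (x, 0) * t ^ 2 +
      (1 / 6) * K * t ^ 3) _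
    (hder _ hF) (fun t ht => by
      rw [e1 t ht]
      have := ((((hasDerivAt_id t).const_mul (vd w F (x, 0))).const_add (F (x, 0))).add
        ((hasDerivAt_pow 2 t).const_mul ((1 / 2) * vd w (vd w F) (x, 0)))).add
        ((hasDerivAt_pow 3 t).const_mul ((1 / 6) * K))
      refine this.congr_deriv ?_
      simp; ring) (by simp)
  simpa using e0 1 (by simp)

/-- A function with vanishing derivatives along the fibres is constant on the rays of the fibres. -/
lemma eq_zero_section (hΩ : IsOpen Ω) (hF : ContDiffOn ℝ ∞ F Ω) {x : E 2} {w : E 2 →L[ℝ] ℝ}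
    (hw : ∀ t ∈ Icc (0 : ℝ) 1, (x, t • w) ∈ Ω) (h : ∀ β, ∀ c ∈ Ω, vd β F c = 0) :
    F (x, w) = F (x, 0) := by
  have h2 := vd_zero hΩ (h w) w
  have h0 : ((x, 0) : Cot) ∈ Ω := by simpa using hw 0 (by simp)
  rw [taylor_fibre hΩ hF hw (K := 0) fun t ht => vd_zero hΩ h2 w _ (hw t ht), h w _ h0, h2 _ h0]
  ring

end FibreDerivatives

lemma vector_eq (v : E 2) : v = v 0 • vec 0 + v 1 • vec 1 := by
  ext i; fin_cases i <;> simp [vec]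

lemma covector_eq (w : E 2 →L[ℝ] ℝ) : w = w (vec 0) • cov 0 + w (vec 1) • cov 1 := by
  ext v
  conv_lhs => rw [vector_eq v]
  simp [cov]
  ring

/-- The functions `a`, `c`, `b` are the components of a field of quadratic forms
`Q(v) = a v₀² + 2 c v₀ v₁ + b v₁²` such that `Q(v)` has vanishing second derivative along the fibre in
each direction `β` with `β(v) = 0`. -/
structure IsFibreSystem (a c b : Cot → ℝ) (Ω : Set Cot) : Prop where
  isOpen : IsOpen Ω
  smooth_a : ContDiffOn ℝ ∞ a Ω
  smooth_c : ContDiffOn ℝ ∞ c Ω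
  smooth_b : ContDiffOn ℝ ∞ b Ω
  eq : ∀ s t : ℝ, ∀ y ∈ Ω, vd (t • cov 0 + (-s) • cov 1) (vd (t • cov 0 + (-s) • cov 1)
    (fun y => s ^ 2 * a y + 2 * s * t * c y + t ^ 2 * b y)) y = 0

namespace IsFibreSystem

variable {a c b : Cot → ℝ} {Ω : Set Cot}

/-- The fibre equation, expanded as a quartic form in the direction `(s, t)`. -/
lemma expand (H : IsFibreSystem a c b Ω) (s t : ℝ) {y : Cot} (hy : y ∈ Ω) :
    s ^ 2 * (t ^ 2 * vd (cov 0) (vd (cov 0) a) y - 2 * s * t * vd (cov 0) (vd (cov 1) a) y +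
        s ^ 2 * vd (cov 1) (vd (cov 1) a) y) +
      2 * s * t * (t ^ 2 * vd (cov 0) (vd (cov 0) c) y - 2 * s * t * vd (cov 0) (vd (cov 1) c) y +
        s ^ 2 * vd (cov 1) (vd (cov 1) c) y) +
      t ^ 2 * (t ^ 2 * vd (cov 0) (vd (cov 0) b) y - 2 * s * t * vd (cov 0) (vd (cov 1) b) y +
        s ^ 2 * vd (cov 1) (vd (cov 1) b) y) = 0 := by
  have hΩ := H.isOpen
  have h := H.eq s t y hy
  set β : E 2 →L[ℝ] ℝ := t • cov 0 + (-s) • cov 1 with hβ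
  have hac : ContDiffOn ℝ ∞ (fun y => s ^ 2 * a y + 2 * s * t * c y) Ω :=
    (contDiffOn_const.mul H.smooth_a).add (contDiffOn_const.mul H.smooth_c)
  have e1 : EqOn (vd β (fun y => s ^ 2 * a y + 2 * s * t * c y + t ^ 2 * b y))
      (fun y => 1 * vd β (fun y => s ^ 2 * a y + 2 * s * t * c y) y + t ^ 2 * vd β b y) Ω := by
    have := vd_lin hΩ hac H.smooth_b β 1 (t ^ 2)
    simpa only [one_mul] using this
  have e2 := vd_lin hΩ H.smooth_a H.smooth_c β (s ^ 2) (2 * s * t)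
  have ha := contDiffOn_vd hΩ H.smooth_a β
  have hb := contDiffOn_vd hΩ H.smooth_b β
  have hc := contDiffOn_vd hΩ H.smooth_c β
  rw [vd_congr hΩ e1 β hy, vd_lin hΩ (contDiffOn_vd hΩ hac β) hb β 1 (t ^ 2) hy] at h
  beta_reduce at h
  rw [vd_congr hΩ e2 β hy, vd_lin hΩ ha hc β (s ^ 2) (2 * s * t) hy] at h
  beta_reduce at h
  rw [hβ, vd_vd_comb hΩ H.smooth_a t (-s) _ _ hy, vd_vd_comb hΩ H.smooth_b t (-s) _ _ hy,
    vd_vd_comb hΩ H.smooth_c t (-s) _ _ hy] at h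
  linear_combination h

/-- The second order differential equations satisfied by the components. -/
lemma second_order (H : IsFibreSystem a c b Ω) {y : Cot} (hy : y ∈ Ω) :
    vd (cov 1) (vd (cov 1) a) y = 0 ∧ vd (cov 0) (vd (cov 0) b) y = 0 ∧
    vd (cov 1) (vd (cov 1) c) y = vd (cov 0) (vd (cov 1) a) y ∧
    vd (cov 0) (vd (cov 0) c) y = vd (cov 0) (vd (cov 1) b) y ∧
    vd (cov 1) (vd (cov 1) b) y =
      4 * vd (cov 0) (vd (cov 1) c) y + (-1) * vd (cov 0) (vd (cov 0) a) y := by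
  -- the five coefficients of a quartic form in `(s, t)`
  have h1 := H.expand 1 0 hy
  have h2 := H.expand 0 1 hy
  have h3 := H.expand 1 1 hy
  have h4 := H.expand 1 (-1) hy
  have h5 := H.expand 2 1 hy
  have h6 := H.expand 1 2 hy
  refine ⟨?_, ?_, ?_, ?_, ?_⟩ <;> linarith

/-- The components have degree at most three on the fibres, and their cubic parts are those of
`ω(X) ω(v)²` for a vector `X`. -/
theorem taylor (H : IsFibreSystem a c b Ω) {x : E 2} {w : E 2 →L[ℝ] ℝ}
    (hw : ∀ t ∈ Icc (0 : ℝ) 1, (x, t • w) ∈ Ω) :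
    (a (x, w) = a (x, 0) + (w (vec 0) * vd (cov 0) a (x, 0) + w (vec 1) * vd (cov 1) a (x, 0)) +
      w (vec 0) * (w (vec 0) * ((1 / 2) * vd (cov 0) (vd (cov 0) a) (x, 0)) +
        w (vec 1) * vd (cov 0) (vd (cov 1) a) (x, 0)) +
      w (vec 0) ^ 2 * (w (vec 0) * ((1 / 2) * vd (cov 0) (vd (cov 0) (vd (cov 1) c)) (x, 0)) +
        w (vec 1) * ((1 / 2) * vd (cov 0) (vd (cov 1) (vd (cov 1) c)) (x, 0)))) ∧
    (c (x, w) = c (x, 0) + (w (vec 0) * vd (cov 0) c (x, 0) + w (vec 1) * vd (cov 1) c (x, 0)) +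
      (1 / 2) * (w (vec 0) ^ 2 * vd (cov 0) (vd (cov 1) b) (x, 0) +
        2 * (w (vec 0) * w (vec 1)) * vd (cov 0) (vd (cov 1) c) (x, 0) +
        w (vec 1) ^ 2 * vd (cov 0) (vd (cov 1) a) (x, 0)) +
      w (vec 0) * w (vec 1) *
        (w (vec 0) * ((1 / 2) * vd (cov 0) (vd (cov 0) (vd (cov 1) c)) (x, 0)) +
        w (vec 1) * ((1 / 2) * vd (cov 0) (vd (cov 1) (vd (cov 1) c)) (x, 0)))) ∧
    (b (x, w) = b (x, 0) + (w (vec 0) * vd (cov 0) b (x, 0) + w (vec 1) * vd (cov 1) b (x, 0)) +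
      w (vec 1) * (w (vec 0) * vd (cov 0) (vd (cov 1) b) (x, 0) +
        w (vec 1) * (2 * vd (cov 0) (vd (cov 1) c) (x, 0) -
          (1 / 2) * vd (cov 0) (vd (cov 0) a) (x, 0))) +
      w (vec 1) ^ 2 * (w (vec 0) * ((1 / 2) * vd (cov 0) (vd (cov 0) (vd (cov 1) c)) (x, 0)) +
        w (vec 1) * ((1 / 2) * vd (cov 0) (vd (cov 1) (vd (cov 1) c)) (x, 0)))) := by
  have hΩ := H.isOpen
  set P := vd (cov 0) with hP
  set R := vd (cov 1) with hR
  have sP : ∀ {F}, ContDiffOn ℝ ∞ F Ω → ContDiffOn ℝ ∞ (P F) Ω := fun h => contDiffOn_vd hΩ h _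
  have sR : ∀ {F}, ContDiffOn ℝ ∞ F Ω → ContDiffOn ℝ ∞ (R F) Ω := fun h => contDiffOn_vd hΩ h _
  have cP : ∀ {F G}, EqOn F G Ω → EqOn (P F) (P G) Ω := fun h => vd_congr hΩ h _
  have cR : ∀ {F G}, EqOn F G Ω → EqOn (R F) (R G) Ω := fun h => vd_congr hΩ h _
  have zP : ∀ {F}, (∀ y ∈ Ω, F y = 0) → ∀ y ∈ Ω, P F y = 0 := fun h => vd_zero hΩ h _
  have zR : ∀ {F}, (∀ y ∈ Ω, F y = 0) → ∀ y ∈ Ω, R F y = 0 := fun h => vd_zero hΩ h _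
  have comm : ∀ {F}, ContDiffOn ℝ ∞ F Ω → EqOn (R (P F)) (P (R F)) Ω :=
    fun h => vd_comm hΩ h _ _
  have lP : ∀ {F G} (k l : ℝ), ContDiffOn ℝ ∞ F Ω → ContDiffOn ℝ ∞ G Ω →
      EqOn (P (fun y => k * F y + l * G y)) (fun y => k * P F y + l * P G y) Ω :=
    fun k l hF hG => vd_lin hΩ hF hG _ k l
  have lR : ∀ {F G} (k l : ℝ), ContDiffOn ℝ ∞ F Ω → ContDiffOn ℝ ∞ G Ω →
      EqOn (R (fun y => k * F y + l * G y)) (fun y => k * R F y + l * R G y) Ω :=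
    fun k l hF hG => vd_lin hΩ hF hG _ k l
  have sa := H.smooth_a
  have sb := H.smooth_b
  have sc := H.smooth_c
  have qa : ∀ y ∈ Ω, R (R a) y = 0 := fun y hy => (H.second_order hy).1
  have qb : ∀ y ∈ Ω, P (P b) y = 0 := fun y hy => (H.second_order hy).2.1
  have qc : EqOn (R (R c)) (P (R a)) Ω := fun y hy => (H.second_order hy).2.2.1
  have pc : EqOn (P (P c)) (P (R b)) Ω := fun y hy => (H.second_order hy).2.2.2.1
  have rb : EqOn (R (R b)) (fun y => 4 * P (R c) y + (-1) * P (P a) y) Ω :=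
    fun y hy => (H.second_order hy).2.2.2.2
  -- third derivatives
  have a3 : ∀ y ∈ Ω, R (R (R a)) y = 0 := zR qa
  have a2 : ∀ y ∈ Ω, P (R (R a)) y = 0 := zP qa
  have a1 : EqOn (P (P (R a))) (P (R (R c))) Ω := fun y hy => (cP qc hy).symm
  have b2 : EqOn (P (R (R b))) (P (P (R c))) Ω := fun y hy =>
    calc P (R (R b)) y = R (P (R b)) y := (comm (sR sb) hy).symm
      _ = R (P (P c)) y := (cR pc hy).symm
      _ = P (R (P c)) y := comm (sP sc) hy
      _ = P (P (R c)) y := cP (comm sc) hy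
  have a0 : EqOn (P (P (P a))) (fun y => 3 * P (P (R c)) y + 0 * P (P (R c)) y) Ω := fun y hy => by
    have h := cP rb hy
    rw [lP _ _ (sP (sR sc)) (sP (sP sa)) hy, b2 hy] at h
    beta_reduce at h ⊢
    linarith
  have c0 : ∀ y ∈ Ω, P (P (P c)) y = 0 := fun y hy => by
    rw [cP pc hy, ← cP (comm sb) hy, ← comm (sP sb) hy]
    exact zR qb y hy
  have c3 : ∀ y ∈ Ω, R (R (R c)) y = 0 := fun y hy => by
    rw [cR qc hy, comm (sR sa) hy]
    exact zP qa y hy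
  have b0 : ∀ y ∈ Ω, P (P (P b)) y = 0 := zP qb
  have b1 : ∀ y ∈ Ω, P (P (R b)) y = 0 := fun y hy => by
    rw [← cP (comm sb) hy, ← comm (sP sb) hy]
    exact zR qb y hy
  have b3 : ∀ y ∈ Ω, R (R (R b)) y = 3 * P (R (R c)) y := fun y hy => by
    have h := cR rb hy
    rw [lR _ _ (sP (sR sc)) (sP (sP sa)) hy] at h
    beta_reduce at h
    have e1 : R (P (P a)) y = P (R (R c)) y := by
      rw [comm (sP sa) hy, cP (comm sa) hy, a1 hy]
    have e2 : R (P (R c)) y = P (R (R c)) y := comm (sR sc) hy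
    rw [e1, e2] at h
    linarith
  -- the third derivatives are constant along the fibres
  have sM : ContDiffOn ℝ ∞ (P (P (R c))) Ω := sP (sP (sR sc))
  have sN : ContDiffOn ℝ ∞ (P (R (R c))) Ω := sP (sR (sR sc))
  have PM : ∀ y ∈ Ω, P (P (P (R c))) y = 0 := fun y hy => by
    have e : EqOn (P (P (R c))) (R (P (P c))) Ω := fun y hy =>
      ((comm (sP sc) hy).trans (cP (comm sc) hy)).symm
    rw [cP e hy, ← comm (sP (sP sc)) hy]
    exact zR c0 y hy
  have RMN : ∀ y ∈ Ω, R (P (P (R c))) y = P (P (R (R c))) y := fun y hy => by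
    rw [comm (sP (sR sc)) hy, cP (comm (sR sc)) hy]
  have PN : ∀ y ∈ Ω, P (P (R (R c))) y = 3 * R (P (P (R c))) y := fun y hy => by
    have e : EqOn (P (P (R a))) (R (P (P a))) Ω := fun y hy =>
      ((comm (sP sa) hy).trans (cP (comm sa) hy)).symm
    have e2 : P (R (P (P a))) y = R (P (P (P a))) y := (comm (sP (sP sa)) hy).symm
    rw [← cP a1 hy, cP e hy, e2, cR a0 hy, lR _ _ sM sM hy]
    beta_reduce
    ring
  have RM : ∀ y ∈ Ω, R (P (P (R c))) y = 0 := fun y hy => by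
    have h1 := RMN y hy
    have h2 := PN y hy
    linarith
  have PN' : ∀ y ∈ Ω, P (P (R (R c))) y = 0 := fun y hy => by rw [PN y hy, RM y hy, mul_zero]
  have RN : ∀ y ∈ Ω, R (P (R (R c))) y = 0 := fun y hy => by
    rw [← cR a1 hy, comm (sP (sR sa)) hy, cP (comm (sR sa)) hy]
    exact zP a2 y hy
  have hwe : w = w (vec 0) • cov 0 + w (vec 1) • cov 1 := covector_eq w
  set w0 := w (vec 0)
  set w1 := w (vec 1)
  have h0 : ((x, 0) : Cot) ∈ Ω := by simpa using hw 0 (by simp)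
  have hβ : ∀ {F : Cot → ℝ}, (∀ y ∈ Ω, P F y = 0) → (∀ y ∈ Ω, R F y = 0) →
      ∀ β : E 2 →L[ℝ] ℝ, ∀ y ∈ Ω, vd β F y = 0 := by
    intro F h1 h2 β y hy
    rw [covector_eq β, vd_comb]
    change _ * P F y + _ * R F y = 0
    rw [h1 y hy, h2 y hy]
    ring
  have hM : ∀ t ∈ Icc (0 : ℝ) 1, P (P (R c)) (x, t • w) = P (P (R c)) (x, 0) := fun t ht =>
    eq_zero_section hΩ sM (fun r hr => by
      rw [smul_smul]
      exact hw _ ⟨mul_nonneg hr.1 ht.1, mul_le_one₀ hr.2 ht.1 ht.2⟩) (hβ PM RM)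
  have hN : ∀ t ∈ Icc (0 : ℝ) 1, P (R (R c)) (x, t • w) = P (R (R c)) (x, 0) := fun t ht =>
    eq_zero_section hΩ sN (fun r hr => by
      rw [smul_smul]
      exact hw _ ⟨mul_nonneg hr.1 ht.1, mul_le_one₀ hr.2 ht.1 ht.2⟩) (hβ PN' RN)
  have v1 : ∀ F : Cot → ℝ, vd w F (x, 0) = w0 * P F (x, 0) + w1 * R F (x, 0) := fun F => by
    conv_lhs => rw [hwe]
    exact vd_comb _ _ _ _ _ _
  have v2 : ∀ F : Cot → ℝ, ContDiffOn ℝ ∞ F Ω → vd w (vd w F) (x, 0) = w0 ^ 2 * P (P F) (x, 0) +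
      2 * w0 * w1 * P (R F) (x, 0) + w1 ^ 2 * R (R F) (x, 0) := fun F hF => by
    conv_lhs => rw [hwe]
    exact vd_vd_comb hΩ hF _ _ _ _ h0
  have v3 : ∀ F : Cot → ℝ, ContDiffOn ℝ ∞ F Ω → ∀ y ∈ Ω, vd w (vd w (vd w F)) y =
      w0 ^ 3 * P (P (P F)) y + 3 * w0 ^ 2 * w1 * P (P (R F)) y +
      3 * w0 * w1 ^ 2 * P (R (R F)) y + w1 ^ 3 * R (R (R F)) y := fun F hF y hy => by
    conv_lhs => rw [hwe]
    exact vd_vd_vd_comb hΩ hF _ _ _ _ hy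
  refine ⟨?_, ?_, ?_⟩
  · rw [taylor_fibre hΩ sa hw (K := 3 * w0 ^ 3 * P (P (R c)) (x, 0) +
      3 * w0 ^ 2 * w1 * P (R (R c)) (x, 0)) fun t ht => by
        rw [v3 a sa _ (hw t ht), a0 (hw t ht), a1 (hw t ht), a2 _ (hw t ht), a3 _ (hw t ht), hN t ht]
        beta_reduce
        rw [hM t ht]
        ring, v1, v2 a sa, qa _ h0]
    ring
  · rw [taylor_fibre hΩ sc hw (K := 3 * w0 ^ 2 * w1 * P (P (R c)) (x, 0) +
      3 * w0 * w1 ^ 2 * P (R (R c)) (x, 0)) fun t ht => by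
        rw [v3 c sc _ (hw t ht), c0 _ (hw t ht), c3 _ (hw t ht), hN t ht, hM t ht]
        ring, v1, v2 c sc, qc h0, pc h0]
    ring
  · rw [taylor_fibre hΩ sb hw (K := 3 * w0 * w1 ^ 2 * P (P (R c)) (x, 0) +
      3 * w1 ^ 3 * P (R (R c)) (x, 0)) fun t ht => by
        rw [v3 b sb _ (hw t ht), b0 _ (hw t ht), b1 _ (hw t ht), b2 (hw t ht), b3 _ (hw t ht),
          hN t ht, hM t ht]
        ring, v1, v2 b sb, qb _ h0, rb h0]
    ring

end IsFibreSystem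

section Tensors

/-- The symmetric bilinear form with the given components. -/
def symForm (a c b : ℝ) : E 2 →L[ℝ] E 2 →L[ℝ] ℝ :=
  a • (cov 0).smulRight (cov 0) + c • ((cov 0).smulRight (cov 1) + (cov 1).smulRight (cov 0)) +
    b • (cov 1).smulRight (cov 1)

lemma symForm_apply (a c b : ℝ) (u v : E 2) :
    symForm a c b u v = a * (u 0 * v 0) + c * (u 0 * v 1 + u 1 * v 0) + b * (u 1 * v 1) := by
  simp [symForm, cov]
  ring

/-- The bilinear map `B z` with values in multiples of `z`. -/
def formSMul (B : E 2 →L[ℝ] E 2 →L[ℝ] ℝ) (z : E 2) : E 2 →L[ℝ] E 2 →L[ℝ] E 2 :=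
  ((ContinuousLinearMap.smulRightL ℝ (E 2) (E 2)).flip z).comp B

lemma formSMul_apply (B : E 2 →L[ℝ] E 2 →L[ℝ] ℝ) (z u v : E 2) : formSMul B z u v = B u v • z := rfl

lemma contDiff_symForm {a c b : E 2 → ℝ} (ha : ContDiff ℝ ∞ a) (hc : ContDiff ℝ ∞ c)
    (hb : ContDiff ℝ ∞ b) : ContDiff ℝ ∞ fun x => symForm (a x) (c x) (b x) :=
  ((ha.smul contDiff_const).add (hc.smul contDiff_const)).add (hb.smul contDiff_const)

/-- A field of symmetric bilinear forms all of whose values on pairs of equal vectors satisfy the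
second order equation of self-duality comes, near the zero section over the origin, from smooth
tensor fields on the base. -/
theorem exists_base_tensors {Q : Cot → E 2 →L[ℝ] E 2 →L[ℝ] ℝ} {Ω : Set Cot} (hΩ : IsOpen Ω)
    (h0 : (0 : Cot) ∈ Ω) (hQ : ContDiffOn ℝ ∞ Q Ω) (hs : ∀ c ∈ Ω, ∀ u v, Q c u v = Q c v u)
    (hstar : ∀ c ∈ Ω, ∀ s t : ℝ,
      fderiv ℝ (fun y => fderiv ℝ (fun y' => Q y' (s • vec 0 + t • vec 1) (s • vec 0 + t • vec 1))
        y (0, t • cov 0 - s • cov 1)) c (0, t • cov 0 - s • cov 1) = 0) :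
    ∃ (X : E 2 → E 2) (T : E 2 → E 2 →L[ℝ] E 2) (Γ : E 2 → E 2 →L[ℝ] E 2 →L[ℝ] E 2)
      (Φ : E 2 → E 2 →L[ℝ] E 2 →L[ℝ] ℝ), ContDiff ℝ ∞ X ∧ ContDiff ℝ ∞ T ∧ ContDiff ℝ ∞ Γ ∧
      ContDiff ℝ ∞ Φ ∧ (∀ x u v, Γ x u v = Γ x v u) ∧ (∀ x u v, Φ x u v = Φ x v u) ∧
      ∀ᶠ c in 𝓝 (0 : Cot), ∀ u v, Q c u v = c.2 (X c.1) * (c.2 u * c.2 v) +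
        (1 / 2) * (c.2 u * c.2 (T c.1 v) + c.2 (T c.1 u) * c.2 v) - c.2 (Γ c.1 v u) -
        c.2 (Γ c.1 u v) + Φ c.1 u v := by
  let a : Cot → ℝ := fun c => Q c (vec 0) (vec 0)
  let b : Cot → ℝ := fun c => Q c (vec 1) (vec 1)
  let m : Cot → ℝ := fun c => Q c (vec 0) (vec 1)
  have hsm : ∀ u v : E 2, ContDiffOn ℝ ∞ (fun c => Q c u v) Ω := contDiffOn_bilin_iff.1 hQ
  have hquad : ∀ s t : ℝ, EqOn (fun c => Q c (s • vec 0 + t • vec 1) (s • vec 0 + t • vec 1))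
      (fun c => s ^ 2 * a c + 2 * s * t * m c + t ^ 2 * b c) Ω := by
    intro s t c hc
    simp only [map_add, map_smul, add_apply, smul_apply, smul_eq_mul, a, b, m,
      hs c hc (vec 1) (vec 0)]
    ring
  have hsys : IsFibreSystem a m b Ω := by
    refine ⟨hΩ, hsm _ _, hsm _ _, hsm _ _, fun s t y hy => ?_⟩
    have e : t • cov 0 + (-s) • cov 1 = t • cov 0 - s • cov 1 := by
      rw [neg_smul, sub_eq_add_neg]
    rw [e, ← vd_congr hΩ (vd_congr hΩ (hquad s t) _) _ hy]
    exact hstar y hy s t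
  -- extension of the coefficients to all of the base
  have hext : ∀ F : Cot → ℝ, ContDiffOn ℝ ∞ F Ω →
      ∃ f : E 2 → ℝ, ContDiff ℝ ∞ f ∧ f =ᶠ[𝓝 0] fun x => F (x, 0) := by
    intro F hF
    have hι : ContDiff ℝ ∞ fun x : E 2 => ((x, 0) : Cot) := contDiff_id.prodMk contDiff_const
    exact exists_contDiff_eventuallyEq (hΩ.preimage hι.continuous)
      (hF.comp hι.contDiffOn fun x hx => hx) h0
  choose! ext ext_smooth ext_eq using hext
  have sv : ∀ {F}, ContDiffOn ℝ ∞ F Ω → ∀ β, ContDiffOn ℝ ∞ (vd β F) Ω :=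
    fun h β => contDiffOn_vd hΩ h β
  have sa : ContDiffOn ℝ ∞ a Ω := hsm _ _
  have sb : ContDiffOn ℝ ∞ b Ω := hsm _ _
  have sm : ContDiffOn ℝ ∞ m Ω := hsm _ _
  obtain ⟨r, hr, hrΩ⟩ := Metric.isOpen_iff.1 hΩ 0 h0
  -- `X`, `T`, `Γ` and `Φ` are read off from the derivatives of order three, two, one and zero of
  -- `Q` along the fibres, at the zero section; see `IsFibreSystem.taylor`
  let x₀ := ext (vd (cov 0) (vd (cov 0) (vd (cov 1) m)))
  let x₁ := ext (vd (cov 0) (vd (cov 1) (vd (cov 1) m)))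
  let t₀₀ := ext (vd (cov 0) (vd (cov 0) a))
  let t₀₁ := ext (vd (cov 0) (vd (cov 1) a))
  let t₁₀ := ext (vd (cov 0) (vd (cov 1) b))
  let t₁₁ := ext (vd (cov 0) (vd (cov 1) m))
  have hx₀ := sv (sv (sv sm (cov 1)) (cov 0)) (cov 0)
  have hx₁ := sv (sv (sv sm (cov 1)) (cov 1)) (cov 0)
  have h00 := sv (sv sa (cov 0)) (cov 0)
  have h01 := sv (sv sa (cov 1)) (cov 0)
  have h10 := sv (sv sb (cov 1)) (cov 0)
  have h11 := sv (sv sm (cov 1)) (cov 0)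
  refine ⟨fun x => ((1 / 2 : ℝ) * x₀ x) • vec 0 + ((1 / 2 : ℝ) * x₁ x) • vec 1,
    fun x => (cov 0).smulRight (((1 / 2 : ℝ) * t₀₀ x) • vec 0 + t₀₁ x • vec 1) +
      (cov 1).smulRight (t₁₀ x • vec 0 + (2 * t₁₁ x - (1 / 2) * t₀₀ x) • vec 1),
    fun x => formSMul
        (symForm (-(1 / 2) * ext (vd (cov 0) a) x) (-(1 / 2) * ext (vd (cov 0) m) x)
          (-(1 / 2) * ext (vd (cov 0) b) x)) (vec 0) +
      formSMul
        (symForm (-(1 / 2) * ext (vd (cov 1) a) x) (-(1 / 2) * ext (vd (cov 1) m) x)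
          (-(1 / 2) * ext (vd (cov 1) b) x)) (vec 1),
    fun x => symForm (ext a x) (ext m x) (ext b x), ?_, ?_, ?_, ?_, ?_, ?_, ?_⟩
  · exact ((contDiff_const.mul (ext_smooth _ hx₀)).smul contDiff_const).add
      ((contDiff_const.mul (ext_smooth _ hx₁)).smul contDiff_const)
  · have h1 : ContDiff ℝ ∞ fun x => ((1 / 2 : ℝ) * t₀₀ x) • vec 0 + t₀₁ x • vec 1 :=
      ((contDiff_const.mul (ext_smooth _ h00)).smul contDiff_const).add
        ((ext_smooth _ h01).smul contDiff_const)
    have h2 : ContDiff ℝ ∞ fun x => t₁₀ x • vec 0 + (2 * t₁₁ x - (1 / 2 : ℝ) * t₀₀ x) • vec 1 :=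
      ((ext_smooth _ h10).smul contDiff_const).add
        (((contDiff_const.mul (ext_smooth _ h11)).sub
          (contDiff_const.mul (ext_smooth _ h00))).smul contDiff_const)
    exact (contDiff_const.smulRight h1).add (contDiff_const.smulRight h2)
  · have h1 : ∀ β, ContDiff ℝ ∞ fun x => symForm (-(1 / 2) * ext (vd β a) x)
        (-(1 / 2) * ext (vd β m) x) (-(1 / 2) * ext (vd β b) x) := fun β =>
      contDiff_symForm (contDiff_const.mul (ext_smooth _ (sv sa β)))
        (contDiff_const.mul (ext_smooth _ (sv sm β))) (contDiff_const.mul (ext_smooth _ (sv sb β)))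
    exact (contDiff_const.clm_comp (h1 _)).add (contDiff_const.clm_comp (h1 _))
  · exact contDiff_symForm (ext_smooth _ sa) (ext_smooth _ sm) (ext_smooth _ sb)
  · intro x u v
    simp only [add_apply, formSMul_apply, symForm_apply]
    congr 2 <;> ring
  · intro x u v
    simp only [symForm_apply]
    ring
  · have hfst : Tendsto (Prod.fst : Cot → E 2) (𝓝 0) (𝓝 0) := continuous_fst.tendsto 0
    have ev : ∀ {F}, ContDiffOn ℝ ∞ F Ω → ∀ᶠ c : Cot in 𝓝 0, ext F c.1 = F (c.1, 0) :=
      fun h => hfst.eventually (ext_eq _ h)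
    filter_upwards [Metric.ball_mem_nhds (0 : Cot) hr, ev hx₀, ev hx₁, ev h00, ev h01, ev h10,
      ev h11, ev (sv sa (cov 0)), ev (sv sa (cov 1)), ev (sv sm (cov 0)), ev (sv sm (cov 1)),
      ev (sv sb (cov 0)), ev (sv sb (cov 1)), ev sa, ev sm, ev sb]
      with c hc e1 e2 e3 e4 e5 e6 e7 e8 e9 e10 e11 e12 e13 e14 e15 u v
    obtain ⟨x, w⟩ := c
    have hw : ∀ t ∈ Icc (0 : ℝ) 1, (x, t • w) ∈ Ω := by
      intro t ht
      refine hrΩ ?_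
      rw [mem_ball_zero_iff] at hc ⊢
      refine lt_of_le_of_lt ?_ hc
      rw [Prod.norm_mk, Prod.norm_mk]
      refine max_le_max le_rfl ?_
      rw [norm_smul, Real.norm_of_nonneg ht.1]
      exact mul_le_of_le_one_left (norm_nonneg _) ht.2
    obtain ⟨Ta, Tm, Tb⟩ := hsys.taylor hw
    have hxw : ((x, w) : Cot) ∈ Ω := by simpa using hw 1 (by simp)
    have hexp : Q (x, w) u v = a (x, w) * (u 0 * v 0) + m (x, w) * (u 0 * v 1 + u 1 * v 0) +
        b (x, w) * (u 1 * v 1) := by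
      conv_lhs => rw [vector_eq u, vector_eq v]
      simp only [map_add, map_smul, add_apply, smul_apply, smul_eq_mul, a, b, m,
        hs _ hxw (vec 1) (vec 0)]
      ring
    have hwv : ∀ v : E 2, w v = v 0 * w (vec 0) + v 1 * w (vec 1) := fun v => by
      conv_lhs => rw [vector_eq v]
      simp only [map_add, map_smul, smul_eq_mul]
    dsimp only at e1 e2 e3 e4 e5 e6 e7 e8 e9 e10 e11 e12 e13 e14 e15
    rw [hexp, Ta, Tm, Tb]
    simp only [map_add, map_smul, add_apply, smul_eq_mul,
      ContinuousLinearMap.smulRight_apply, formSMul_apply,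
      symForm_apply, x₀, x₁, t₀₀, t₀₁, t₁₀, t₁₁, e1, e2, e3, e4, e5, e6, e7, e8, e9, e10,
      e11, e12, e13, e14, e15]
    rw [hwv u, hwv v]
    have hcov : ∀ (i : Fin 2) (v : E 2), cov i v = v i := fun i v => rfl
    simp only [hcov]
    ring

end Tensors

/-! ### Affine surfaces with underlying manifold the plane -/

section Plane

lemma contMDiff_endField {T : E 2 → E 2 →L[ℝ] E 2} (hT : ContDiff ℝ ∞ T) :
    ContMDiff (𝓡 2) ((𝓡 2).prod 𝓘(ℝ, E 2 →L[ℝ] E 2)) ∞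
      (fun p => Bundle.TotalSpace.mk' (E 2 →L[ℝ] E 2)
        (E := fun p : E 2 => TangentSpace (𝓡 2) p →L[ℝ] TangentSpace (𝓡 2) p) p (T p)) := by
  intro p
  refine (contMDiffAt_hom_bundle _).2 ⟨contMDiffAt_id, ?_⟩
  refine hT.contMDiff.contMDiffAt.congr_of_eventuallyEq (Eventually.of_forall fun x => ?_)
  exact inCoordinates_tangent_bundle_core_model_space (I := 𝓡 2) (I' := 𝓡 2) p x p x (T x)

lemma contMDiff_formField {Φ : E 2 → E 2 →L[ℝ] E 2 →L[ℝ] ℝ} (hΦ : ContDiff ℝ ∞ Φ) :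
    ContMDiff (𝓡 2) ((𝓡 2).prod 𝓘(ℝ, E 2 →L[ℝ] E 2 →L[ℝ] ℝ)) ∞
      (fun p => Bundle.TotalSpace.mk' (E 2 →L[ℝ] E 2 →L[ℝ] ℝ)
        (E := fun p : E 2 => TangentSpace (𝓡 2) p →L[ℝ] TangentSpace (𝓡 2) p →L[ℝ] ℝ) p
          (Φ p)) := by
  intro p
  refine (contMDiffAt_hom_bundle _).2 ⟨contMDiffAt_id, ?_⟩
  refine hΦ.contMDiff.contMDiffAt.congr_of_eventuallyEq (Eventually.of_forall fun x => ?_)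
  have hm : x ∈ (trivializationAt (E 2 →L[ℝ] ℝ)
      (fun q : E 2 => TangentSpace (𝓡 2) q →L[ℝ] ℝ) p).baseSet := by
    rw [hom_trivializationAt_baseSet]
    exact ⟨mem_univ x, mem_univ x⟩
  ext u v
  simp only [ContinuousLinearMap.inCoordinates, ContinuousLinearMap.comp_apply]
  rw [Bundle.Trivialization.continuousLinearMapAt_apply_of_mem _ _ hm]
  simp [hom_trivializationAt_apply, ContinuousLinearMap.inCoordinates]
  rfl

lemma mdifferentiableAt_field_iff {Y : ∀ q : E 2, TangentSpace (𝓡 2) q} {p : E 2} :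
    MDifferentiableAt (𝓡 2) ((𝓡 2).prod 𝓘(ℝ, E 2))
      (fun q => (⟨q, Y q⟩ : Bundle.TotalSpace (E 2) (fun q : E 2 => TangentSpace (𝓡 2) q))) p ↔
      DifferentiableAt ℝ (fun q => (Y q : E 2)) p := by
  refine (mdifferentiableAt_section _ _).trans (Iff.trans ?_ mdifferentiableAt_iff_differentiableAt)
  refine iff_of_eq (congrArg (fun f : E 2 → E 2 => MDifferentiableAt (𝓡 2) 𝓘(ℝ, E 2) f p) ?_)
  funext q
  rw [trivializationAt_model_space_apply]

/-- The connection on the plane with Christoffel symbols `Γ`. -/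
def planeConnection (Γ : E 2 → E 2 →L[ℝ] E 2 →L[ℝ] E 2) :
    CovariantDerivative (𝓡 2) (E 2) (fun p : E 2 => TangentSpace (𝓡 2) p) where
  toFun Y p := (fderiv ℝ (fun q => (Y q : E 2)) p + Γ p (Y p) : E 2 →L[ℝ] E 2)
  isCovariantDerivativeOnUniv := by
    constructor
    · intro σ τ p hσ hτ _
      have key : ∀ f g : E 2 → E 2, DifferentiableAt ℝ f p → DifferentiableAt ℝ g p →
          fderiv ℝ (fun q => f q + g q) p + Γ p (f p + g p) =
            (fderiv ℝ f p + Γ p (f p)) + (fderiv ℝ g p + Γ p (g p)) := by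
        intro f g hf hg
        rw [fderiv_fun_add hf hg, map_add]
        abel
      exact key σ τ (mdifferentiableAt_field_iff.1 hσ) (mdifferentiableAt_field_iff.1 hτ)
    · intro σ f p hσ hf _
      have key : ∀ (f : E 2 → ℝ) (g : E 2 → E 2), DifferentiableAt ℝ f p → DifferentiableAt ℝ g p →
          fderiv ℝ (fun q => f q • g q) p + Γ p (f p • g p) =
            f p • (fderiv ℝ g p + Γ p (g p)) + (fderiv ℝ f p).smulRight (g p) := by
        intro f g hf hg
        rw [fderiv_fun_smul hf hg, map_smul, smul_add]
        abel
      refine (key f σ hf.differentiableAt (mdifferentiableAt_field_iff.1 hσ)).trans ?_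
      have h4 : (mvfderiv (𝓡 2) f p : E 2 →L[ℝ] ℝ) = fderiv ℝ f p := mfderiv_eq_fderiv
      rw [← h4]
      rfl

lemma torsion_planeConnection {Γ : E 2 → E 2 →L[ℝ] E 2 →L[ℝ] E 2} (hΓ : ∀ x u v, Γ x u v = Γ x v u) :
    (planeConnection Γ).torsion = 0 := by
  rw [CovariantDerivative.torsion_eq_zero_iff]
  intro X Y p hX hY
  have key : ∀ f g : E 2 → E 2, (fderiv ℝ g p (f p) + Γ p (g p) (f p)) -
      (fderiv ℝ f p (g p) + Γ p (f p) (g p)) = VectorField.lieBracket ℝ f g p := by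
    intro f g
    rw [VectorField.lieBracket, hΓ p (f p) (g p)]
    abel
  refine (key X Y).trans ?_
  rw [← VectorField.mlieBracketWithin_univ, VectorField.mlieBracketWithin_eq_lieBracketWithin]
  exact (congrFun VectorField.lieBracketWithin_univ p).symm

lemma contMDiff_planeConnection {Γ : E 2 → E 2 →L[ℝ] E 2 →L[ℝ] E 2} (hΓ : ContDiff ℝ ∞ Γ) :
    CovariantDerivative.ContMDiffCovariantDerivative (planeConnection Γ) ∞ := by
  constructor
  constructor
  intro σ hσ
  have h1 : ContDiff ℝ ∞ (fun q => (σ q : E 2)) := by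
    rw [contMDiffOn_univ] at hσ
    exact contMDiff_vectorSpace_iff_contDiff.1 hσ
  exact (contMDiff_endField (T := fun p => fderiv ℝ (fun q => (σ q : E 2)) p + Γ p (σ p))
    ((h1.fderiv_right (by simp)).add (hΓ.clm_apply h1))).contMDiffOn

/-- The affine surface with tensor fields given by smooth tensor fields on the plane. -/
def planeData (X : E 2 → E 2) (T : E 2 → E 2 →L[ℝ] E 2) (Γ : E 2 → E 2 →L[ℝ] E 2 →L[ℝ] E 2)
    (Φ : E 2 → E 2 →L[ℝ] E 2 →L[ℝ] ℝ) (hX : ContDiff ℝ ∞ X) (hT : ContDiff ℝ ∞ T)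
    (hΓ : ContDiff ℝ ∞ Γ) (hΦ : ContDiff ℝ ∞ Φ) (hΓs : ∀ x u v, Γ x u v = Γ x v u)
    (hΦs : ∀ x u v, Φ x u v = Φ x v u) : SurfaceData (E 2) where
  nab := planeConnection Γ
  nab_smooth := contMDiff_planeConnection hΓ
  nab_torsion := torsion_planeConnection hΓs
  X := X
  X_smooth := contMDiff_vectorSpace_iff_contDiff.2 hX
  T := T
  T_smooth := contMDiff_endField hT
  Phi := Φ
  Phi_symm := hΦs
  Phi_smooth := contMDiff_formField hΦ

end Plane

/-! ### The fibre equation and the canonical orientation -/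

section SelfDual

variable {N : Type*} [TopologicalSpace N] [ChartedSpace (E 4) N] [IsManifold (𝓡 4) ∞ N]
  {g : Metric N} {D : WalkerDistribution g}

/-- In Walker coordinates, self-duality is a second order equation along the fibres. -/
theorem fibre_equation_of_isSelfDual (hSD : IsSelfDual g D) {p : N}
    {Θ : OpenPartialHomeomorph Cot (E 4)} (hΘ : IsDiffeo Θ)
    (hΘt : ∀ c ∈ Θ.source, Θ c ∈ (extChartAt (𝓡 4) p).target)
    (hΘv : ∀ c ∈ Θ.source, ∀ β, fderiv ℝ Θ c (0, β) ∈ planeInChart D p (Θ c))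
    (hΘg : ∀ c ∈ Θ.source, ∀ v w, pull Θ (g.inChart p) c v w =
      v.2 w.1 + w.2 v.1 + pull Θ (g.inChart p) c (v.1, 0) (w.1, 0))
    {c : Cot} (hc : c ∈ Θ.source) (s t : ℝ) :
    fderiv ℝ (fun y => fderiv ℝ (fun y' => horizontal (pull Θ (g.inChart p)) y'
      (s • vec 0 + t • vec 1) (s • vec 0 + t • vec 1)) y (0, t • cov 0 - s • cov 1)) c
      (0, t • cov 0 - s • cov 1) = 0 := by
  have hy := hΘt c hc
  set q := (extChartAt (𝓡 4) p).symm (Θ c) with hq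
  have hqs : (extChartAt (𝓡 4) p).symm (Θ c) ∈ (extChartAt (𝓡 4) q).source :=
    mem_extChartAt_source q
  have H1 : IsPullbackAt Θ (pull Θ (g.inChart p)) (g.inChart p) c :=
    hΘ.isPullbackAt_pull hc (isMetricAt_inChart g hy)
  have H : IsPullbackAt (transition p q ∘ Θ) (pull Θ (g.inChart p)) (g.inChart q) c :=
    (isPullbackAt_transition hy hqs g).comp H1
  have hφ : (transition p q ∘ Θ) c = extChartAt (𝓡 4) q q := transition_eq_self hq.symm
  have hW : IsWalkerFormAt (pull Θ (g.inChart p)) (horizontal (pull Θ (g.inChart p))) c := by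
    refine ⟨H1.isMetricAt, ?_⟩
    filter_upwards [Θ.open_source.mem_nhds hc] with y hy v w using hΘg y hy v w
  obtain ⟨b, hb1, hb2, hb3⟩ := weylMinus_iff_of_walkerForm H hφ hW
  have hvert : ∀ β : E 2 →L[ℝ] ℝ, fderiv ℝ (transition p q ∘ Θ) c (0, β) ∈ D.plane q := by
    intro β
    have h1 := frame_fderiv_transition hy hqs (fderiv ℝ Θ c (0, β))
    rw [transition_eq_self hq.symm, frame_self] at h1
    have h2 : fderiv ℝ (transition p q ∘ Θ) c (0, β) =
        fderiv ℝ (transition p q) (Θ c) (fderiv ℝ Θ c (0, β)) := by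
      rw [fderiv_comp c ((contDiffAt_transition hy hqs).differentiableAt (by simp))
        (hΘ.differentiableAt hc)]
      rfl
    rw [h2, show fderiv ℝ (transition p q) (Θ c) (fderiv ℝ Θ c (0, β)) =
      frame p (Θ c) (fderiv ℝ Θ c (0, β)) from h1]
    exact hΘv c hc β
  have hadapted : IsAdapted (fun x y => g.val q x y) (D.plane q) b := by
    refine ⟨?_, ?_, (hb1 0 2).trans rfl, (hb1 0 3).trans rfl, (hb1 1 2).trans rfl, (hb1 1 3).trans rfl⟩
    · rw [hb2]; exact hvert (cov 0)
    · rw [hb2]; exact hvert (cov 1)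
  exact hb3.1 (hSD q b hadapted) s t

/-- A differentiable isometry which takes the null distribution to the vertical one preserves
the canonical orientations. -/
theorem preservesOrientationAt_of_preservesDistributionAt {S : Type} [TopologicalSpace S]
    [ChartedSpace (E 2) S] [IsManifold (𝓡 2) ∞ S] {d : SurfaceData S} {f : N → Cotangent S} {p : N}
    (hf : IsLocalIsometryAt g d f p) (hD : PreservesDistributionAt D f p) :
    PreservesOrientationAt D d f p := by
  obtain ⟨⟨Φ, hp, hΦ⟩, hiso⟩ := hf
  filter_upwards [hiso, hD, Φ.open_source.mem_nhds hp] with q hiso hD hq b b' hb hb'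
  have hloc : IsLocalDiffeomorphAt (𝓡 4) cotModel ∞ f q := ⟨Φ, hq, hΦ⟩
  let L := (hloc.mfderivToContinuousLinearEquiv (by simp)).toLinearEquiv
  have hL : ∀ x, mfderiv (𝓡 4) cotModel f q x = L x := fun x => rfl
  have hL' : ∀ x, mfderiv (𝓡 4) cotModel f q (L.symm x) = x := L.apply_symm_apply
  let B : TangentSpace (𝓡 4) q →ₗ[ℝ] TangentSpace (𝓡 4) q →ₗ[ℝ] ℝ :=
    LinearMap.mk₂ ℝ (fun x y => g.val q x y) (fun x y z => by simp) (fun c x y => by simp)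
      (fun x y z => by simp) (fun c x y => by simp)
  have hval : ∀ i j, g.val q (b'.map L.symm i) (b'.map L.symm j) = d.extension (f q) (b' i) (b' j) := by
    intro i j
    rw [← hiso, Module.Basis.map_apply, Module.Basis.map_apply, hL', hL']
  have hmem : ∀ i, b' i ∈ vertical (f q) → b'.map L.symm i ∈ D.plane q := by
    intro i hi
    rw [← hD, Module.Basis.map_apply, hL']
    exact hi
  have hb'' : IsAdapted (fun x y => B x y) (D.plane q) (b'.map L.symm) :=
    ⟨hmem _ hb'.1, hmem _ hb'.2.1, (hval 0 2).trans hb'.2.2.1, (hval 0 3).trans hb'.2.2.2.1,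
      (hval 1 2).trans hb'.2.2.2.2.1, (hval 1 3).trans hb'.2.2.2.2.2⟩
  have h1 := IsAdapted.det_eq_one (B := B) (D.null q) hb'' hb
  rw [Module.Basis.det_map] at h1
  have h2 : b'.det (fun i => mfderiv (𝓡 4) cotModel f q (b i)) = 1 := h1
  rw [h2]
  exact one_pos

end SelfDual

/-! ### Realization of self-dual Walker metrics on the cotangent bundle of the plane -/

section PlaneCotangent

/-- The plane is its own chart, so its coordinate frame is the identity. -/
lemma frame_plane (p y : E 2) : frame p y = ContinuousLinearMap.id ℝ (E 2) := by
  have h : ⇑(extChartAt (𝓡 2) p).symm = id := rfl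
  rw [frame, h]
  exact mfderiv_id

lemma coordField_plane (p v q : E 2) : (coordField p v q : E 2) = v :=
  congrArg (fun L : E 2 →L[ℝ] E 2 => L v) (frame_plane p _)

lemma mem_extChartAt_plane_source (p q : E 2) : q ∈ (extChartAt (𝓡 2) p).source := by
  rw [extChartAt_source]
  exact mem_univ q

lemma extChartAt_cotangent_plane_source (z₀ : Cotangent (E 2)) :
    (extChartAt cotModel z₀).source = univ :=
  eq_univ_of_forall fun _ => mem_cotangent_source.2 (mem_extChartAt_plane_source _ _)

lemma extChartAt_cotangent_plane_target (z₀ : Cotangent (E 2)) :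
    (extChartAt cotModel z₀).target = univ := by
  refine eq_univ_of_forall fun c => ?_
  rw [FiberBundle.extChartAt_target]
  refine ⟨⟨?_, ?_⟩, mem_univ _⟩
  · rw [extChartAt_target]
    exact ⟨mem_univ _, mem_range_self (f := 𝓡 2) c.1⟩
  · rw [mem_preimage, hom_trivializationAt_baseSet]
    exact ⟨mem_univ _, mem_univ _⟩

lemma snd_plane (z₀ z : Cotangent (E 2)) (v : E 2) :
    z.2 v = (extChartAt cotModel z₀ z).2 v := by
  rw [extChartAt_cotangent_snd (by rw [extChartAt_cotangent_plane_source]; trivial), frame_plane]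
  rfl

/-- The metric of the cotangent bundle of the plane, in the canonical coordinates. -/
lemma baseForm_plane {X : E 2 → E 2} {T : E 2 → E 2 →L[ℝ] E 2} {Γ : E 2 → E 2 →L[ℝ] E 2 →L[ℝ] E 2}
    {Φ : E 2 → E 2 →L[ℝ] E 2 →L[ℝ] ℝ} (hX : ContDiff ℝ ∞ X) (hT : ContDiff ℝ ∞ T)
    (hΓ : ContDiff ℝ ∞ Γ) (hΦ : ContDiff ℝ ∞ Φ) (hΓs : ∀ x u v, Γ x u v = Γ x v u)
    (hΦs : ∀ x u v, Φ x u v = Φ x v u) (z₀ z : Cotangent (E 2)) (c : Cot)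
    (hc : extChartAt cotModel z₀ z = c) (u v : E 2) :
    (planeData X T Γ Φ hX hT hΓ hΦ hΓs hΦs).baseForm z₀.proj z u v =
      c.2 (X c.1) * (c.2 u * c.2 v) +
        (1 / 2) * (c.2 u * c.2 (T c.1 v) + c.2 (T c.1 u) * c.2 v) - c.2 (Γ c.1 v u) -
        c.2 (Γ c.1 u v) + Φ c.1 u v := by
  subst hc
  have h1 : (extChartAt cotModel z₀ z).1 = z.proj := rfl
  have hcoord : ∀ v : E 2, coordField z₀.proj v = fun _ : E 2 => v :=
    fun v => funext fun q => coordField_plane z₀.proj v q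
  have hnab : ∀ u v : E 2, planeConnection Γ (fun _ : E 2 => v) z.proj u = Γ z.proj v u := by
    intro u v
    have h : ∀ q : E 2, (fderiv ℝ (fun _ : E 2 => v) q u + Γ q v u : E 2) = Γ q v u := by
      intro q; simp
    exact h z.proj
  simp only [← snd_plane, h1]
  rw [SurfaceData.baseForm, hcoord, hcoord, ← hnab, ← hnab]
  rfl

end PlaneCotangent

section SelfDual

variable {N : Type*} [TopologicalSpace N] [ChartedSpace (E 4) N] [IsManifold (𝓡 4) ∞ N]
  {g : Metric N} {D : WalkerDistribution g}

/-- Coordinates on `N` near `p` with values in an open part of `ℝ² × (ℝ²)*` define a local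
diffeomorphism to the cotangent bundle of the plane. -/
lemma exists_partialDiffeomorph_cotangent (p : N) {Θ : OpenPartialHomeomorph Cot (E 4)}
    (hΘ : IsDiffeo Θ) (h0 : (0 : Cot) ∈ Θ.source) (hΘ0 : Θ 0 = extChartAt (𝓡 4) p p)
    (z₀ : Cotangent (E 2)) :
    ∃ Φ : PartialDiffeomorph (𝓡 4) cotModel N (Cotangent (E 2)) ∞, p ∈ Φ.source ∧
      ∀ q ∈ Φ.source, q ∈ (extChartAt (𝓡 4) p).source ∧ extChartAt (𝓡 4) p q ∈ Θ.target ∧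
        extChartAt cotModel z₀ (Φ q) = Θ.symm (extChartAt (𝓡 4) p q) := by
  let ψ := extChartAt (𝓡 4) p
  let Ψ := extChartAt cotModel z₀
  have hΨs : Ψ.source = univ := extChartAt_cotangent_plane_source z₀
  have hΨt : Ψ.target = univ := extChartAt_cotangent_plane_target z₀
  have hψ : ContMDiffOn (𝓡 4) 𝓘(ℝ, E 4) ∞ ψ ψ.source := by
    have := contMDiffOn_extChartAt (I := 𝓡 4) (n := ∞) (x := p)
    rwa [← extChartAt_source (I := 𝓡 4)] at this
  have hΨ : ContMDiff cotModel 𝓘(ℝ, Cot) ∞ Ψ := by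
    have := contMDiffOn_extChartAt (I := cotModel) (n := ∞) (x := z₀)
    rwa [← extChartAt_source (I := cotModel), extChartAt_cotangent_plane_source,
      contMDiffOn_univ] at this
  have hΨ' : ContMDiff 𝓘(ℝ, Cot) cotModel ∞ Ψ.symm := by
    have := contMDiffOn_extChartAt_symm (I := cotModel) (n := ∞) z₀
    rwa [extChartAt_cotangent_plane_target, contMDiffOn_univ] at this
  have hΨl : ∀ z, Ψ.symm (Ψ z) = z := fun z => Ψ.left_inv (by rw [hΨs]; trivial)
  have hΨr : ∀ c, Ψ (Ψ.symm c) = c := fun c => Ψ.right_inv (by rw [hΨt]; trivial)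
  refine ⟨{ toFun := fun q => Ψ.symm (Θ.symm (ψ q))
            invFun := fun z => ψ.symm (Θ (Ψ z))
            source := ψ.source ∩ ψ ⁻¹' Θ.target
            target := Ψ ⁻¹' (Θ.source ∩ Θ ⁻¹' ψ.target)
            map_source' := ?_
            map_target' := ?_
            left_inv' := ?_
            right_inv' := ?_
            open_source := ?_
            open_target := ?_
            contMDiffOn_toFun := ?_
            contMDiffOn_invFun := ?_ }, ?_, fun q hq => ⟨hq.1, hq.2, hΨr _⟩⟩
  · rintro q ⟨hq, hq'⟩
    rw [mem_preimage, hΨr]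
    refine ⟨Θ.map_target hq', ?_⟩
    rw [mem_preimage, Θ.right_inv hq']
    exact ψ.map_source hq
  · rintro z ⟨hz, hz'⟩
    refine ⟨ψ.map_target hz', ?_⟩
    rw [mem_preimage, ψ.right_inv hz']
    exact Θ.map_source hz
  · rintro q ⟨hq, hq'⟩
    rw [hΨr, Θ.right_inv hq', ψ.left_inv hq]
  · rintro z ⟨hz, hz'⟩
    rw [ψ.right_inv hz', Θ.left_inv hz, hΨl]
  · exact (continuousOn_extChartAt p).isOpen_inter_preimage (isOpen_extChartAt_source p)
      Θ.open_target
  · exact (Θ.isOpen_inter_preimage (isOpen_extChartAt_target p)).preimage hΨ.continuous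
  · exact (hΨ'.comp_contMDiffOn (hΘ.contDiffOn_symm.contMDiffOn.comp
      (hψ.mono inter_subset_left) fun q hq => hq.2))
  · exact (contMDiffOn_extChartAt_symm p).comp ((hΘ.contDiffOn.mono inter_subset_left).contMDiffOn.comp
      hΨ.contMDiffOn fun z hz => hz) fun z hz => hz.2
  · refine ⟨mem_extChartAt_source p, ?_⟩
    rw [mem_preimage, ← hΘ0]
    exact Θ.map_source h0

/-- If coordinates take the vectors `(0, β)` into a plane, they identify that plane with the
vectors whose first component vanishes. -/
lemma fst_eq_zero_iff_mem {P : Submodule ℝ (E 4)} (hP : Module.finrank ℝ P = 2)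
    {A : Cot →L[ℝ] E 4} {B : E 4 →L[ℝ] Cot} (hAB : ∀ v, A (B v) = v) (hBA : ∀ c, B (A c) = c)
    (hA : ∀ β, A (0, β) ∈ P) (v : E 4) : (B v).1 = 0 ↔ v ∈ P := by
  let L : (E 2 →L[ℝ] ℝ) →ₗ[ℝ] E 4 := A.toLinearMap ∘ₗ LinearMap.inr ℝ (E 2) (E 2 →L[ℝ] ℝ)
  have hL : ∀ β, L β = A (0, β) := fun β => rfl
  have hinj : Function.Injective L := fun β β' h => by
    rw [hL, hL] at h
    have := congrArg B h
    rw [hBA, hBA] at this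
    exact congrArg Prod.snd this
  have hrange : LinearMap.range L = P := by
    refine Submodule.eq_of_le_of_finrank_eq ?_ ?_
    · rintro _ ⟨β, rfl⟩
      exact hA β
    · rw [LinearMap.finrank_range_of_inj hinj, finrank_dual_plane, hP]
  constructor
  · intro h
    have h1 := hA (B v).2
    rw [← h, Prod.mk.eta, hAB] at h1
    exact h1
  · intro h
    rw [← hrange] at h
    obtain ⟨β, rfl⟩ := h
    rw [hL, hBA]

lemma inChart_mfderiv_chart {p q : N} (hq : q ∈ (extChartAt (𝓡 4) p).source) (v w : E 4) :
    g.inChart p (extChartAt (𝓡 4) p q) (mfderiv (𝓡 4) (𝓡 4) (extChartAt (𝓡 4) p) q v)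
      (mfderiv (𝓡 4) (𝓡 4) (extChartAt (𝓡 4) p) q w) = g.val q v w := by
  have h : ∀ x, x = q → ∀ a b : E 4, a = v → b = w → g.val x a b = g.val q v w := by
    rintro x rfl a b rfl rfl
    rfl
  exact h _ ((extChartAt (𝓡 4) p).left_inv hq) _ _ (frame_mfderiv_chart' hq v)
    (frame_mfderiv_chart' hq w)

lemma mfderiv_chart_mem_planeInChart {p q : N} (hq : q ∈ (extChartAt (𝓡 4) p).source) (v : E 4) :
    (mfderiv (𝓡 4) (𝓡 4) (extChartAt (𝓡 4) p) q v : E 4) ∈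
      planeInChart D p (extChartAt (𝓡 4) p q) ↔ v ∈ D.plane q := by
  have h : ∀ x, x = q → ∀ a : E 4, a = v → (a ∈ D.plane x ↔ v ∈ D.plane q) := by
    rintro x rfl a rfl
    rfl
  exact h _ ((extChartAt (𝓡 4) p).left_inv hq) _ (frame_mfderiv_chart' hq v)

lemma mem_vertical_plane_iff (z₀ : Cotangent (E 2)) {z : Cotangent (E 2)}
    (hz : z ∈ (extChartAt cotModel z₀).source) (ξ : TangentSpace cotModel z) :
    ξ ∈ vertical z ↔ (cotVec z₀ z ξ).1 = 0 := by
  have h : (dproj z ξ : E 2) = (cotVec z₀ z ξ).1 :=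
    (dproj_eq hz ξ).trans (congrArg (fun L : E 2 →L[ℝ] E 2 => L (cotVec z₀ z ξ).1)
      (frame_plane z₀.proj _))
  rw [← h]
  exact Iff.rfl

/-- A self-dual Walker manifold is locally isometric to the cotangent bundle of an affine surface,
by isometries that take the null distribution to the vertical one. The surface can be taken to be the
plane: in Walker coordinates, the coefficients of the metric on the fibres extend smoothly from a
neighbourhood of a point to all of `ℝ²`. -/
theorem locallyIsometricWalker_of_isSelfDual (hSD : IsSelfDual g D) : LocallyIsometricWalker g D := by
  intro p
  obtain ⟨Θ, h0, hΘ0, hΘ, hΘt, hΘv, hΘg⟩ := exists_walkerChart D p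
  set ψ := extChartAt (𝓡 4) p with hψ
  set G := pull Θ (g.inChart p) with hG
  have hGsmooth : ContDiffOn ℝ ∞ G Θ.source := by
    have := hΘ.contDiffOn_pull (contDiffOn_inChart g p)
    exact this.mono fun c hc => ⟨hc, hΘt c hc⟩
  have hQ : ContDiffOn ℝ ∞ (horizontal G) Θ.source :=
    contDiffOn_bilin_iff.2 fun u v => contDiffOn_bilin_iff.1 hGsmooth (u, 0) (v, 0)
  obtain ⟨X, T, Γ, Φ, hX, hT, hΓ, hΦ, hΓs, hΦs, hform⟩ := exists_base_tensors Θ.open_source h0 hQ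
    (fun c _ u v => g.symm _ _ _)
    (fun c hc s t => fibre_equation_of_isSelfDual hSD hΘ hΘt hΘv hΘg hc s t)
  -- the chart at `z₀` is the canonical identification of the cotangent bundle with `ℝ² × (ℝ²)*`
  let z₀ : Cotangent (E 2) := ⟨0, 0⟩
  obtain ⟨F, hpF, hF⟩ := exists_partialDiffeomorph_cotangent p hΘ h0 hΘ0 z₀
  have hsrc : ∀ z : Cotangent (E 2), z ∈ (extChartAt cotModel z₀).source := fun z => by
    rw [extChartAt_cotangent_plane_source]; trivial
  have hloc : ∀ q ∈ F.source, IsLocalDiffeomorphAt (𝓡 4) cotModel ∞ F q :=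
    fun q hq => ⟨F, hq, fun _ _ => rfl⟩
  -- the differential of `F` in coordinates
  have hdF : ∀ q ∈ F.source, ∀ v : E 4, cotVec z₀ (F q) (mfderiv (𝓡 4) cotModel F q v) =
      fderiv ℝ Θ.symm (ψ q) (mfderiv (𝓡 4) (𝓡 4) ψ q v) := by
    intro q hq v
    have : IsManifold (𝓡 4) 1 N := IsManifold.of_le (n := ∞) (by simp)
    have h1 := mfderiv_comp (I := 𝓡 4) (I' := cotModel) (I'' := 𝓘(ℝ, Cot)) q
      (g := extChartAt cotModel z₀) (f := F)
      (mdifferentiableAt_extChartAt_cotangent (hsrc _)) ((hloc q hq).mdifferentiableAt (by simp))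
    have h2 := mfderiv_comp (I := 𝓡 4) (I' := 𝓡 4) (I'' := 𝓘(ℝ, Cot)) q (g := Θ.symm) (f := ψ)
      ((hΘ.symm.differentiableAt (hF q hq).2.1).mdifferentiableAt)
      (mdifferentiableAt_extChartAt (by rw [← extChartAt_source (I := 𝓡 4)]; exact (hF q hq).1))
    have h3 : extChartAt cotModel z₀ ∘ F =ᶠ[𝓝 q] Θ.symm ∘ ψ := by
      filter_upwards [F.open_source.mem_nhds hq] with q' hq' using (hF q' hq').2.2
    rw [h3.mfderiv_eq, h2, mfderiv_eq_fderiv] at h1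
    exact (congrArg (fun L : E 4 →L[ℝ] Cot => L v) h1).symm
  let d := planeData X T Γ Φ hX hT hΓ hΦ hΓs hΦs
  refine ⟨E 2, inferInstance, inferInstance, inferInstance, inferInstance, inferInstance, d, F,
    ⟨hloc p hpF, ?_⟩, ?_⟩
  · have hc : Tendsto (fun q => Θ.symm (ψ q)) (𝓝 p) (𝓝 0) := by
      have h1 : ContinuousAt ψ p := continuousAt_extChartAt p
      have h2 : ContinuousAt Θ.symm (ψ p) := by
        rw [← hΘ0]
        exact (hΘ.symm.differentiableAt (Θ.map_source h0)).continuousAt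
      have h3 := ContinuousAt.comp (f := ψ) (g := Θ.symm) h2 h1
      have h4 : Θ.symm (ψ p) = 0 := by rw [← hΘ0, Θ.left_inv h0]
      rw [ContinuousAt, Function.comp_apply, h4] at h3
      exact h3
    filter_upwards [F.open_source.mem_nhds hpF, hc.eventually hform] with q hq hq' v w
    obtain ⟨hqs, hqt, hqF⟩ := hF q hq
    set c := Θ.symm (ψ q) with hcdef
    have hcs : c ∈ Θ.source := Θ.map_target hqt
    have hΘc : Θ c = ψ q := Θ.right_inv hqt
    refine (extension_eq d (hsrc _) _ _).trans ?_
    rw [hdF q hq v, hdF q hq w, baseForm_plane hX hT hΓ hΦ hΓs hΦs z₀ (F q) c hqF, ← hq',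
      horizontal_apply, ← hΘg c hcs, hG, pull_apply, hΘc]
    have h1 : ∀ v w : E 4, g.inChart p (ψ q) (fderiv ℝ Θ c (fderiv ℝ Θ.symm (ψ q) v))
        (fderiv ℝ Θ c (fderiv ℝ Θ.symm (ψ q) w)) = g.inChart p (ψ q) v w := fun v w => by
      rw [hΘ.fderiv_fderiv_symm hqt, hΘ.fderiv_fderiv_symm hqt]
    exact (h1 _ _).trans (inChart_mfderiv_chart hqs v w)
  · filter_upwards [F.open_source.mem_nhds hpF] with q hq v
    obtain ⟨hqs, hqt, hqF⟩ := hF q hq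
    have hcs := Θ.map_target hqt
    have hΘc := Θ.right_inv hqt
    rw [mem_vertical_plane_iff z₀ (hsrc _), hdF q hq v]
    refine (fst_eq_zero_iff_mem (A := fderiv ℝ Θ (Θ.symm (ψ q))) (finrank_planeInChart D
      ((extChartAt (𝓡 4) p).map_source hqs)) (hΘ.fderiv_fderiv_symm hqt) (fun c => ?_)
      (fun β => ?_) _).trans (mfderiv_chart_mem_planeInChart hqs v)
    · have := hΘ.fderiv_symm_fderiv hcs c
      rwa [hΘc] at this
    · have := hΘv _ hcs β
      rwa [hΘc] at this

end SelfDual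

end Walker

end

theorem theorem7p2 {N : Type*} [TopologicalSpace N] [T2Space N] [SecondCountableTopology N]
    [ChartedSpace (Walker.E 4) N] [IsManifold (𝓡 4) ∞ N]
    (g : Walker.Metric N) (D : Walker.WalkerDistribution g) :
    (Walker.IsSelfDual g D ↔ Walker.LocallyIsometricOriented g D) ∧
      (Walker.IsSelfDual g D ↔ Walker.LocallyIsometricWalker g D) := by
  have hWO : Walker.LocallyIsometricWalker g D → Walker.LocallyIsometricOriented g D := by
    intro h p
    obtain ⟨S, i₁, i₂, i₃, i₄, i₅, d, f, hf, hD⟩ := h p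
    exact ⟨S, i₁, i₂, i₃, i₄, i₅, d, f, hf,
      Walker.preservesOrientationAt_of_preservesDistributionAt hf hD⟩
  have hOS : Walker.LocallyIsometricOriented g D → Walker.IsSelfDual g D := by
    intro h p b hb u v w z
    obtain ⟨S, _, _, _, _, _, d, f, hf, ho⟩ := h p
    exact Walker.weylMinus_eq_zero_of_isometry D d hf ho b hb u v w z
  have hSW : Walker.IsSelfDual g D → Walker.LocallyIsometricWalker g D :=
    Walker.locallyIsometricWalker_of_isSelfDual
  exact ⟨⟨fun h => hWO (hSW h), hOS⟩, hSW, fun h => hOS (hWO h)⟩
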